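/- **Model.** Let $n=s^2$ with $s\ge 1$, and let $G$ be the $s\times s$ square grid graph. The nodes of $G$ are anonymous and memoryless. The grid is unoriented: at every node $v$ the incident edges are labelled by distinct port numbers $1,\dots,\deg v$, chosen arbitrarily, with no relation between the two port numbers of an edge. There are $k\le n$ non-faulty robots, placed arbitrarily on the nodes (several robots may share a node), with pairwise distinct identifiers of at most $c(\lfloor\log_2 k\rfloor+1)$ bits, where $c$ is a constant. All robots run the same deterministic algorithm, in synchronous rounds, starting simultaneously. A robot initially knows $n$ and its own identifier. In each round every robot sees the degree of its node, the port through which it entered the node (if it moved in the previous round), its own memory and the memories of the other robots on the same node; from this it computes its new memory content and either stays or moves to a neighbouring node through a port of its choice. A robot may terminate, after which it neither moves nor changes its memory. *Dispersion* is solved when every node holds at most one robot and all robots have terminated. **Theorem.** For every constant $c$ there are a constant $C$ and a deterministic algorithm which, for every $s\ge1$ and $n=s^2$, every port labelling of the $s\times s$ grid, every $k\le n$, every choice of distinct identifiers as above and every initial placement of the $k$ robots, solves dispersion within $195\sqrt n$ rounds (in particular in $O(\sqrt n)$ rounds), using at most $C\log_2 n$, that is $O(\log n)$, bits of memory per robot.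 -/

import Mathlib

/-- The `s × s` square grid: the Cartesian product of two paths on `s` vertices. -/
abbrev squareGrid (s : ℕ) : SimpleGraph (Fin s × Fin s) :=
  (SimpleGraph.pathGraph s).boxProd (SimpleGraph.pathGraph s)

/-- The degree of a node in a finite graph. -/
noncomputable def nodeDegree {V : Type} (G : SimpleGraph V) (v : V) : ℕ :=
  (G.neighborSet v).ncard

/-- An arbitrary port labelling: at every node `v` the incident edges carry the distinct port
numbers `1, …, deg v`.  `port v u` is the port number at `v` of the edge `{v, u}`; it is unrelated
to `port u v`.  (Values at non-adjacent pairs are irrelevant.) -/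
structure PortLabeling {V : Type} (G : SimpleGraph V) where
  port : V → V → ℕ
  bijOn : ∀ v, Set.BijOn (port v) (G.neighborSet v) (Set.Icc 1 (nodeDegree G v))

open Classical in
/-- The node reached from `v` through port `p`; a robot that names a non-existent port stays. -/
noncomputable def PortLabeling.follow {V : Type} {G : SimpleGraph V} (L : PortLabeling G)
    (v : V) (p : ℕ) : V :=
  if h : ∃ u, G.Adj v u ∧ L.port v u = p then h.choose else v

/-- A deterministic protocol, the same for all robots.  `State` is the set of possible contents of
a robot's whole memory.  A robot starts with a memory content that depends only on its identifier.
In each round it sees the degree of its node, the port through which it has entered the node in the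
previous round (`none` if it did not move), its own memory and the memories of the other robots at
the same node; from this it computes its new memory content and the port through which it leaves
(`none` to stay).  Memory contents in `halted` mean that the robot has terminated. -/
structure Protocol where
  State : Type
  init : ℕ → State
  halted : Set State
  step : (degree : ℕ) → (entry : Option ℕ) → (own : State) → (others : Multiset State) →
    State × Option ℕ

/-- The memory of a robot fits into `b` bits. -/
def Protocol.UsesBits (P : Protocol) (b : ℕ) : Prop :=
  Finite P.State ∧ Nat.card P.State ≤ 2 ^ b

/-- The current situation of one robot: the node on which it is, the content of its memory, and the
port through which it entered the node in the previous round, if it moved. -/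
structure RobotStatus (V : Type) (S : Type) where
  pos : V
  mem : S
  entry : Option ℕ

/-- A configuration of `k` robots. -/
abbrev Configuration (V : Type) (S : Type) (k : ℕ) := Fin k → RobotStatus V S

namespace Configuration

variable {V S : Type} {k : ℕ}

open Classical in
/-- The memory contents of the robots co-located with robot `i`, other than `i` itself. -/
noncomputable def others (c : Configuration V S k) (i : Fin k) : Multiset S :=
  (Finset.univ.filter fun j => j ≠ i ∧ (c j).pos = (c i).pos).val.map fun j => (c j).mem

end Configuration

namespace Protocol

variable {V : Type} {G : SimpleGraph V} {k : ℕ}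

open Classical in
/-- The outcome for a robot that is on node `v`, stores `m` and leaves through port `q`. -/
noncomputable def move (P : Protocol) (L : PortLabeling G) (v : V) (m : P.State) :
    Option ℕ → RobotStatus V P.State
  | none => ⟨v, m, none⟩
  | some p =>
      let w := L.follow v p
      ⟨w, m, if w = v then none else some (L.port w v)⟩

open Classical in
/-- One synchronous Communicate-Compute-Move round, executed by all robots simultaneously.
A terminated robot neither moves nor changes its memory. -/
noncomputable def round (P : Protocol) (L : PortLabeling G) (c : Configuration V P.State k) :
    Configuration V P.State k := fun i =>
  if (c i).mem ∈ P.halted then c i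
  else
    let r := P.step (nodeDegree G (c i).pos) (c i).entry (c i).mem (c.others i)
    P.move L (c i).pos r.1 r.2

/-- The initial configuration: robot `i` has identifier `ident i` and is on node `start i`. -/
def initial (P : Protocol) (ident : Fin k → ℕ) (start : Fin k → V) :
    Configuration V P.State k :=
  fun i => ⟨start i, P.init (ident i), none⟩

/-- The configuration after `t` rounds. -/
noncomputable def run (P : Protocol) (L : PortLabeling G) (ident : Fin k → ℕ)
    (start : Fin k → V) (t : ℕ) : Configuration V P.State k :=
  (P.round L)^[t] (P.initial ident start)

/-- Dispersion is achieved in configuration `c`: no node carries two robots and all robots have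
terminated (hence the configuration never changes again). -/
def Dispersed (P : Protocol) (c : Configuration V P.State k) : Prop :=
  (∀ i j, (c i).pos = (c j).pos → i = j) ∧ ∀ i, (c i).mem ∈ P.halted

end Protocol

/-! ### Ports -/

namespace PortLabeling

variable {V : Type} {G : SimpleGraph V} (L : PortLabeling G)

/-! All robots start together and know `n`, so the algorithm is a fixed list of rounds driven by a
clock. The difficulty is to make local information suffice on a grid without directions. Write `s =
m + 1`.

Robots that are alone on their node settle. Robots that share a node form a group, which walks
straight to the boundary, recognizable by degrees less than 4. Keeping the direction needs two
parties. At an inner node `v` entered from an inner node `a`, a neighbour `x ≠ a` of `v` lies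
straight ahead exactly if `a` and `x` have no common neighbour besides `v`. This is tested by
sending the anchor to `a` and the scouts to `x`, and by trying all pairs of onward ports for a
meeting (`exists_meets_iff`, `Heading.exists_opposite`, `trials_spec`). Within `m + 1` steps all
groups have dissolved into walkers on the boundary (`outwardPart_spec`).

The boundary is a cycle of length `4 m`, and a walker that never turns back follows it. Every node
that a walker leaves carries a settled robot. So after one turn either nobody walks and the robots
are already dispersed, or every boundary node carries a settled robot (`settlePart_spec`). In the
first case the rest of the program has no effect (`finalPart_inert`). In the second case the
remaining walkers go to corners and then make a tour. The walker of least identifier thereby gives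
the settled boundary robots a common numbering that starts at a corner, which breaks the symmetry of
the grid (`tourPart_spec`).

The robots numbered `0, …, m` fill one side. They sweep over the grid as a front and carry all other
robots to the opposite side (`sweepPart_spec`), where they act as signposts for the columns. The
others gather in a corner, rank themselves by identifier, and the robot of rank `r` goes to column
`r % s` and to height `r / s + 1` above the front. At most `s ^ 2 - s` robots are not in the front,
so heights up to `m` suffice (`stacked_of_rank`, `stackPart_spec`).

On the boundary and in all later motions a robot finds its way by probing: it visits every
neighbour, returns, and selects a port whose far end passes a test (`perform_probes`). Each step
costs boundedly many rounds, and there are `O(m)` steps. The memory consists of a clock and twelve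
bounded numbers. -/

theorem port_mem {v u : V} (h : G.Adj v u) : L.port v u ∈ Set.Icc 1 (nodeDegree G v) :=
  (L.bijOn v).mapsTo h

theorem port_inj {v u w : V} (hu : G.Adj v u) (hw : G.Adj v w)
    (h : L.port v u = L.port v w) : u = w :=
  (L.bijOn v).injOn hu hw h

theorem follow_port {v u : V} (h : G.Adj v u) : L.follow v (L.port v u) = u := by
  have hex : ∃ w, G.Adj v w ∧ L.port v w = L.port v u := ⟨u, h, rfl⟩
  rw [follow, dif_pos hex]
  exact L.port_inj hex.choose_spec.1 h hex.choose_spec.2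

theorem exists_port_eq {v : V} {p : ℕ} (h : p ∈ Set.Icc 1 (nodeDegree G v)) :
    ∃ u, G.Adj v u ∧ L.port v u = p :=
  (L.bijOn v).surjOn h

theorem adj_follow {v : V} {p : ℕ} (h : p ∈ Set.Icc 1 (nodeDegree G v)) :
    G.Adj v (L.follow v p) := by
  obtain ⟨u, hu, rfl⟩ := L.exists_port_eq h
  rwa [L.follow_port hu]

theorem port_follow {v : V} {p : ℕ} (h : p ∈ Set.Icc 1 (nodeDegree G v)) :
    L.port v (L.follow v p) = p := by
  obtain ⟨u, hu, rfl⟩ := L.exists_port_eq h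
  rw [L.follow_port hu]

theorem follow_of_notMem {v : V} {p : ℕ} (h : p ∉ Set.Icc 1 (nodeDegree G v)) :
    L.follow v p = v := by
  rw [follow, dif_neg]
  rintro ⟨u, hu, rfl⟩
  exact h (L.port_mem hu)

theorem follow_ne_iff {v : V} {p : ℕ} :
    L.follow v p ≠ v ↔ p ∈ Set.Icc 1 (nodeDegree G v) := by
  refine ⟨fun h => by_contra fun hp => h (L.follow_of_notMem hp), fun h he => ?_⟩
  exact (L.adj_follow h).ne he.symm

theorem adj_of_follow_ne {v : V} {p : ℕ} (h : L.follow v p ≠ v) : G.Adj v (L.follow v p) :=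
  L.adj_follow (L.follow_ne_iff.1 h)

open Classical in
/-- The status of a robot with memory `m` that leaves the node `v` as prescribed. -/
noncomputable def relocate {S : Type} (v : V) (m : S) : Option ℕ → RobotStatus V S
  | none => ⟨v, m, none⟩
  | some p => ⟨L.follow v p, m,
      if L.follow v p = v then none else some (L.port (L.follow v p) v)⟩

section relocate

variable {S : Type} (v : V) (m : S)

@[simp] theorem relocate_none : L.relocate v m none = ⟨v, m, none⟩ := rfl

@[simp] theorem relocate_mem (q : Option ℕ) : (L.relocate v m q).mem = m := by
  cases q <;> rfl

@[simp] theorem relocate_some_pos (p : ℕ) : (L.relocate v m (some p)).pos = L.follow v p := rfl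

theorem relocate_port {u : V} (h : G.Adj v u) :
    L.relocate v m (some (L.port v u)) = ⟨u, m, some (L.port u v)⟩ := by
  simp [relocate, L.follow_port h, h.ne']

theorem relocate_some {p : ℕ} (h : p ∈ Set.Icc 1 (nodeDegree G v)) :
    L.relocate v m (some p) = ⟨L.follow v p, m, some (L.port (L.follow v p) v)⟩ := by
  simp [relocate, L.follow_ne_iff.2 h]

theorem relocate_of_notMem {p : ℕ} (h : p ∉ Set.Icc 1 (nodeDegree G v)) :
    L.relocate v m (some p) = ⟨v, m, none⟩ := by
  simp [relocate, L.follow_of_notMem h]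

/-- Robots copy entry ports into their memories, so the memory bound rests on this. -/
theorem relocate_entry_le {q : Option ℕ} {p : ℕ} (h : (L.relocate v m q).entry = some p) :
    ∃ u, p ≤ nodeDegree G u := by
  cases q with
  | none => simp at h
  | some q =>
    by_cases hq : q ∈ Set.Icc 1 (nodeDegree G v)
    · rw [L.relocate_some v m hq] at h
      simp only [Option.some.injEq] at h
      exact ⟨_, h ▸ (L.port_mem (L.adj_follow hq).symm).2⟩
    · rw [L.relocate_of_notMem v m hq] at h
      simp at h

end relocate

end PortLabeling

theorem Configuration.mem_others {V S : Type} {k : ℕ} {c : Configuration V S k} {i : Fin k}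
    {σ : S} : σ ∈ c.others i ↔ ∃ j, j ≠ i ∧ (c j).pos = (c i).pos ∧ (c j).mem = σ := by
  simp [Configuration.others, and_assoc]

/-! ### Straight-line programs -/

/-- The rule of one round for robots with memory type `S`. -/
abbrev RoundRule (S : Type) := ℕ → Option ℕ → S → Multiset S → S × Option ℕ

section programs

variable {V S : Type} {G : SimpleGraph V} {k : ℕ} (L : PortLabeling G)

/-- One round in which all robots obey the rule `f`. -/
noncomputable def applyRule (f : RoundRule S) (c : Configuration V S k) :
    Configuration V S k := fun i =>
  L.relocate (c i).pos (f (nodeDegree G (c i).pos) (c i).entry (c i).mem (c.others i)).1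
    (f (nodeDegree G (c i).pos) (c i).entry (c i).mem (c.others i)).2

/-- Successive rounds with the rules listed in `prog`. -/
noncomputable def perform (prog : List (RoundRule S)) (c : Configuration V S k) :
    Configuration V S k :=
  prog.foldl (fun c f => applyRule L f c) c

@[simp] theorem perform_nil (c : Configuration V S k) : perform L [] c = c := rfl

@[simp] theorem perform_cons (f : RoundRule S) (prog : List (RoundRule S))
    (c : Configuration V S k) :
    perform L (f :: prog) c = perform L prog (applyRule L f c) := rfl

theorem perform_append (p q : List (RoundRule S)) (c : Configuration V S k) :
    perform L (p ++ q) c = perform L q (perform L p c) := by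
  simp [perform, List.foldl_append]

theorem perform_flatMap_range_succ (p : ℕ → List (RoundRule S)) (N : ℕ)
    (c : Configuration V S k) :
    perform L ((List.range (N + 1)).flatMap p) c =
      perform L (p N) (perform L ((List.range N).flatMap p) c) := by
  simp [List.range_succ, List.flatMap_append, perform_append]

theorem applyRule_mem (f : RoundRule S) (c : Configuration V S k) (i : Fin k) :
    (applyRule L f c i).mem =
      (f (nodeDegree G (c i).pos) (c i).entry (c i).mem (c.others i)).1 := by
  simp [applyRule]

/-- A property of configurations that every rule of a program preserves is preserved by the
program. -/
theorem perform_induction {prog : List (RoundRule S)} (I : Configuration V S k → Prop)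
    (h : ∀ f ∈ prog, ∀ c, I c → I (applyRule L f c)) {c : Configuration V S k} (hc : I c) :
    I (perform L prog c) := by
  induction prog generalizing c with
  | nil => exact hc
  | cons f prog ih =>
    exact ih (fun g hg => h g (List.mem_cons_of_mem _ hg)) (h f List.mem_cons_self c hc)

end programs

/-! ### Protocols that execute a program -/

section clocked

variable {S : Type}

open Classical in
/-- `σ` if it belongs to `M`, and `d` otherwise. -/
noncomputable def confine {M : Set S} (d : M) (σ : S) : M := if h : σ ∈ M then ⟨σ, h⟩ else d

theorem coe_confine {M : Set S} (d : M) {σ : S} (h : σ ∈ M) : (confine d σ : S) = σ := by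
  simp [confine, h]

/-- The protocol that executes a program by means of a clock, with memory contents restricted to
the set `M`. -/
noncomputable def clockedProtocol (prog : List (RoundRule S)) (start : ℕ → S) (M : Set S)
    (d : M) : Protocol where
  State := Fin (prog.length + 1) × M
  init a := (0, confine d (start a))
  halted := {x | x.1 = Fin.last _}
  step deg e own o :=
    if h : (own.1 : ℕ) < prog.length then
      let r := prog[(own.1 : ℕ)] deg e own.2 (o.map fun x => (x.2 : S))
      ((⟨own.1 + 1, by omega⟩, confine d r.1), r.2)
    else (own, none)

/-- A program keeps the memory contents within `M` if entry ports are at most `D`. -/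
def RoundRule.Keeps (f : RoundRule S) (M : Set S) (D : ℕ) : Prop :=
  ∀ deg e σ o, (∀ p ∈ e, p ≤ D) → σ ∈ M → (∀ τ ∈ o, τ ∈ M) → Multiset.card o < D →
    (f deg e σ o).1 ∈ M

variable {V : Type} {G : SimpleGraph V} {k : ℕ} (L : PortLabeling G)

/-- A robot does not see itself, whence the strict inequality. It leaves room for the `+ 1` in the
height assigned by `rankRule`. -/
theorem card_others_lt {c : Configuration V S k} (i : Fin k) :
    Multiset.card (c.others i) < k := by
  classical
  simp only [Configuration.others, Multiset.card_map, Finset.card_val]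
  calc _ < (Finset.univ : Finset (Fin k)).card := by
        apply Finset.card_lt_card
        refine (Finset.filter_ssubset).2 ⟨i, Finset.mem_univ _, by simp⟩
    _ = k := by simp

/-- The invariant must carry the bound on entry ports along with the memory, since a rule may store
its entry port. -/
theorem perform_mem_of_keeps {prog : List (RoundRule S)} {M : Set S} {D : ℕ}
    (hD : ∀ v, nodeDegree G v ≤ D) (hk : k ≤ D) (hprog : ∀ f ∈ prog, RoundRule.Keeps f M D)
    {c : Configuration V S k}
    (hc : ∀ i, (c i).mem ∈ M ∧ ∀ p ∈ (c i).entry, p ≤ D) (i : Fin k) :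
    (perform L prog c i).mem ∈ M := by
  refine (perform_induction L (fun c => ∀ i, (c i).mem ∈ M ∧ ∀ p ∈ (c i).entry, p ≤ D)
    (fun f hf c hc i => ⟨?_, ?_⟩) hc i).1
  · rw [applyRule_mem]
    refine hprog f hf _ _ _ _ (hc i).2 (hc i).1 ?_ ((card_others_lt i).trans_le hk)
    intro τ hτ
    obtain ⟨j, -, -, rfl⟩ := Configuration.mem_others.1 hτ
    exact (hc j).1
  · intro p hp
    obtain ⟨u, hu⟩ := L.relocate_entry_le _ _ hp
    exact hu.trans (hD u)

/-- Simulation in lockstep: as long as memories stay in `M`, `confine` is the identity and the clock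
counts the elapsed rounds. Correctness can then be proved for `perform`, without clock and without
bounds. -/
theorem clockedProtocol_run {prog : List (RoundRule S)} {start : ℕ → S} {M : Set S} {d : M}
    {D : ℕ} (hD : ∀ v, nodeDegree G v ≤ D) (hk : k ≤ D)
    (hprog : ∀ f ∈ prog, RoundRule.Keeps f M D) {ident : Fin k → ℕ}
    (hstart : ∀ i, start (ident i) ∈ M) (pos : Fin k → V) {t : ℕ} (ht : t ≤ prog.length)
    (i : Fin k) :
    let r := (clockedProtocol prog start M d).run L ident pos t i
    let c := perform L (prog.take t) (fun i => ⟨pos i, start (ident i), none⟩) i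
    r.pos = c.pos ∧ r.entry = c.entry ∧ (r.mem.1 : ℕ) = t ∧ (r.mem.2 : S) = c.mem := by
  induction t generalizing i with
  | zero =>
    simp [Protocol.run, Protocol.initial, clockedProtocol, coe_confine, hstart]
  | succ t ih =>
    have ht' : t < prog.length := ht
    have ih := ih ht'.le
    have hM := perform_mem_of_keeps L hD hk
      (fun f hf => hprog f (List.mem_of_mem_take hf))
      (prog := prog.take (t + 1)) (c := fun i => ⟨pos i, start (ident i), none⟩)
      (fun i => ⟨hstart i, by simp⟩) i
    intro r c
    have hr : r = (clockedProtocol prog start M d).round L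
        ((clockedProtocol prog start M d).run L ident pos t) i := by
      simp only [r, Protocol.run, Function.iterate_succ', Function.comp_apply]
    have htake : prog.take (t + 1) = prog.take t ++ [prog[t]] := by
      rw [List.take_add_one, List.getElem?_eq_getElem ht']; rfl
    generalize hb : (clockedProtocol prog start M d).run L ident pos t = b at *
    have hc : c = applyRule L prog[t] (perform L (prog.take t)
        (fun i => ⟨pos i, start (ident i), none⟩)) i := by
      simp only [c, htake, perform_append, perform_cons, perform_nil]
    change c.mem ∈ M at hM
    generalize hx : perform L (prog.take t) (fun i => ⟨pos i, start (ident i), none⟩) = x at *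
    have hoth : (b.others i).map (fun y => (y.2 : S)) = x.others i := by
      classical
      simp only [Configuration.others, Multiset.map_map, Function.comp_def, (ih _).2.2.2]
      congr 2
      exact Finset.filter_congr fun j _ => by rw [(ih j).1, (ih i).1]
    obtain ⟨h1, h2, h3, h4⟩ := ih i
    have hnot : (b i).mem ∉ (clockedProtocol prog start M d).halted := by
      intro h
      have : (b i).mem.1 = Fin.last _ := h
      rw [this] at h3
      simp at h3
      omega
    have hlt : ((b i).mem.1 : ℕ) < prog.length := by omega
    rw [hc, applyRule_mem] at hM
    have hstep : (clockedProtocol prog start M d).step (nodeDegree G (b i).pos) (b i).entry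
        (b i).mem (b.others i) =
        ((⟨t + 1, by omega⟩, confine d (prog[t] (nodeDegree G (x i).pos) (x i).entry (x i).mem (x.others i)).1),
          (prog[t] (nodeDegree G (x i).pos) (x i).entry (x i).mem (x.others i)).2) := by
      simp only [clockedProtocol] at hoth ⊢
      rw [dif_pos hlt]
      have hget : prog[((b i).mem.1 : ℕ)]'hlt = prog[t] := getElem_congr_idx h3
      simp only [hoth, h1, h2, h3, h4]
      rw [hget]
    have hr' : r = (clockedProtocol prog start M d).move L (b i).pos
        (⟨t + 1, by omega⟩, confine d (prog[t] (nodeDegree G (x i).pos) (x i).entry (x i).mem (x.others i)).1)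
        (prog[t] (nodeDegree G (x i).pos) (x i).entry (x i).mem (x.others i)).2 := by
      rw [hr, Protocol.round, if_neg hnot, hstep]
    rw [hr', hc, applyRule, h1]
    generalize (prog[t] (nodeDegree G (x i).pos) (x i).entry (x i).mem (x.others i)) = q at *
    obtain ⟨σ, q⟩ := q
    cases q with
    | none => simp [Protocol.move, coe_confine d hM]
    | some p => simp [Protocol.move, PortLabeling.relocate, coe_confine d hM]

/-- All clocks reach their last value at the same time, so no robot halts early and only the final
positions remain to be compared. -/
theorem clockedProtocol_dispersed {prog : List (RoundRule S)} {start : ℕ → S} {M : Set S} {d : M}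
    {D : ℕ} (hD : ∀ v, nodeDegree G v ≤ D) (hk : k ≤ D)
    (hprog : ∀ f ∈ prog, RoundRule.Keeps f M D) {ident : Fin k → ℕ}
    (hstart : ∀ i, start (ident i) ∈ M) (pos : Fin k → V)
    (hdisp : ∀ i j,
      (perform L prog (fun i => ⟨pos i, start (ident i), none⟩) i).pos =
        (perform L prog (fun i => ⟨pos i, start (ident i), none⟩) j).pos → i = j) :
    (clockedProtocol prog start M d).Dispersed
      ((clockedProtocol prog start M d).run L ident pos prog.length) := by
  have h := fun i => clockedProtocol_run L (d := d) hD hk hprog hstart pos le_rfl i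
  simp only [List.take_length] at h
  refine ⟨fun i j hij => hdisp i j ?_, fun i => Fin.ext (h i).2.2.1⟩
  rw [← (h i).1, ← (h j).1, hij]

end clocked

/-! ### The memory of a robot and the rules of the algorithm -/

/-- The part that a robot plays. -/
inductive Mode
  /-- stays on its node -/
  | settled
  /-- explores on behalf of a group that moves along a straight line -/
  | scout
  /-- serves as the landmark of a group that moves along a straight line -/
  | anchor
  /-- walks along the boundary -/
  | walker
  /-- belongs to the front that sweeps over the grid -/
  | sweeper

/-- The long-term memory of a robot. -/
structure Core where
  id : ℕ
  mode : Mode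
  /-- least identifier of the group -/
  tag : ℕ
  /-- successor of the least identifier of a walker that has passed -/
  best : ℕ
  /-- position along the boundary tour of that walker -/
  idx : ℕ
  /-- port of the previous node -/
  back : ℕ
  /-- successor of the current column -/
  col : ℕ
  /-- final column -/
  tcol : ℕ
  /-- final height above the row of the sweepers -/
  ht : ℕ

/-- The memory of a robot: long-term memory and scratch variables. -/
structure Mem where
  core : Core
  /-- the port selected for the next step -/
  cand : ℕ
  /-- the port leading back to the group -/
  ret : ℕ
  /-- whether the partner has been met -/
  met : Bool

/-- The initial memory of the robot with identifier `a`. -/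
def initialMem (a : ℕ) : Mem := ⟨⟨a, .settled, 0, 0, 0, 0, 0, 0, 0⟩, 0, 0, false⟩

/-- The robot belongs to a group that moves along a straight line. -/
def Core.Grouped (κ : Core) : Prop := κ.mode = .scout ∨ κ.mode = .anchor

/-- The robot walks along the boundary. -/
def Core.Walks (κ : Core) : Prop := κ.mode = .walker

/-- The robot belongs to the front. -/
def Core.Sweeps (κ : Core) : Prop := κ.mode = .sweeper

/-- The port that follows the port `e` cyclically at distance `i + 1`, at a node of degree `d`. -/
def turn (d e i : ℕ) : ℕ := (e + i) % d + 1

open Classical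

section rules

/-- Active robots leave through port `p`. -/
noncomputable def outRule (A : Core → Prop) (p : ℕ) : RoundRule Mem := fun _ _ σ _ =>
  (σ, if A σ.core then some p else none)

/-- Active robots that have left through port `p` examine the node reached with the test `Q`, which
may depend on the port, the degree, and the memories found there, and return. -/
noncomputable def checkRule (A : Core → Prop) (Q : ℕ → ℕ → Core → Set Core → Prop) (p : ℕ) :
    RoundRule Mem := fun d e σ o =>
  if A σ.core then
    (if e.isSome ∧ Q p d σ.core {κ | ∃ τ ∈ o, τ.core = κ} then { σ with cand := p } else σ, e)
  else (σ, none)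

/-- Active robots examine the nodes behind the ports `1, …, D`. -/
noncomputable def probes (A : Core → Prop) (Q : ℕ → ℕ → Core → Set Core → Prop) (D : ℕ) :
    List (RoundRule Mem) :=
  (List.range D).flatMap fun p => [outRule A (p + 1), checkRule A Q (p + 1)]

/-- Active robots leave through the selected port if the degree of their node satisfies `go`. -/
noncomputable def advanceRule (A : Core → Prop) (go : ℕ → Prop) : RoundRule Mem := fun d _ σ _ =>
  (σ, if A σ.core ∧ go d then some σ.cand else none)

/-- Active robots memorize the port of the previous node. -/
noncomputable def orientRule (A : Core → Prop) : RoundRule Mem := fun _ e σ _ =>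
  (if A σ.core then { σ with core := { σ.core with back := e.getD 0 }, cand := 0 } else σ, none)

/-- Robots that share their node form groups. -/
noncomputable def formRule : RoundRule Mem := fun d _ σ o =>
  if o = 0 then (σ, none) else
    ({ σ with core := { σ.core with
        tag := sInf {a | a = σ.core.id ∨ ∃ τ ∈ o, τ.core.id = a}
        mode := if σ.core.id = sInf {a | a = σ.core.id ∨ ∃ τ ∈ o, τ.core.id = a}
          then .anchor else .scout } },
      if d < 4 then none else some 1)

/-- A group that has reached the boundary dissolves; the others prepare the next step. -/
noncomputable def alignRule : RoundRule Mem := fun d e σ _ =>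
  (if σ.core.Grouped then
    if d < 4 then { σ with core := { σ.core with mode := .walker } }
    else { σ with core := { σ.core with back := e.getD 0 }, cand := 0 }
  else σ, none)

/-- Scouts leave through the `q`-th port after the one they came through, anchors go back. -/
noncomputable def departRule (q : ℕ) : RoundRule Mem := fun _ _ σ _ =>
  if σ.core.Grouped then
    ({ σ with met := false },
      some (if σ.core.mode = .scout then turn 4 σ.core.back q else σ.core.back))
  else (σ, none)

/-- The port leading back to the group is memorized. -/
noncomputable def recordRule : RoundRule Mem := fun _ e σ _ =>
  (if σ.core.Grouped then { σ with ret := e.getD 0 } else σ, none)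

/-- Scouts and anchors visit further nodes. -/
noncomputable def spreadRule (i j : ℕ) : RoundRule Mem := fun d _ σ _ =>
  (σ, if σ.core.Grouped then
    some (turn d σ.ret (if σ.core.mode = .scout then j else i)) else none)

/-- Scouts and anchors note whether they meet, and return. -/
noncomputable def meetRule : RoundRule Mem := fun _ e σ o =>
  if σ.core.Grouped then
    ({ σ with met := σ.met || decide (∃ τ ∈ o, τ.core.Grouped ∧ τ.core.tag = σ.core.tag ∧
        τ.core.mode ≠ σ.core.mode) }, e)
  else (σ, none)

/-- The group reunites, and selects the `q`-th port if scouts and anchor have never met. -/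
noncomputable def rejoinRule (q : ℕ) : RoundRule Mem := fun _ _ σ _ =>
  if σ.core.Grouped then
    ({ σ with cand := if σ.met then σ.cand else turn 4 σ.core.back q }, some σ.ret)
  else (σ, none)

/-- The excursions in which scouts and anchor try to meet. -/
noncomputable def excursions (l : List (ℕ × ℕ)) : List (RoundRule Mem) :=
  l.flatMap fun x => [spreadRule x.1 x.2, meetRule]

/-- The examination of the `q`-th port. -/
noncomputable def trial (q : ℕ) : List (RoundRule Mem) :=
  departRule q :: recordRule :: (excursions (List.range 3 ×ˢ List.range 3) ++ [rejoinRule q])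

/-- One step of all groups along their straight lines. -/
noncomputable def straightMacro : List (RoundRule Mem) :=
  alignRule :: ((List.range 3).flatMap trial ++ [advanceRule Core.Grouped fun _ => True])

/-- A walker settles if there is no settled robot and no walker with smaller identifier. -/
noncomputable def settleRule : RoundRule Mem := fun _ e σ o =>
  (if σ.core.Walks then
    if (∀ τ ∈ o, τ.core.mode ≠ .settled) ∧ ∀ τ ∈ o, τ.core.Walks → σ.core.id < τ.core.id then
      { σ with core := { σ.core with mode := .settled } }
    else { σ with core := { σ.core with back := e.getD 0 }, cand := 0 }
  else σ, none)

/-- Settled robots note the passing walker of least identifier, and the time `n` of its visit. -/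
noncomputable def noteRule (n : ℕ) : RoundRule Mem := fun _ e σ o =>
  (if σ.core.Walks then { σ with core := { σ.core with back := e.getD 0 }, cand := 0 }
  else if σ.core.mode = .settled ∧ (∃ τ ∈ o, τ.core.Walks) ∧
      (σ.core.best = 0 ∨ sInf {a | ∃ τ ∈ o, τ.core.Walks ∧ τ.core.id = a} + 1 < σ.core.best) then
    { σ with core := { σ.core with
      best := sInf {a | ∃ τ ∈ o, τ.core.Walks ∧ τ.core.id = a} + 1, idx := n } }
  else σ, none)

/-- The next node of a walker is on the boundary and not the previous one. -/
def ringLook (p d : ℕ) (κ : Core) (_ : Set Core) : Prop := d < 4 ∧ p ≠ κ.back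

/-- One step of all walkers along the boundary. -/
noncomputable def ringMacro (f : RoundRule Mem) (go : ℕ → Prop) : List (RoundRule Mem) :=
  f :: (probes Core.Walks ringLook 3 ++ [advanceRule Core.Walks go])

/-- The robots settled on one side of the grid become sweepers. -/
noncomputable def enlistRule (m : ℕ) : RoundRule Mem := fun _ _ σ _ =>
  (if σ.core.mode = .settled ∧ σ.core.best ≠ 0 ∧ σ.core.idx ≤ m then
    { σ with core := { σ.core with mode := .sweeper } } else σ, none)

/-- The next node of a sweeper is not the previous one and carries no sweeper. -/
def sweepLook (p _d : ℕ) (κ : Core) (K : Set Core) : Prop :=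
  p ≠ κ.back ∧ ∀ κ' ∈ K, ¬ κ'.Sweeps

/-- Sweepers advance, and the robots on their nodes go with them. -/
noncomputable def convoyRule : RoundRule Mem := fun _ _ σ o =>
  (σ, if σ.core.Sweeps then some σ.cand else
    if h : ∃ τ ∈ o, τ.core.Sweeps then some h.choose.cand else none)

/-- The front advances by one row. -/
noncomputable def sweepMacro : List (RoundRule Mem) :=
  orientRule Core.Sweeps ::
    (probes (fun κ => κ.Sweeps ∧ Even κ.idx) sweepLook 4 ++
      (probes (fun κ => κ.Sweeps ∧ ¬ Even κ.idx) sweepLook 4 ++ [convoyRule]))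

/-- Robots learn their column from the sweeper on their node. -/
noncomputable def locateRule : RoundRule Mem := fun _ _ σ o =>
  (if σ.core.Sweeps then σ else
    { σ with core := { σ.core with
      col := if h : ∃ τ ∈ o, τ.core.Sweeps then h.choose.core.idx + 1 else 0 }, cand := 0 }, none)

/-- The robot accompanies a sweeper. -/
def Core.Joins (κ : Core) : Prop := ¬ κ.Sweeps ∧ κ.col ≠ 0

/-- The next node belongs to the preceding column. -/
def gatherLook (_p _d : ℕ) (κ : Core) (K : Set Core) : Prop :=
  ∃ κ' ∈ K, κ'.Sweeps ∧ κ'.idx + 2 = κ.col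

/-- The next node belongs to the following column, unless the final column has been reached. -/
def fanLook (_p _d : ℕ) (κ : Core) (K : Set Core) : Prop :=
  κ.col ≠ κ.tcol + 1 ∧ ∃ κ' ∈ K, κ'.Sweeps ∧ κ'.idx = κ.col

/-- The robots that accompany sweepers move to an adjacent column. -/
noncomputable def shiftMacro (Q : ℕ → ℕ → Core → Set Core → Prop) : List (RoundRule Mem) :=
  locateRule :: (probes Core.Joins Q 4 ++ [advanceRule Core.Joins fun _ => True])

/-- The robots gathered around a sweeper are ranked and receive their final places. -/
noncomputable def rankRule (s : ℕ) : RoundRule Mem := fun _ _ σ o =>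
  (if ¬ σ.core.Sweeps ∧ ∃ τ ∈ o, τ.core.Sweeps then
    { σ with core := { σ.core with
      tcol := Multiset.card (o.filter fun τ => ¬ τ.core.Sweeps ∧ τ.core.id < σ.core.id) % s
      ht := Multiset.card (o.filter fun τ => ¬ τ.core.Sweeps ∧ τ.core.id < σ.core.id) / s + 1 } }
  else σ, none)

/-- The selected port is forgotten. -/
def resetRule : RoundRule Mem := fun _ _ σ _ => ({ σ with cand := 0 }, none)

/-- The next node carries no robot of final height at most `h`. -/
def stackLook (h : ℕ) (_p _d : ℕ) (_ : Core) (K : Set Core) : Prop := ∀ κ' ∈ K, h < κ'.ht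

/-- The robots of final height greater than `h` advance by one row. -/
noncomputable def stackMacro (h : ℕ) : List (RoundRule Mem) :=
  resetRule :: (probes (fun κ => h < κ.ht) (stackLook h) 4 ++
    [advanceRule (fun κ => h < κ.ht) fun _ => True])

/-- Robots that share a node form groups, which go to the boundary and dissolve there. -/
noncomputable def outwardPart (m : ℕ) : List (RoundRule Mem) :=
  formRule :: (List.range (m + 1)).flatMap fun _ => straightMacro

/-- Walkers settle on the boundary. -/
noncomputable def settlePart (m : ℕ) : List (RoundRule Mem) :=
  (List.range (4 * m)).flatMap fun _ => ringMacro settleRule fun _ => True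

/-- The remaining walkers go to corners. -/
noncomputable def cornerPart (m : ℕ) : List (RoundRule Mem) :=
  (List.range m).flatMap fun _ => ringMacro (orientRule Core.Walks) fun d => d ≠ 2

/-- The remaining walkers make a tour of the boundary. -/
noncomputable def tourPart (m : ℕ) : List (RoundRule Mem) :=
  (List.range (4 * m)).flatMap fun n => ringMacro (noteRule n) fun _ => True

/-- The sweepers collect all robots on one side of the grid. -/
noncomputable def sweepPart (m : ℕ) : List (RoundRule Mem) :=
  (List.range m).flatMap fun _ => sweepMacro

/-- All robots but the sweepers gather in a corner. -/
noncomputable def gatherPart (m : ℕ) : List (RoundRule Mem) :=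
  (List.range m).flatMap fun _ => shiftMacro gatherLook

/-- All robots move to their final columns. -/
noncomputable def fanPart (m : ℕ) : List (RoundRule Mem) :=
  (List.range m).flatMap fun _ => shiftMacro fanLook

/-- All robots move to their final rows. -/
noncomputable def stackPart (m : ℕ) : List (RoundRule Mem) :=
  (List.range m).flatMap stackMacro

/-- The part of the algorithm that follows after walkers have settled on the boundary. -/
noncomputable def finalPart (m : ℕ) : List (RoundRule Mem) :=
  cornerPart m ++ (tourPart m ++ (enlistRule m :: (sweepPart m ++ (gatherPart m ++
    (rankRule (m + 1) :: (fanPart m ++ stackPart m))))))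

/-- The dispersion algorithm for the square grid of side `m + 1`. -/
noncomputable def dispersionProgram (m : ℕ) : List (RoundRule Mem) :=
  outwardPart m ++ (settlePart m ++ finalPart m)

/-- A trial takes 21 rounds, so a straight step takes 65. A boundary step takes 8, a sweep step 18,
a shift or stacking step 10. Their multiplicities are `m + 1`, `9 * m`, `m` and `3 * m`, and there
are three single rounds. -/
theorem dispersionProgram_length (m : ℕ) : (dispersionProgram m).length = 185 * m + 68 := by
  have h9 : (List.range 3 ×ˢ List.range 3).length = 9 := rfl
  simp [h9, dispersionProgram, outwardPart, settlePart, finalPart, cornerPart, tourPart, sweepPart,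
    gatherPart, fanPart, stackPart, stackMacro, shiftMacro, sweepMacro, ringMacro, straightMacro,
    trial, excursions, probes, List.length_flatMap]
  omega

end rules

/-! ### Probing -/

section probing

variable {V : Type} {G : SimpleGraph V} {k : ℕ} (L : PortLabeling G)

/-- The position of robot `i` while the active robots visit the node behind port `p`. -/
noncomputable def visit (A : Core → Prop) (c : Configuration V Mem k) (p : ℕ) (i : Fin k) : V :=
  if A (c i).mem.core then L.follow (c i).pos p else (c i).pos

/-- The port `p` passes the test of robot `i`. -/
def Hit (A : Core → Prop) (Q : ℕ → ℕ → Core → Set Core → Prop) (c : Configuration V Mem k)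
    (i : Fin k) (p : ℕ) : Prop :=
  p ∈ Set.Icc 1 (nodeDegree G (c i).pos) ∧
    Q p (nodeDegree G (L.follow (c i).pos p)) (c i).mem.core
      {κ | ∃ j, j ≠ i ∧ visit L A c p j = L.follow (c i).pos p ∧ (c j).mem.core = κ}

variable {A : Core → Prop} {Q : ℕ → ℕ → Core → Set Core → Prop} {c : Configuration V Mem k}

/-- Probing alters only `cand`, which tests do not read. All probes can therefore be evaluated in
the configuration before the first one. -/
theorem Hit.congr {c' : Configuration V Mem k}
    (h : ∀ i, (c' i).pos = (c i).pos ∧ (c' i).mem.core = (c i).mem.core) {i : Fin k} {p : ℕ} :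
    Hit L A Q c' i p ↔ Hit L A Q c i p := by
  simp only [Hit, visit, (h _).1, (h _).2]

theorem applyRule_outRule (p : ℕ) (i : Fin k) :
    (applyRule L (outRule A p) c i).pos = visit L A c p i ∧
      (applyRule L (outRule A p) c i).mem = (c i).mem := by
  by_cases h : A (c i).mem.core <;> simp [applyRule, outRule, visit, h]

/-- The entry port of the visit is the way home. A non-existent port leaves no entry port, and then
`checkRule` neither tests nor moves. -/
theorem perform_probe (p : ℕ) (i : Fin k) :
    (perform L [outRule A p, checkRule A Q p] c i).pos = (c i).pos ∧
      (perform L [outRule A p, checkRule A Q p] c i).mem =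
        if A (c i).mem.core ∧ Hit L A Q c i p then { (c i).mem with cand := p }
        else (c i).mem := by
  simp only [perform_cons, perform_nil]
  have hset : {κ | ∃ τ ∈ (applyRule L (outRule A p) c).others i, τ.core = κ} =
      {κ | ∃ j, j ≠ i ∧ visit L A c p j = visit L A c p i ∧ (c j).mem.core = κ} := by
    ext κ
    simp only [Set.mem_ofPred_eq, Configuration.mem_others, (applyRule_outRule L p _).1,
      (applyRule_outRule L p _).2]
    constructor
    · rintro ⟨τ, ⟨j, hj, hv, rfl⟩, hκ⟩
      exact ⟨j, hj, hv, hκ⟩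
    · rintro ⟨j, hj, hv, hκ⟩
      exact ⟨_, ⟨j, hj, hv, rfl⟩, hκ⟩
  by_cases h : A (c i).mem.core
  · have hout : applyRule L (outRule A p) c i = L.relocate (c i).pos (c i).mem (some p) := by
      simp [applyRule, outRule, h]
    have hvis : visit L A c p i = L.follow (c i).pos p := by simp [visit, h]
    rw [hvis] at hset
    rw [applyRule, checkRule]
    simp only [hset]
    rw [hout]
    by_cases hp : p ∈ Set.Icc 1 (nodeDegree G (c i).pos)
    · rw [L.relocate_some _ _ hp]
      simp only [h, if_true, Option.isSome_some, true_and, Hit, hp, PortLabeling.relocate_mem,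
        and_true]
      rw [PortLabeling.relocate_some_pos, L.follow_port (L.adj_follow hp).symm]
    · rw [L.relocate_of_notMem _ _ hp]
      simp [h, Hit, hp]
  · have hout : applyRule L (outRule A p) c i = ⟨(c i).pos, (c i).mem, none⟩ := by
      simp [applyRule, outRule, h]
    rw [applyRule, checkRule, hout]
    simp [h]

/-- A later success overwrites an earlier one, which is immaterial if the success is unique. If
nothing passes, the old `cand` survives. For this reason the macros first reset it to `0`, which is
never a port. -/
theorem perform_probes (D : ℕ) (i : Fin k) :
    (perform L (probes A Q D) c i).pos = (c i).pos ∧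
      (perform L (probes A Q D) c i).mem.core = (c i).mem.core ∧
      (¬ A (c i).mem.core → (perform L (probes A Q D) c i).mem = (c i).mem) ∧
      (A (c i).mem.core →
        ((perform L (probes A Q D) c i).mem.cand = (c i).mem.cand ∧
            ∀ p ∈ Set.Icc 1 D, ¬ Hit L A Q c i p) ∨
          ∃ p ∈ Set.Icc 1 D, Hit L A Q c i p ∧
            (perform L (probes A Q D) c i).mem.cand = p) := by
  induction D generalizing i with
  | zero => simp [probes]
  | succ D ih =>
    rw [probes, perform_flatMap_range_succ, ← probes]
    generalize perform L (probes A Q D) c = b at *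
    have hb : ∀ i, (b i).pos = (c i).pos ∧ (b i).mem.core = (c i).mem.core :=
      fun i => ⟨(ih i).1, (ih i).2.1⟩
    obtain ⟨h1, h2⟩ := perform_probe L (A := A) (Q := Q) (c := b) (D + 1) i
    rw [h1, h2, (ih i).1, (ih i).2.1, Hit.congr L hb]
    refine ⟨rfl, by split_ifs <;> simp [(ih i).2.1], fun h => ?_, fun h => ?_⟩
    · rw [if_neg (by simp [h]), (ih i).2.2.1 h]
    · by_cases hD : Hit L A Q c i (D + 1)
      · right
        exact ⟨D + 1, by simp, hD, by simp [h, hD]⟩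
      · simp only [hD, and_false, if_false]
        rcases (ih i).2.2.2 h with ⟨h3, h4⟩ | ⟨p, hp, h3, h4⟩
        · refine .inl ⟨h3, fun p hp => ?_⟩
          rcases hp.2.lt_or_eq with h | rfl
          · exact h4 p ⟨hp.1, Nat.lt_succ_iff.1 h⟩
          · exact hD
        · exact .inr ⟨p, ⟨hp.1, hp.2.trans D.le_succ⟩, h3, h4⟩

/-- If exactly one neighbour passes the test, the port leading there is selected. -/
theorem perform_probes_cand {D : ℕ} {i : Fin k} {w : V} (hA : A (c i).mem.core)
    (hD : nodeDegree G (c i).pos ≤ D) (hw : G.Adj (c i).pos w)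
    (h : ∀ x, G.Adj (c i).pos x → (Hit L A Q c i (L.port (c i).pos x) ↔ x = w)) :
    (perform L (probes A Q D) c i).mem.cand = L.port (c i).pos w := by
  rcases (perform_probes L (c := c) (Q := Q) D i).2.2.2 hA with ⟨-, h4⟩ | ⟨p, hp, h3, h4⟩
  · exact absurd ((h w hw).2 rfl) (h4 _ ⟨(L.port_mem hw).1, (L.port_mem hw).2.trans hD⟩)
  · obtain ⟨x, hx, rfl⟩ := L.exists_port_eq h3.1
    rw [h4, (h x hx).1 h3]

/-- If no neighbour passes the test, no port is selected. -/
theorem perform_probes_cand_none {D : ℕ} {i : Fin k} (hA : A (c i).mem.core)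
    (h : ∀ x, G.Adj (c i).pos x → ¬ Hit L A Q c i (L.port (c i).pos x)) :
    (perform L (probes A Q D) c i).mem.cand = (c i).mem.cand := by
  rcases (perform_probes L (c := c) (Q := Q) D i).2.2.2 hA with ⟨h3, -⟩ | ⟨p, hp, h3, h4⟩
  · exact h3
  · obtain ⟨x, hx, rfl⟩ := L.exists_port_eq h3.1
    exact absurd h3 (h x hx)

end probing

/-! ### The square grid -/

section grid

variable {m : ℕ}

/-- The vertex with given coordinates. -/
def gridPoint (m a b : ℕ) : Fin (m + 1) × Fin (m + 1) :=
  (⟨min a m, by omega⟩, ⟨min b m, by omega⟩)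

@[simp] theorem gridPoint_fst (m a b : ℕ) : ((gridPoint m a b).1 : ℕ) = min a m := rfl

@[simp] theorem gridPoint_snd (m a b : ℕ) : ((gridPoint m a b).2 : ℕ) = min b m := rfl

theorem grid_ext {x y : Fin (m + 1) × Fin (m + 1)} (h₁ : (x.1 : ℕ) = y.1)
    (h₂ : (x.2 : ℕ) = y.2) : x = y :=
  Prod.ext (Fin.ext h₁) (Fin.ext h₂)

theorem grid_eq_iff {x y : Fin (m + 1) × Fin (m + 1)} :
    x = y ↔ (x.1 : ℕ) = y.1 ∧ (x.2 : ℕ) = y.2 :=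
  ⟨fun h => h ▸ ⟨rfl, rfl⟩, fun h => grid_ext h.1 h.2⟩

theorem gridPoint_coe (x : Fin (m + 1) × Fin (m + 1)) : gridPoint m x.1 x.2 = x := by
  apply grid_ext <;> simp <;> omega

theorem squareGrid_adj {x y : Fin (m + 1) × Fin (m + 1)} :
    (squareGrid (m + 1)).Adj x y ↔
      (((x.1 : ℕ) + 1 = y.1 ∨ (y.1 : ℕ) + 1 = x.1) ∧ (x.2 : ℕ) = y.2) ∨
      (((x.2 : ℕ) + 1 = y.2 ∨ (y.2 : ℕ) + 1 = x.2) ∧ (x.1 : ℕ) = y.1) := by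
  simp [SimpleGraph.boxProd_adj, SimpleGraph.pathGraph_adj, Fin.ext_iff]

theorem gridPoint_adj {a b a' b' : ℕ} (ha : a ≤ m) (hb : b ≤ m) (ha' : a' ≤ m) (hb' : b' ≤ m) :
    (squareGrid (m + 1)).Adj (gridPoint m a b) (gridPoint m a' b') ↔
      ((a + 1 = a' ∨ a' + 1 = a) ∧ b = b') ∨ ((b + 1 = b' ∨ b' + 1 = b) ∧ a = a') := by
  rw [squareGrid_adj]
  simp [ha, hb, ha', hb']

/-- The number of valid neighbours in the direction of one coordinate. -/
def axisDegree (m a : ℕ) : ℕ := (if 0 < a then 1 else 0) + if a < m then 1 else 0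

theorem ncard_path_neighbors (m a : ℕ) (ha : a ≤ m) :
    {x : Fin (m + 1) | a + 1 = x ∨ (x : ℕ) + 1 = a}.ncard = axisDegree m a := by
  have h1 : {x : Fin (m + 1) | a + 1 = x ∨ (x : ℕ) + 1 = a} =
      (Finset.univ.filter fun x : Fin (m + 1) => a + 1 = x) ∪
        (Finset.univ.filter fun x : Fin (m + 1) => (x : ℕ) + 1 = a) := by
    ext x; simp
  have hd : Disjoint (Finset.univ.filter fun x : Fin (m + 1) => a + 1 = x)
      (Finset.univ.filter fun x : Fin (m + 1) => (x : ℕ) + 1 = a) := by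
    rw [Finset.disjoint_filter]; intros; omega
  rw [h1, Set.ncard_coe_finset, Finset.card_union_of_disjoint hd, axisDegree,
    add_comm]
  congr 1
  · split_ifs with h
    · refine Finset.card_eq_one.2 ⟨⟨a - 1, by omega⟩, ?_⟩
      ext x; simp [Fin.ext_iff]; omega
    · rw [Finset.card_eq_zero, Finset.filter_eq_empty_iff]; intro x _; omega
  · split_ifs with h
    · refine Finset.card_eq_one.2 ⟨⟨a + 1, by omega⟩, ?_⟩
      ext x; simp [Fin.ext_iff]; omega
    · rw [Finset.card_eq_zero, Finset.filter_eq_empty_iff]; intro x _; omega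

theorem nodeDegree_squareGrid (x : Fin (m + 1) × Fin (m + 1)) :
    nodeDegree (squareGrid (m + 1)) x = axisDegree m x.1 + axisDegree m x.2 := by
  have h1 : (squareGrid (m + 1)).neighborSet x =
      (fun a => (a, x.2)) '' {a : Fin (m + 1) | (x.1 : ℕ) + 1 = a ∨ (a : ℕ) + 1 = x.1} ∪
      (fun b => (x.1, b)) '' {b : Fin (m + 1) | (x.2 : ℕ) + 1 = b ∨ (b : ℕ) + 1 = x.2} := by
    ext y
    simp only [SimpleGraph.mem_neighborSet, squareGrid_adj, Set.mem_union, Set.mem_image,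
      Set.mem_ofPred_eq]
    constructor
    · rintro (⟨h, h'⟩ | ⟨h, h'⟩)
      · exact .inl ⟨y.1, h, Prod.ext rfl (Fin.ext h')⟩
      · exact .inr ⟨y.2, h, Prod.ext (Fin.ext h') rfl⟩
    · rintro (⟨a, h, rfl⟩ | ⟨a, h, rfl⟩)
      · exact .inl ⟨h, rfl⟩
      · exact .inr ⟨h, rfl⟩
  rw [nodeDegree, h1, Set.ncard_union_eq, Set.ncard_image_of_injective _
    (fun a b h => (Prod.ext_iff.1 h).1), Set.ncard_image_of_injective _
    (fun a b h => (Prod.ext_iff.1 h).2), ncard_path_neighbors _ _ (by omega),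
    ncard_path_neighbors _ _ (by omega)]
  rw [Set.disjoint_left]
  rintro _ ⟨a, ha, rfl⟩ ⟨b, hb, h⟩
  simp only [Prod.mk.injEq, Set.mem_ofPred_eq] at h ha
  have := congrArg Fin.val h.1
  omega

/-- Boundary nodes of the grid. -/
def OnBoundary (x : Fin (m + 1) × Fin (m + 1)) : Prop :=
  (x.1 : ℕ) = 0 ∨ (x.1 : ℕ) = m ∨ (x.2 : ℕ) = 0 ∨ (x.2 : ℕ) = m

/-- Robots do not see coordinates; the degree is how they recognize the boundary. -/
theorem nodeDegree_lt_four {x : Fin (m + 1) × Fin (m + 1)} :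
    nodeDegree (squareGrid (m + 1)) x < 4 ↔ OnBoundary x := by
  rw [nodeDegree_squareGrid, axisDegree, axisDegree, OnBoundary]
  split_ifs <;> omega

theorem nodeDegree_le_four (x : Fin (m + 1) × Fin (m + 1)) :
    nodeDegree (squareGrid (m + 1)) x ≤ 4 := by
  rw [nodeDegree_squareGrid, axisDegree, axisDegree]
  split_ifs <;> omega

theorem nodeDegree_eq_two (hm : 0 < m) {x : Fin (m + 1) × Fin (m + 1)} :
    nodeDegree (squareGrid (m + 1)) x = 2 ↔
      ((x.1 : ℕ) = 0 ∨ (x.1 : ℕ) = m) ∧ ((x.2 : ℕ) = 0 ∨ (x.2 : ℕ) = m) := by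
  rw [nodeDegree_squareGrid, axisDegree, axisDegree]
  split_ifs <;> omega

/-! ### Symmetries of the grid -/

/-- Symmetries of the grid. -/
abbrev GridSymm (m : ℕ) := squareGrid (m + 1) ≃g squareGrid (m + 1)

/-- Exchange of rows and columns. -/
def gridSwap (m : ℕ) : GridSymm m where
  toEquiv := Equiv.prodComm _ _
  map_rel_iff' := by
    intro x y
    simp only [Equiv.prodComm_apply, squareGrid_adj, Prod.fst_swap, Prod.snd_swap]
    omega

/-- Reflection of the columns. -/
def gridFlip (m : ℕ) : GridSymm m where
  toEquiv := (Equiv.refl _).prodCongr Fin.revPerm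
  map_rel_iff' := by
    intro x y
    simp only [Equiv.prodCongr_apply, squareGrid_adj, Prod.map_fst, Prod.map_snd,
      Equiv.refl_apply, Fin.revPerm_apply, Fin.val_rev]
    omega

theorem gridSwap_apply (x : Fin (m + 1) × Fin (m + 1)) : gridSwap m x = (x.2, x.1) := rfl

theorem gridFlip_apply (x : Fin (m + 1) × Fin (m + 1)) : gridFlip m x = (x.1, x.2.rev) := rfl

theorem nodeDegree_iso {V : Type} {G : SimpleGraph V} (e : G ≃g G) (x : V) :
    nodeDegree G (e x) = nodeDegree G x := by
  rw [nodeDegree, nodeDegree]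
  have : G.neighborSet (e x) = e '' G.neighborSet x := by
    ext y
    simp only [SimpleGraph.mem_neighborSet, Set.mem_image]
    constructor
    · intro h
      refine ⟨e.symm y, ?_, by simp⟩
      rw [← e.map_adj_iff]; simpa using h
    · rintro ⟨z, hz, rfl⟩
      exact e.map_adj_iff.2 hz
  rw [this, Set.ncard_image_of_injective _ e.injective]

theorem onBoundary_iso (e : GridSymm m) {x : Fin (m + 1) × Fin (m + 1)} :
    OnBoundary (e x) ↔ OnBoundary x := by
  rw [← nodeDegree_lt_four, ← nodeDegree_lt_four, nodeDegree_iso]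

theorem exists_symm_of_row_zero {x y : Fin (m + 1) × Fin (m + 1)}
    (h : (squareGrid (m + 1)).Adj x y) (hx : (x.1 : ℕ) = 0) (hy : (y.1 : ℕ) = 0) :
    ∃ (e : GridSymm m) (a : ℕ), a < m ∧ x = e (gridPoint m 0 a) ∧
      y = e (gridPoint m 0 (a + 1)) := by
  rw [squareGrid_adj] at h
  have h1 : (x.2 : ℕ) + 1 = y.2 ∨ (y.2 : ℕ) + 1 = x.2 := by omega
  rcases h1 with h1 | h1
  · refine ⟨SimpleGraph.Iso.refl, x.2, by omega, ?_, ?_⟩ <;>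
      apply grid_ext <;> simp only [RelIso.refl_apply, gridPoint_fst, gridPoint_snd] <;> omega
  · refine ⟨gridFlip m, m - x.2, by omega, ?_, ?_⟩ <;>
      apply grid_ext <;> simp only [gridFlip_apply, Fin.val_rev, gridPoint_fst, gridPoint_snd] <;>
      omega

/-- Every oriented boundary edge is the image of an edge of the first row. -/
theorem exists_symm_of_adj {x y : Fin (m + 1) × Fin (m + 1)}
    (h : (squareGrid (m + 1)).Adj x y) (hx : OnBoundary x) (hy : OnBoundary y) :
    ∃ (e : GridSymm m) (a : ℕ), a < m ∧ x = e (gridPoint m 0 a) ∧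
      y = e (gridPoint m 0 (a + 1)) := by
  -- It suffices to carry the edge into the first row and to pull the result back.
  have key : ∀ f : GridSymm m, ((f x).1 : ℕ) = 0 → ((f y).1 : ℕ) = 0 →
      ∃ (e : GridSymm m) (a : ℕ), a < m ∧ x = e (gridPoint m 0 a) ∧
        y = e (gridPoint m 0 (a + 1)) := by
    intro f h1 h2
    obtain ⟨e, a, ha, hex, hey⟩ := exists_symm_of_row_zero (f.map_adj_iff.2 h) h1 h2
    refine ⟨e.trans f.symm, a, ha, ?_, ?_⟩
    · simp [← hex]
    · simp [← hey]
  -- Adjacent boundary nodes lie on a common side.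
  have hcase : ((x.1 : ℕ) = 0 ∧ (y.1 : ℕ) = 0) ∨ ((x.1 : ℕ) = m ∧ (y.1 : ℕ) = m) ∨
      ((x.2 : ℕ) = 0 ∧ (y.2 : ℕ) = 0) ∨ ((x.2 : ℕ) = m ∧ (y.2 : ℕ) = m) := by
    rw [squareGrid_adj] at h
    unfold OnBoundary at hx hy
    omega
  rcases hcase with h | h | h | h
  · exact key SimpleGraph.Iso.refl h.1 h.2
  · refine key ((gridSwap m).trans ((gridFlip m).trans (gridSwap m))) ?_ ?_ <;>
      simp [gridSwap_apply, gridFlip_apply, Fin.val_rev, h]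
  · exact key (gridSwap m) h.1 h.2
  · refine key ((gridFlip m).trans (gridSwap m)) ?_ ?_ <;>
      simp [gridSwap_apply, gridFlip_apply, Fin.val_rev, h]

/-! ### The boundary cycle -/

/-- The vertex at position `t ≤ 4 m` of the boundary cycle. -/
def ringPoint (m t : ℕ) : Fin (m + 1) × Fin (m + 1) :=
  if t ≤ m then gridPoint m 0 t else if t ≤ 2 * m then gridPoint m (t - m) m
  else if t ≤ 3 * m then gridPoint m m (3 * m - t) else gridPoint m (4 * m - t) 0

/-- The vertex at position `i` of the boundary cycle, with period `4 m`. -/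
def ring (m i : ℕ) : Fin (m + 1) × Fin (m + 1) := ringPoint m (i % (4 * m))

/-- The form in which the four sides are handed to `omega`. The value `t = 4 * m` is included, where
the cycle closes. -/
theorem ringPoint_coord {t : ℕ} (ht : t ≤ 4 * m) :
    (t ≤ m ∧ ((ringPoint m t).1 : ℕ) = 0 ∧ ((ringPoint m t).2 : ℕ) = t) ∨
    (m < t ∧ t ≤ 2 * m ∧ ((ringPoint m t).1 : ℕ) = t - m ∧ ((ringPoint m t).2 : ℕ) = m) ∨
    (2 * m < t ∧ t ≤ 3 * m ∧ ((ringPoint m t).1 : ℕ) = m ∧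
      ((ringPoint m t).2 : ℕ) = 3 * m - t) ∨
    (3 * m < t ∧ ((ringPoint m t).1 : ℕ) = 4 * m - t ∧ ((ringPoint m t).2 : ℕ) = 0) := by
  unfold ringPoint
  split_ifs <;> simp <;> omega

theorem ringPoint_onBoundary {t : ℕ} (ht : t ≤ 4 * m) : OnBoundary (ringPoint m t) := by
  have := ringPoint_coord ht
  unfold OnBoundary
  omega

theorem ring_onBoundary (hm : 0 < m) (i : ℕ) : OnBoundary (ring m i) :=
  ringPoint_onBoundary (Nat.mod_lt _ (by omega)).le

theorem ring_of_le {i : ℕ} (hi : i ≤ m) : ring m i = gridPoint m 0 i := by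
  rcases Nat.eq_zero_or_pos m with rfl | hm
  · obtain rfl : i = 0 := by omega
    apply grid_ext <;> simp
  · rw [ring, Nat.mod_eq_of_lt (by omega), ringPoint, if_pos hi]

theorem ring_add_period (i : ℕ) : ring m (i + 4 * m) = ring m i := by
  simp [ring]

theorem ring_succ_mod (hm : 0 < m) (i : ℕ) :
    i % (4 * m) + 1 < 4 * m ∧ (i + 1) % (4 * m) = i % (4 * m) + 1 ∨
      i % (4 * m) + 1 = 4 * m ∧ (i + 1) % (4 * m) = 0 := by
  have h := Nat.mod_lt i (show 0 < 4 * m by omega)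
  rcases (Nat.succ_le_of_lt h).lt_or_eq with h1 | h1
  · left
    refine ⟨h1, ?_⟩
    rw [Nat.add_mod, Nat.mod_eq_of_lt (show 1 < 4 * m by omega), Nat.mod_eq_of_lt h1]
  · right
    refine ⟨h1, ?_⟩
    rw [Nat.add_mod, Nat.mod_eq_of_lt (show 1 < 4 * m by omega)]
    have : i % (4 * m) + 1 = 4 * m := h1
    rw [this, Nat.mod_self]

/-- The boundary cycle has no chords. This forces a walker that does not turn back to follow the
cycle. -/
theorem ring_eq_or {i : ℕ} (hm : 0 < m) {x : Fin (m + 1) × Fin (m + 1)}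
    (hx : OnBoundary x) (h : (squareGrid (m + 1)).Adj (ring m (i + 1)) x) :
    x = ring m i ∨ x = ring m (i + 2) := by
  have h0 := ring_succ_mod hm i
  have h1 := ring_succ_mod hm (i + 1)
  have hlt := Nat.mod_lt i (show 0 < 4 * m by omega)
  simp only [ring, grid_eq_iff] at h ⊢
  rw [squareGrid_adj] at h
  unfold OnBoundary at hx
  rw [show i + 2 = i + 1 + 1 from rfl]
  generalize i % (4 * m) = t₀ at *
  generalize (i + 1) % (4 * m) = t₁ at *
  generalize (i + 1 + 1) % (4 * m) = t₂ at *
  have c0 := ringPoint_coord (m := m) (t := t₀) (by omega)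
  have c1 := ringPoint_coord (m := m) (t := t₁) (by omega)
  have c2 := ringPoint_coord (m := m) (t := t₂) (by omega)
  generalize ((ringPoint m t₀).1 : ℕ) = a₀ at *
  generalize ((ringPoint m t₀).2 : ℕ) = b₀ at *
  generalize ((ringPoint m t₁).1 : ℕ) = a₁ at *
  generalize ((ringPoint m t₁).2 : ℕ) = b₁ at *
  generalize ((ringPoint m t₂).1 : ℕ) = a₂ at *
  generalize ((ringPoint m t₂).2 : ℕ) = b₂ at *
  have := x.1.2
  have := x.2.2
  generalize (x.1 : ℕ) = a at *
  generalize (x.2 : ℕ) = b at *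
  rcases h0 with h0 | h0 <;> rcases h1 with h1 | h1 <;> rcases c1 with c1 | c1 | c1 | c1 <;>
    rcases h with ⟨h | h, h'⟩ | ⟨h | h, h'⟩ <;> omega

theorem ring_adj (hm : 0 < m) (i : ℕ) :
    (squareGrid (m + 1)).Adj (ring m i) (ring m (i + 1)) := by
  have h0 := ring_succ_mod hm i
  simp only [ring]
  rw [squareGrid_adj]
  generalize i % (4 * m) = t₀ at *
  generalize (i + 1) % (4 * m) = t₁ at *
  have c0 := ringPoint_coord (m := m) (t := t₀) (by omega)
  have c1 := ringPoint_coord (m := m) (t := t₁) (by omega)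
  omega

theorem exists_ringPoint {x : Fin (m + 1) × Fin (m + 1)} (hx : OnBoundary x) (hm : 0 < m) :
    ∃ t < 4 * m, ringPoint m t = x := by
  unfold OnBoundary at hx
  have h1 := x.1.2
  have h2 := x.2.2
  rcases hx with h | h | h | h
  · refine ⟨x.2, by omega, ?_⟩
    have := ringPoint_coord (m := m) (t := x.2) (by omega)
    apply grid_ext <;> omega
  · refine ⟨3 * m - x.2, by omega, ?_⟩
    have := ringPoint_coord (m := m) (t := 3 * m - x.2) (by omega)
    apply grid_ext <;> omega
  · rcases Nat.eq_zero_or_pos (x.1 : ℕ) with h0 | h0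
    · refine ⟨0, by omega, ?_⟩
      have := ringPoint_coord (m := m) (t := 0) (by omega)
      apply grid_ext <;> omega
    · refine ⟨4 * m - x.1, by omega, ?_⟩
      have := ringPoint_coord (m := m) (t := 4 * m - x.1) (by omega)
      apply grid_ext <;> omega
  · refine ⟨m + x.1, by omega, ?_⟩
    have := ringPoint_coord (m := m) (t := m + x.1) (by omega)
    apply grid_ext <;> omega

theorem ring_injOn {i j : ℕ} (hi : i < 4 * m) (hj : j < 4 * m) (h : ring m i = ring m j) :
    i = j := by
  rw [ring, ring, Nat.mod_eq_of_lt hi, Nat.mod_eq_of_lt hj, grid_eq_iff] at h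
  have c0 := ringPoint_coord hi.le
  have c1 := ringPoint_coord hj.le
  omega

/-- A full turn along the boundary visits every boundary node. -/
theorem exists_ring_eq (hm : 0 < m) (e : GridSymm m) {a : ℕ} (ha : a < m)
    {x : Fin (m + 1) × Fin (m + 1)} (hx : OnBoundary x) :
    ∃ n < 4 * m, x = e (ring m (a + n)) := by
  obtain ⟨t, ht, htx⟩ := exists_ringPoint ((onBoundary_iso e.symm).2 hx) hm
  by_cases h : a ≤ t
  · refine ⟨t - a, by omega, ?_⟩
    rw [ring, Nat.mod_eq_of_lt (by omega), show a + (t - a) = t by omega, htx]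
    simp
  -- Position `t` lies behind the start `a` and is reached only after passing position `0`.
  · refine ⟨t + 4 * m - a, by omega, ?_⟩
    rw [show a + (t + 4 * m - a) = t + 4 * m by omega, ring_add_period, ring,
      Nat.mod_eq_of_lt ht, htx]
    simp

/-- A walk along the boundary that never turns back follows the boundary cycle. -/
theorem exists_symm_of_walk (hm : 0 < m) {N : ℕ} (hN : 0 < N)
    (x : ℕ → Fin (m + 1) × Fin (m + 1)) (hb : ∀ n ≤ N, OnBoundary (x n))
    (hadj : ∀ n < N, (squareGrid (m + 1)).Adj (x n) (x (n + 1)))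
    (hne : ∀ n, n + 2 ≤ N → x (n + 2) ≠ x n) :
    ∃ (e : GridSymm m) (a : ℕ), a < m ∧ ∀ n ≤ N, x n = e (ring m (a + n)) := by
  obtain ⟨e, a, ha, h0, h1⟩ := exists_symm_of_adj (hadj 0 hN) (hb 0 (by omega)) (hb 1 hN)
  refine ⟨e, a, ha, ?_⟩
  -- Two consecutive positions are needed in the induction: the next node is determined only once
  -- the previous one is excluded.
  have key : ∀ n, n + 1 ≤ N → x n = e (ring m (a + n)) ∧ x (n + 1) = e (ring m (a + n + 1)) := by
    intro n
    induction n with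
    | zero =>
      intro _
      simp only [add_zero, zero_add]
      rw [ring_of_le ha.le, ring_of_le (by omega : a + 1 ≤ m)]
      exact ⟨h0, h1⟩
    | succ n ih =>
      intro hn
      obtain ⟨ih1, ih2⟩ := ih (by omega)
      refine ⟨ih2, ?_⟩
      have hadj' := hadj (n + 1) (by omega)
      have : e.symm (x (n + 2)) = ring m (a + n) ∨ e.symm (x (n + 2)) = ring m (a + n + 2) := by
        refine ring_eq_or hm ((onBoundary_iso e.symm).2 (hb _ (by omega))) ?_
        rw [← e.map_adj_iff]
        simpa [← ih2] using hadj'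
      rcases this with h | h
      · exact absurd (by rw [ih1, ← h]; simp) (hne n (by omega))
      · change x (n + 2) = e (ring m (a + n + 2))
        rw [← h]; simp
  intro n hn
  rcases n with _ | n
  · exact (key 0 hN).1
  · exact (key n hn).2

/-- A walk along the boundary meets a corner within one side length. -/
theorem exists_corner (hm : 0 < m) (e : GridSymm m) {a : ℕ} (ha : a < m) :
    ∃ n ≤ m, nodeDegree (squareGrid (m + 1)) (e (ring m (a + n))) = 2 := by
  -- The end of the first side, `ring m m`, is a corner.
  refine ⟨m - a, by omega, ?_⟩
  rw [nodeDegree_iso, show a + (m - a) = m by omega, ring_of_le le_rfl, nodeDegree_eq_two hm]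
  simp

/-- The condition `a < m` rules out the far end of the side. A tour from a corner thus begins at
position `0`, and its positions `0, …, m` fill a whole side. -/
theorem ring_start_of_corner (hm : 0 < m) (e : GridSymm m) {a : ℕ} (ha : a < m)
    (h : nodeDegree (squareGrid (m + 1)) (e (ring m a)) = 2) : a = 0 := by
  rw [nodeDegree_iso, ring_of_le ha.le, nodeDegree_eq_two hm] at h
  simp at h
  omega

/-- Every boundary node has two neighbours on the boundary. -/
theorem exists_boundary_neighbors (hm : 0 < m) {x : Fin (m + 1) × Fin (m + 1)}
    (hx : OnBoundary x) : ∃ y z, y ≠ z ∧ OnBoundary y ∧ OnBoundary z ∧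
      (squareGrid (m + 1)).Adj x y ∧ (squareGrid (m + 1)).Adj x z := by
  obtain ⟨t, ht, rfl⟩ := exists_ringPoint hx hm
  -- Adding a full period lets the predecessor of position `0` be written with natural subtraction.
  have hr : ringPoint m t = ring m (t + 4 * m) := by
    rw [ring_add_period, ring, Nat.mod_eq_of_lt ht]
  rw [hr]
  refine ⟨ring m (t + 4 * m + 1), ring m (t + 4 * m - 1), ?_, ring_onBoundary hm _,
    ring_onBoundary hm _, ring_adj hm _, ?_⟩
  · rw [show t + 4 * m + 1 = t + 1 + 4 * m by omega, ring_add_period]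
    intro h
    rcases Nat.eq_zero_or_pos t with rfl | h0
    · have := ring_injOn (by omega) (by omega) h
      omega
    · rw [show t + 4 * m - 1 = t - 1 + 4 * m by omega, ring_add_period] at h
      rcases (Nat.succ_le_of_lt ht).lt_or_eq with h1 | h1
      · have := ring_injOn h1 (by omega) h
        omega
      · rw [show t + 1 = 0 + 4 * m by omega, ring_add_period] at h
        have := ring_injOn (by omega) (by omega) h
        omega
  · have := (ring_adj hm (t + 4 * m - 1)).symm
    rwa [show t + 4 * m - 1 + 1 = t + 4 * m by omega] at this

end grid

/-! ### Walking along the boundary -/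

section stationary

variable {V : Type} {G : SimpleGraph V} {k : ℕ} (L : PortLabeling G)

theorem Configuration.forall_mem_others {S : Type} {c : Configuration V S k} {i : Fin k}
    {P : S → Prop} : (∀ σ ∈ c.others i, P σ) ↔
      ∀ j, j ≠ i → (c j).pos = (c i).pos → P (c j).mem := by
  constructor
  · exact fun h j hj hp => h _ (Configuration.mem_others.2 ⟨j, hj, hp, rfl⟩)
  · rintro h σ hσ
    obtain ⟨j, hj, hp, rfl⟩ := Configuration.mem_others.1 hσ
    exact h j hj hp

theorem Configuration.exists_mem_others {S : Type} {c : Configuration V S k} {i : Fin k}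
    {P : S → Prop} : (∃ σ ∈ c.others i, P σ) ↔
      ∃ j, j ≠ i ∧ (c j).pos = (c i).pos ∧ P (c j).mem := by
  constructor
  · rintro ⟨σ, hσ, h⟩
    obtain ⟨j, hj, hp, rfl⟩ := Configuration.mem_others.1 hσ
    exact ⟨j, hj, hp, h⟩
  · rintro ⟨j, hj, hp, h⟩
    exact ⟨_, Configuration.mem_others.2 ⟨j, hj, hp, rfl⟩, h⟩

theorem applyRule_stay {f : RoundRule Mem} {c : Configuration V Mem k} {i : Fin k}
    (h : (f (nodeDegree G (c i).pos) (c i).entry (c i).mem (c.others i)).2 = none) :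
    applyRule L f c i =
      ⟨(c i).pos, (f (nodeDegree G (c i).pos) (c i).entry (c i).mem (c.others i)).1, none⟩ := by
  rw [applyRule, h]; rfl

theorem applyRule_advanceRule_of_not {A : Core → Prop} {go : ℕ → Prop}
    {c : Configuration V Mem k} {i : Fin k}
    (h : ¬ (A (c i).mem.core ∧ go (nodeDegree G (c i).pos))) :
    applyRule L (advanceRule A go) c i = ⟨(c i).pos, (c i).mem, none⟩ := by
  simp [applyRule, advanceRule, h]

theorem applyRule_advanceRule {A : Core → Prop} {go : ℕ → Prop}
    {c : Configuration V Mem k} {i : Fin k}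
    (hA : A (c i).mem.core) (hgo : go (nodeDegree G (c i).pos)) {w : V}
    (hw : G.Adj (c i).pos w) (hc : (c i).mem.cand = L.port (c i).pos w) :
    applyRule L (advanceRule A go) c i = ⟨w, (c i).mem, some (L.port w (c i).pos)⟩ := by
  simp [applyRule, advanceRule, hA, hgo, hc, L.relocate_port _ _ hw]

theorem applyRule_advanceRule_zero {A : Core → Prop} {go : ℕ → Prop}
    {c : Configuration V Mem k} {i : Fin k} (hc : (c i).mem.cand = 0) :
    applyRule L (advanceRule A go) c i = ⟨(c i).pos, (c i).mem, none⟩ := by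
  by_cases h : A (c i).mem.core ∧ go (nodeDegree G (c i).pos)
  · simp only [applyRule, advanceRule, h, and_self, if_true, hc]
    exact L.relocate_of_notMem _ _ (by simp)
  · exact applyRule_advanceRule_of_not L h

/-- Probing followed by an advance: robots that are not active stay, active robots go to the only
neighbour that passes the test. -/
theorem perform_probes_advance_of_not {A : Core → Prop} {Q : ℕ → ℕ → Core → Set Core → Prop}
    {go : ℕ → Prop} {D : ℕ} {c : Configuration V Mem k} {i : Fin k} (hA : ¬ A (c i).mem.core) :
    perform L (probes A Q D ++ [advanceRule A go]) c i = ⟨(c i).pos, (c i).mem, none⟩ := by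
  obtain ⟨h1, h2, h3, -⟩ := perform_probes L (A := A) (Q := Q) (c := c) D i
  rw [perform_append, perform_cons, perform_nil, applyRule_advanceRule_of_not L (by simp [h2, hA]),
    h1, h3 hA]

theorem perform_probes_advance_core {A : Core → Prop} {Q : ℕ → ℕ → Core → Set Core → Prop}
    {go : ℕ → Prop} {D : ℕ} {c : Configuration V Mem k} (i : Fin k) :
    (perform L (probes A Q D ++ [advanceRule A go]) c i).mem.core = (c i).mem.core := by
  rw [perform_append, perform_cons, perform_nil, applyRule_mem]
  exact (perform_probes L (A := A) (Q := Q) (c := c) D i).2.1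

theorem perform_probes_advance {A : Core → Prop} {Q : ℕ → ℕ → Core → Set Core → Prop}
    {go : ℕ → Prop} {D : ℕ} {c : Configuration V Mem k} {i : Fin k} {w : V}
    (hA : A (c i).mem.core) (hgo : go (nodeDegree G (c i).pos))
    (hD : nodeDegree G (c i).pos ≤ D) (hw : G.Adj (c i).pos w)
    (h : ∀ x, G.Adj (c i).pos x → (Hit L A Q c i (L.port (c i).pos x) ↔ x = w)) :
    (perform L (probes A Q D ++ [advanceRule A go]) c i).pos = w ∧
      (perform L (probes A Q D ++ [advanceRule A go]) c i).entry =
        some (L.port w (c i).pos) := by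
  obtain ⟨h1, h2, -, -⟩ := perform_probes L (A := A) (Q := Q) (c := c) D i
  have h3 := perform_probes_cand L hA hD hw h
  rw [perform_append, perform_cons, perform_nil,
    applyRule_advanceRule L (w := w) (by rwa [h2]) (by rwa [h1]) (by rwa [h1]) (by rw [h3, h1]), h1]
  exact ⟨rfl, rfl⟩

theorem perform_probes_advance_none {A : Core → Prop} {Q : ℕ → ℕ → Core → Set Core → Prop}
    {go : ℕ → Prop} {D : ℕ} {c : Configuration V Mem k} {i : Fin k}
    (hA : A (c i).mem.core) (hc : (c i).mem.cand = 0)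
    (h : ∀ x, G.Adj (c i).pos x → ¬ Hit L A Q c i (L.port (c i).pos x)) :
    (perform L (probes A Q D ++ [advanceRule A go]) c i).pos = (c i).pos := by
  obtain ⟨h1, h2, -, -⟩ := perform_probes L (A := A) (Q := Q) (c := c) D i
  have h3 := perform_probes_cand_none L (D := D) hA h
  rw [perform_append, perform_cons, perform_nil,
    applyRule_advanceRule_zero L (by rw [h3, hc]), h1]

end stationary

/-! ### Steps along the boundary cycle, and the settling of walkers. -/

section boundary

variable {m k : ℕ} (L : PortLabeling (squareGrid (m + 1)))

/-- Robot `i` has made a step along the boundary that does not lead back. -/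
def StepsOn (c c' : Configuration (Fin (m + 1) × Fin (m + 1)) Mem k) (i : Fin k) : Prop :=
  (squareGrid (m + 1)).Adj (c i).pos (c' i).pos ∧ OnBoundary (c' i).pos ∧
    (c' i).entry = some (L.port (c' i).pos (c i).pos) ∧
    L.port (c i).pos (c' i).pos ≠ (c i).entry.getD 0

theorem hit_ringLook {c : Configuration (Fin (m + 1) × Fin (m + 1)) Mem k} {i : Fin k}
    {x : Fin (m + 1) × Fin (m + 1)} (hx : (squareGrid (m + 1)).Adj (c i).pos x) :
    Hit L Core.Walks ringLook c i (L.port (c i).pos x) ↔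
      OnBoundary x ∧ L.port (c i).pos x ≠ (c i).mem.core.back := by
  simp only [Hit, ringLook, L.port_mem hx, true_and, L.follow_port hx, nodeDegree_lt_four]

/-- One of the two boundary neighbours is not behind `back`. On the first step of a walk both may
qualify, and the direction is then arbitrary; hence only existence of `w` is claimed. -/
theorem perform_ring (hm : 0 < m) {go : ℕ → Prop}
    {c : Configuration (Fin (m + 1) × Fin (m + 1)) Mem k} {i : Fin k}
    (hA : (c i).mem.core.Walks) (hgo : go (nodeDegree (squareGrid (m + 1)) (c i).pos))
    (hb : OnBoundary (c i).pos) :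
    ∃ w, (squareGrid (m + 1)).Adj (c i).pos w ∧ OnBoundary w ∧
      L.port (c i).pos w ≠ (c i).mem.core.back ∧
      (perform L (probes Core.Walks ringLook 3 ++ [advanceRule Core.Walks go]) c i).pos = w ∧
      (perform L (probes Core.Walks ringLook 3 ++ [advanceRule Core.Walks go]) c i).entry =
        some (L.port w (c i).pos) := by
  obtain ⟨h1, h2, -, h4⟩ := perform_probes L (A := Core.Walks) (Q := ringLook) (c := c) 3 i
  have h5 := h4 hA
  have hdeg : nodeDegree (squareGrid (m + 1)) (c i).pos ≤ 3 :=
    Nat.lt_succ_iff.1 (nodeDegree_lt_four.2 hb)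
  have key : ∃ w, (squareGrid (m + 1)).Adj (c i).pos w ∧ OnBoundary w ∧
      L.port (c i).pos w ≠ (c i).mem.core.back ∧
      (perform L (probes Core.Walks ringLook 3) c i).mem.cand = L.port (c i).pos w := by
    rcases h5 with ⟨-, h6⟩ | ⟨p, hp, h6, h7⟩
    -- If no port passed, both boundary neighbours would lie behind the single port `back`.
    · obtain ⟨y, z, hyz, hy, hz, hay, haz⟩ := exists_boundary_neighbors hm hb
      exfalso
      have hy' := h6 _ ⟨(L.port_mem hay).1, (L.port_mem hay).2.trans hdeg⟩
      have hz' := h6 _ ⟨(L.port_mem haz).1, (L.port_mem haz).2.trans hdeg⟩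
      rw [hit_ringLook L hay] at hy'
      rw [hit_ringLook L haz] at hz'
      have e1 : L.port (c i).pos y = (c i).mem.core.back := by tauto
      have e2 : L.port (c i).pos z = (c i).mem.core.back := by tauto
      exact hyz (L.port_inj hay haz (e1.trans e2.symm))
    · obtain ⟨w, hw, rfl⟩ := L.exists_port_eq h6.1
      rw [hit_ringLook L hw] at h6
      exact ⟨w, hw, h6.1, h6.2, h7⟩
  obtain ⟨w, hw, hbw, hback, hc⟩ := key
  refine ⟨w, hw, hbw, hback, ?_⟩
  rw [perform_append, perform_cons, perform_nil,
    applyRule_advanceRule L (w := w) (by rwa [h2]) (by rwa [h1]) (by rwa [h1]) (by rw [hc, h1]), h1]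
  exact ⟨rfl, rfl⟩

/-- A step of the walkers along the boundary, prepared by a rule that makes the walkers memorize
their entry ports. -/
theorem perform_ringMacro (hm : 0 < m) {f : RoundRule Mem} {go : ℕ → Prop}
    {c : Configuration (Fin (m + 1) × Fin (m + 1)) Mem k}
    (hf : ∀ d e σ o, (f d e σ o).2 = none)
    (hback : ∀ d e σ o, (f d e σ o).1.core.Walks → (f d e σ o).1.core.back = e.getD 0)
    (hb : ∀ i, (c i).mem.core.Walks → OnBoundary (c i).pos)
    (hw : ∀ i, (applyRule L f c i).mem.core.Walks → (c i).mem.core.Walks) (i : Fin k) :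
    (perform L (ringMacro f go) c i).mem.core = (applyRule L f c i).mem.core ∧
      (¬ (applyRule L f c i).mem.core.Walks →
        (perform L (ringMacro f go) c i).pos = (c i).pos) ∧
      ((applyRule L f c i).mem.core.Walks →
        ¬ go (nodeDegree (squareGrid (m + 1)) (c i).pos) →
          (perform L (ringMacro f go) c i).pos = (c i).pos) ∧
      ((applyRule L f c i).mem.core.Walks → go (nodeDegree (squareGrid (m + 1)) (c i).pos) →
        StepsOn L c (perform L (ringMacro f go) c) i) := by
  have hpos : (applyRule L f c i).pos = (c i).pos := by rw [applyRule_stay L (hf _ _ _ _)]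
  rw [ringMacro, perform_cons]
  refine ⟨perform_probes_advance_core L i, fun h => ?_, fun h hgo => ?_, fun h hgo => ?_⟩
  · rw [perform_probes_advance_of_not L h, hpos]
  · rw [perform_append, perform_cons, perform_nil, applyRule_advanceRule_of_not,
      (perform_probes L _ i).1, hpos]
    rw [(perform_probes L _ i).1, hpos]
    tauto
  · obtain ⟨w, h1, h2, h3, h4, h5⟩ := perform_ring L hm (go := go) h (by rwa [hpos])
      (by rw [hpos]; exact hb i (hw i h))
    rw [hpos] at h1 h3 h5
    rw [applyRule_mem] at h h3
    rw [hback _ _ _ _ h] at h3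
    exact ⟨by rwa [h4], by rwa [h4], by rw [h5, h4], by rwa [h4]⟩

/-- A robot that keeps making steps along the boundary follows the boundary cycle. -/
theorem exists_symm_of_stepsOn (hm : 0 < m) {N : ℕ} (hN : 0 < N)
    (c : ℕ → Configuration (Fin (m + 1) × Fin (m + 1)) Mem k) {i : Fin k}
    (hb : OnBoundary (c 0 i).pos) (h : ∀ n < N, StepsOn L (c n) (c (n + 1)) i) :
    ∃ (e : GridSymm m) (a : ℕ), a < m ∧ ∀ n ≤ N, (c n i).pos = e (ring m (a + n)) := by
  refine exists_symm_of_walk hm hN (fun n => (c n i).pos) ?_ (fun n hn => (h n hn).1) ?_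
  · rintro (_ | n) hn
    · exact hb
    · exact (h n hn).2.1
  · intro n hn he
    -- The entry port after step `n` leads back to the node of time `n`, so avoiding that port
    -- excludes a return.
    have h1 := (h (n + 1) (by omega)).2.2.2
    rw [(h n (by omega)).2.2.1, Option.getD_some] at h1
    exact h1 (congrArg _ he)

/-- The situation after the groups have reached the boundary: robots are settled, at most one on
each node, or walk along the boundary. -/
structure Calm (ident : Fin k → ℕ) (c : Configuration (Fin (m + 1) × Fin (m + 1)) Mem k) :
    Prop where
  id : ∀ i, (c i).mem.core.id = ident i
  mode : ∀ i, (c i).mem.core.mode = .settled ∨ (c i).mem.core.Walks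
  best : ∀ i, (c i).mem.core.best = 0
  ht : ∀ i, (c i).mem.core.ht = 0
  col : ∀ i, (c i).mem.core.col = 0
  unique : ∀ i j, (c i).mem.core.mode = .settled → (c j).mem.core.mode = .settled →
    (c i).pos = (c j).pos → i = j
  boundary : ∀ i, (c i).mem.core.Walks → OnBoundary (c i).pos

theorem Core.Walks.ne_settled {κ : Core} (h : κ.Walks) : κ.mode ≠ .settled := by
  rw [Core.Walks] at h; simp [h]

variable {ident : Fin k → ℕ} {c : Configuration (Fin (m + 1) × Fin (m + 1)) Mem k}

/-- The condition under which a walker settles. -/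
def MaySettle (c : Configuration (Fin (m + 1) × Fin (m + 1)) Mem k) (i : Fin k) : Prop :=
  ∀ j, j ≠ i → (c j).pos = (c i).pos →
    (c j).mem.core.mode ≠ .settled ∧
      ((c j).mem.core.Walks → (c i).mem.core.id < (c j).mem.core.id)

theorem applyRule_settleRule (i : Fin k) :
    (applyRule L settleRule c i).mem.core =
      if (c i).mem.core.Walks then
        if MaySettle c i then { (c i).mem.core with mode := .settled }
        else { (c i).mem.core with back := (c i).entry.getD 0 }
      else (c i).mem.core := by
  rw [applyRule_mem, settleRule]
  simp only [Configuration.forall_mem_others]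
  by_cases h : (c i).mem.core.Walks
  · have : ((∀ j, j ≠ i → (c j).pos = (c i).pos → (c j).mem.core.mode ≠ Mode.settled) ∧
        ∀ j, j ≠ i → (c j).pos = (c i).pos → (c j).mem.core.Walks →
          (c i).mem.core.id < (c j).mem.core.id) ↔ MaySettle c i :=
      ⟨fun h j hj hp => ⟨h.1 j hj hp, h.2 j hj hp⟩,
        fun h => ⟨fun j hj hp => (h j hj hp).1, fun j hj hp => (h j hj hp).2⟩⟩
    simp only [h, if_true, this]
    split_ifs <;> rfl
  · simp [h]

/-- On a node without settled robot, the robot of least identifier is a walker and may settle.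
Distinctness of identifiers turns "least" into "strictly least". -/
theorem exists_settled_or_maySettle (hc : Calm ident c) (hident : Function.Injective ident)
    (i : Fin k) :
    ∃ j, (c j).pos = (c i).pos ∧
      ((c j).mem.core.mode = .settled ∨ (c j).mem.core.Walks ∧ MaySettle c j) := by
  by_cases h : ∃ j, (c j).pos = (c i).pos ∧ (c j).mem.core.mode = .settled
  · obtain ⟨j, h1, h2⟩ := h
    exact ⟨j, h1, .inl h2⟩
  · push Not at h
    obtain ⟨j, hj, hmin⟩ := Finset.exists_min_image
      (Finset.univ.filter fun j => (c j).pos = (c i).pos) (fun j => (c j).mem.core.id)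
      ⟨i, by simp⟩
    simp only [Finset.mem_filter, Finset.mem_univ, true_and] at hj hmin
    refine ⟨j, hj, .inr ⟨(hc.mode j).resolve_left (h j hj), fun l hl hp => ?_⟩⟩
    refine ⟨h l (hp.trans hj), fun _ => lt_of_le_of_ne (hmin l (hp.trans hj)) fun he => hl ?_⟩
    rw [hc.id, hc.id] at he
    exact (hident he).symm

/-- The last clause drives the argument: whenever a walker moves on, the node it leaves carries a
settled robot, and by the second clause this remains so. -/
theorem settle_step (hm : 0 < m) (hident : Function.Injective ident) (hc : Calm ident c) :
    Calm ident (perform L (ringMacro settleRule fun _ => True) c) ∧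
    (∀ i, (c i).mem.core.mode = .settled →
      (perform L (ringMacro settleRule fun _ => True) c i).mem.core.mode = .settled ∧
      (perform L (ringMacro settleRule fun _ => True) c i).pos = (c i).pos) ∧
    ∀ i, (perform L (ringMacro settleRule fun _ => True) c i).mem.core.Walks →
      (c i).mem.core.Walks ∧
      StepsOn L c (perform L (ringMacro settleRule fun _ => True) c) i ∧
      ∃ j, (perform L (ringMacro settleRule fun _ => True) c j).mem.core.mode = .settled ∧
        (perform L (ringMacro settleRule fun _ => True) c j).pos = (c i).pos := by
  have hcore := applyRule_settleRule L (c := c)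
  have hw : ∀ i, (applyRule L settleRule c i).mem.core.Walks →
      (c i).mem.core.Walks ∧ ¬ MaySettle c i := by
    intro i hi
    rw [hcore] at hi
    split_ifs at hi with h1 h2
    · simp [Core.Walks] at hi
    · exact ⟨h1, h2⟩
    · exact absurd hi h1
  have hmac := perform_ringMacro L hm (f := settleRule) (go := fun _ => True) (c := c)
    (fun _ _ _ _ => rfl) (by
      intro d e σ o
      simp only [settleRule]
      split_ifs with h1 h2
      · simp [Core.Walks]
      · simp
      · exact fun h => absurd h h1) hc.boundary (fun i hi => (hw i hi).1)
  generalize perform L (ringMacro settleRule fun _ => True) c = c' at *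
  generalize applyRule L settleRule c = b at *
  have hset : ∀ i, (c' i).mem.core.mode = .settled ↔ (c i).mem.core.mode = .settled ∨
      (c i).mem.core.Walks ∧ MaySettle c i := by
    intro i
    rw [(hmac i).1, hcore]
    split_ifs with h1 h2
    · simp [h1, h2]
    · simp [h2]
    · simp [h1]
  have hpos : ∀ i, (c' i).mem.core.mode = .settled → (c' i).pos = (c i).pos := by
    intro i hi
    apply (hmac i).2.1
    rw [← (hmac i).1]
    exact fun h => h.ne_settled hi
  refine ⟨⟨?_, ?_, ?_, ?_, ?_, ?_, ?_⟩, ?_, ?_⟩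
  · intro i
    rw [(hmac i).1, hcore, ← hc.id]
    split_ifs <;> rfl
  · intro i
    by_cases hs : (c' i).mem.core.mode = .settled
    · exact .inl hs
    · right
      rw [hset] at hs
      push Not at hs
      have hwi := (hc.mode i).resolve_left hs.1
      rw [(hmac i).1, hcore, if_pos hwi, if_neg (hs.2 hwi)]
      exact hwi
  · intro i
    rw [(hmac i).1, hcore, ← hc.best i]
    split_ifs <;> rfl
  · intro i
    rw [(hmac i).1, hcore, ← hc.ht i]
    split_ifs <;> rfl
  · intro i
    rw [(hmac i).1, hcore, ← hc.col i]
    split_ifs <;> rfl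
  · intro i j hi hj hij
    rw [hpos i hi, hpos j hj] at hij
    rw [hset] at hi hj
    by_contra hne
    rcases hi with hi | ⟨hi, hi'⟩ <;> rcases hj with hj | ⟨hj, hj'⟩
    · exact hne (hc.unique i j hi hj hij)
    · exact (hj' i hne hij).1 hi
    · exact (hi' j (Ne.symm hne) hij.symm).1 hj
    · exact lt_asymm ((hj' i hne hij).2 hi) ((hi' j (Ne.symm hne) hij.symm).2 hj)
  · intro i hi
    rw [(hmac i).1] at hi
    exact ((hmac i).2.2.2 hi trivial).2.1
  · exact fun i hi => ⟨(hset i).2 (.inl hi), hpos i ((hset i).2 (.inl hi))⟩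
  · intro i hi
    rw [(hmac i).1] at hi
    refine ⟨(hw i hi).1, (hmac i).2.2.2 hi trivial, ?_⟩
    obtain ⟨j, hj, hj'⟩ := exists_settled_or_maySettle hc hident i
    have := (hset j).2 hj'
    exact ⟨j, this, (hpos j this).trans hj⟩

/-- After one turn along the boundary either all robots are settled, or all boundary nodes are
occupied by settled robots. -/
theorem settlePart_spec (hm : 0 < m) (hident : Function.Injective ident) (hc : Calm ident c) :
    Calm ident (perform L (settlePart m) c) ∧
    ((∃ i, (perform L (settlePart m) c i).mem.core.Walks) →
      ∀ x, OnBoundary x → ∃ j, (perform L (settlePart m) c j).mem.core.mode = .settled ∧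
        (perform L (settlePart m) c j).pos = x) := by
  set b : ℕ → Configuration (Fin (m + 1) × Fin (m + 1)) Mem k := fun n =>
    perform L ((List.range n).flatMap fun _ => ringMacro settleRule fun _ => True) c with hb
  have hsucc : ∀ n, b (n + 1) = perform L (ringMacro settleRule fun _ => True) (b n) :=
    fun n => perform_flatMap_range_succ L _ n c
  have hcalm : ∀ n, Calm ident (b n) := by
    intro n
    induction n with
    | zero => exact hc
    | succ n ih => rw [hsucc]; exact (settle_step L hm hident ih).1
  refine ⟨hcalm _, ?_⟩
  rintro ⟨i, hi⟩ x hx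
  have hwalk : ∀ n, ∀ l, (b (n + l) i).mem.core.Walks → (b n i).mem.core.Walks := by
    intro n l
    induction l with
    | zero => exact id
    | succ l ih =>
      intro h
      rw [← add_assoc, hsucc] at h
      exact ih ((settle_step L hm hident (hcalm _)).2.2 i h).1
  have hwalk' : ∀ n ≤ 4 * m, (b n i).mem.core.Walks := fun n hn =>
    hwalk n (4 * m - n) (by rwa [Nat.add_sub_cancel' hn])
  have hstay : ∀ n l j, (b n j).mem.core.mode = .settled →
      (b (n + l) j).mem.core.mode = .settled ∧ (b (n + l) j).pos = (b n j).pos := by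
    intro n l j hj
    induction l with
    | zero => exact ⟨hj, rfl⟩
    | succ l ih =>
      have := (settle_step L hm hident (hcalm (n + l))).2.1 j ih.1
      rw [← hsucc] at this
      exact ⟨this.1, this.2.trans ih.2⟩
  -- A robot that walks in the end has walked all the time, hence has made a full turn.
  obtain ⟨e, a, ha, hea⟩ := exists_symm_of_stepsOn L hm (N := 4 * m) (by omega) b (i := i)
    ((hcalm 0).boundary i (hwalk' 0 (by omega))) (fun n hn => by
      have h := hwalk' (n + 1) hn
      rw [hsucc] at h
      have := ((settle_step L hm hident (hcalm _)).2.2 i h).2.1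
      rwa [← hsucc] at this)
  obtain ⟨n, hn, rfl⟩ := exists_ring_eq hm e ha hx
  have h := hwalk' (n + 1) hn
  rw [hsucc] at h
  obtain ⟨j, hj, hj'⟩ := ((settle_step L hm hident (hcalm _)).2.2 i h).2.2
  rw [← hsucc] at hj hj'
  have := hstay (n + 1) (4 * m - (n + 1)) j hj
  rw [Nat.add_sub_cancel' (by omega)] at this
  refine ⟨j, this.1, ?_⟩
  rw [← hea n hn.le, ← hj']
  exact this.2

end boundary

/-! ### The tour of the boundary -/

section tour

variable {m k : ℕ} (L : PortLabeling (squareGrid (m + 1)))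
  {ident : Fin k → ℕ} {c : Configuration (Fin (m + 1) × Fin (m + 1)) Mem k}

/-- Walkers wait at corners, so that all of them are at corners when the tour starts. -/
theorem corner_step (hm : 0 < m) (hc : Calm ident c) :
    let c' := perform L (ringMacro (orientRule Core.Walks) fun d => d ≠ 2) c
    Calm ident c' ∧ (∀ i, (c' i).mem.core.mode = (c i).mem.core.mode) ∧
    (∀ i, (c i).mem.core.mode = .settled → (c' i).pos = (c i).pos) ∧
    ∀ i, (c i).mem.core.Walks →
      (nodeDegree (squareGrid (m + 1)) (c i).pos = 2 → (c' i).pos = (c i).pos) ∧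
      (nodeDegree (squareGrid (m + 1)) (c i).pos ≠ 2 → StepsOn L c c' i) := by
  intro c'
  have hcore : ∀ i, (applyRule L (orientRule Core.Walks) c i).mem.core =
      if (c i).mem.core.Walks then { (c i).mem.core with back := (c i).entry.getD 0 }
      else (c i).mem.core := by
    intro i
    rw [applyRule_mem, orientRule]
    split_ifs <;> rfl
  have hw : ∀ i, (applyRule L (orientRule Core.Walks) c i).mem.core.Walks ↔
      (c i).mem.core.Walks := by
    intro i
    rw [hcore]
    split_ifs with h
    · exact Iff.rfl
    · exact Iff.rfl
  have hmac := perform_ringMacro L hm (f := orientRule Core.Walks) (go := fun d => d ≠ 2) (c := c)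
    (fun _ _ _ _ => rfl) (by
      intro d e σ o
      simp only [orientRule]
      split_ifs with h1
      · simp
      · exact fun h => absurd h h1) hc.boundary (fun i hi => (hw i).1 hi)
  change ∀ i, (c' i).mem.core = _ ∧ (_ → (c' i).pos = _) ∧ (_ → _ → (c' i).pos = _) ∧
    (_ → _ → StepsOn L c c' i) at hmac
  generalize c' = c' at *
  generalize applyRule L (orientRule Core.Walks) c = b at *
  have hmode : ∀ i, (c' i).mem.core.mode = (c i).mem.core.mode := by
    intro i; rw [(hmac i).1, hcore]; split_ifs <;> rfl
  have hw' : ∀ i, (c' i).mem.core.Walks ↔ (c i).mem.core.Walks := by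
    intro i; rw [Core.Walks, Core.Walks, hmode]
  have hpos : ∀ i, (c i).mem.core.mode = .settled → (c' i).pos = (c i).pos := by
    intro i hi
    refine (hmac i).2.1 ?_
    rw [hw]
    exact fun h => h.ne_settled hi
  have hwalk : ∀ i, (c i).mem.core.Walks →
      (nodeDegree (squareGrid (m + 1)) (c i).pos = 2 → (c' i).pos = (c i).pos) ∧
      (nodeDegree (squareGrid (m + 1)) (c i).pos ≠ 2 → StepsOn L c c' i) := by
    intro i hi
    exact ⟨fun h => (hmac i).2.2.1 ((hw i).2 hi) (by simpa using h),
      fun h => (hmac i).2.2.2 ((hw i).2 hi) h⟩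
  refine ⟨⟨?_, ?_, ?_, ?_, ?_, ?_, ?_⟩, hmode, hpos, hwalk⟩
  · intro i
    rw [(hmac i).1, hcore, ← hc.id]
    split_ifs <;> rfl
  · intro i
    rw [hw', hmode]
    exact hc.mode i
  · intro i
    rw [(hmac i).1, hcore, ← hc.best i]
    split_ifs <;> rfl
  · intro i
    rw [(hmac i).1, hcore, ← hc.ht i]
    split_ifs <;> rfl
  · intro i
    rw [(hmac i).1, hcore, ← hc.col i]
    split_ifs <;> rfl
  · intro i j hi hj hij
    rw [hmode] at hi hj
    rw [hpos i hi, hpos j hj] at hij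
    exact hc.unique i j hi hj hij
  · intro i hi
    rw [hw'] at hi
    by_cases h : nodeDegree (squareGrid (m + 1)) (c i).pos = 2
    · rw [(hwalk i hi).1 h]
      exact hc.boundary i hi
    · exact ((hwalk i hi).2 h).2.1

/-- The walkers reach corners. -/
theorem cornerPart_spec (hm : 0 < m) (hc : Calm ident c) :
    let c' := perform L (cornerPart m) c
    Calm ident c' ∧ (∀ i, (c' i).mem.core.mode = (c i).mem.core.mode) ∧
    (∀ i, (c i).mem.core.mode = .settled → (c' i).pos = (c i).pos) ∧
    ∀ i, (c' i).mem.core.Walks → nodeDegree (squareGrid (m + 1)) (c' i).pos = 2 := by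
  set b : ℕ → Configuration (Fin (m + 1) × Fin (m + 1)) Mem k := fun n =>
    perform L ((List.range n).flatMap fun _ =>
      ringMacro (orientRule Core.Walks) fun d => d ≠ 2) c with hb
  have hsucc : ∀ n, b (n + 1) =
      perform L (ringMacro (orientRule Core.Walks) fun d => d ≠ 2) (b n) :=
    fun n => perform_flatMap_range_succ L _ n c
  have hinv : ∀ n, Calm ident (b n) ∧ (∀ i, (b n i).mem.core.mode = (c i).mem.core.mode) ∧
      (∀ i, (c i).mem.core.mode = .settled → (b n i).pos = (c i).pos) := by
    intro n
    induction n with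
    | zero => exact ⟨hc, fun _ => rfl, fun _ _ => rfl⟩
    | succ n ih =>
      rw [hsucc]
      obtain ⟨h1, h2, h3, -⟩ := corner_step L hm ih.1
      refine ⟨h1, fun i => (h2 i).trans (ih.2.1 i), fun i hi => ?_⟩
      exact (h3 i (by rw [ih.2.1, hi])).trans (ih.2.2 i hi)
  refine ⟨(hinv m).1, (hinv m).2.1, (hinv m).2.2, fun i hi => ?_⟩
  have hwalk : ∀ n, (b n i).mem.core.Walks := by
    intro n
    have : (b m i).mem.core.mode = .walker := hi
    rw [(hinv m).2.1] at this
    rw [Core.Walks, (hinv n).2.1, this]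
  have hcorner : ∀ n l, nodeDegree (squareGrid (m + 1)) (b n i).pos = 2 →
      nodeDegree (squareGrid (m + 1)) (b (n + l) i).pos = 2 := by
    intro n l h
    induction l with
    | zero => exact h
    | succ l ih =>
      have := ((corner_step L hm (hinv (n + l)).1).2.2.2 i (hwalk _)).1 ih
      rw [← add_assoc, hsucc]
      rw [this]
      exact ih
  -- A walker that is not at a corner in the end has never been at one, so it has made `m` genuine
  -- steps, which is enough to meet a corner.
  by_contra hne
  have hne' : ∀ n ≤ m, nodeDegree (squareGrid (m + 1)) (b n i).pos ≠ 2 := by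
    intro n hn h
    have := hcorner n (m - n) h
    rw [Nat.add_sub_cancel' hn] at this
    exact hne this
  obtain ⟨e, a, ha, hea⟩ := exists_symm_of_stepsOn L hm hm b (i := i)
    ((hinv 0).1.boundary i (hwalk 0)) (fun n hn => by
      have := ((corner_step L hm (hinv n).1).2.2.2 i (hwalk _)).2 (hne' n hn.le)
      rw [hsucc]
      exact this)
  obtain ⟨n, hn, h⟩ := exists_corner hm e ha
  rw [← hea n hn] at h
  exact hne' n hn h

/-- Walkers on the node of robot `i`. -/
def visitorIds (c : Configuration (Fin (m + 1) × Fin (m + 1)) Mem k) (i : Fin k) : Set ℕ :=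
  {a | ∃ j, (c j).pos = (c i).pos ∧ (c j).mem.core.Walks ∧ (c j).mem.core.id = a}

theorem applyRule_noteRule (n : ℕ) (i : Fin k) :
    (applyRule L (noteRule n) c i).mem.core =
      if (c i).mem.core.Walks then { (c i).mem.core with back := (c i).entry.getD 0 }
      else if (c i).mem.core.mode = .settled ∧ (visitorIds c i).Nonempty ∧
        ((c i).mem.core.best = 0 ∨ sInf (visitorIds c i) + 1 < (c i).mem.core.best) then
        { (c i).mem.core with best := sInf (visitorIds c i) + 1, idx := n }
      else (c i).mem.core := by
  rw [applyRule_mem, noteRule]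
  by_cases h : (c i).mem.core.Walks
  · simp [h]
  · have hne : ∀ j, (c j).mem.core.Walks → j ≠ i := by
      rintro j hj rfl; exact h hj
    have h1 : {a | ∃ τ ∈ c.others i, τ.core.Walks ∧ τ.core.id = a} = visitorIds c i := by
      ext a
      simp only [Configuration.exists_mem_others, visitorIds, Set.mem_ofPred_eq]
      exact ⟨fun ⟨j, _, h⟩ => ⟨j, h⟩, fun ⟨j, h⟩ => ⟨j, hne j h.2.1, h⟩⟩
    have h2 : (∃ τ ∈ c.others i, τ.core.Walks) ↔ (visitorIds c i).Nonempty := by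
      rw [← h1]
      exact ⟨fun ⟨τ, hτ, h⟩ => ⟨_, τ, hτ, h, rfl⟩, fun ⟨_, τ, hτ, h, _⟩ => ⟨τ, hτ, h⟩⟩
    simp only [h, if_false, h1, h2]
    split_ifs <;> rfl

theorem tour_step (hm : 0 < m) (n : ℕ)
    (hb : ∀ i, (c i).mem.core.Walks → OnBoundary (c i).pos) (i : Fin k) :
    let c' := perform L (ringMacro (noteRule n) fun _ => True) c
    (c' i).mem.core = (applyRule L (noteRule n) c i).mem.core ∧
    (¬ (c i).mem.core.Walks → (c' i).pos = (c i).pos) ∧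
    ((c i).mem.core.Walks → StepsOn L c c' i) := by
  intro c'
  have hw : ∀ i, (applyRule L (noteRule n) c i).mem.core.Walks ↔ (c i).mem.core.Walks := by
    intro i
    rw [applyRule_noteRule]
    split_ifs <;> exact Iff.rfl
  have hmac := perform_ringMacro L hm (f := noteRule n) (go := fun _ => True) (c := c)
    (fun _ _ _ _ => rfl) (by
      intro d e σ o
      simp only [noteRule]
      split_ifs with h1 h2
      · simp
      · exact fun h => absurd h h1
      · exact fun h => absurd h h1) hb (fun i hi => (hw i).1 hi) i
  rw [hw] at hmac
  exact ⟨hmac.1, hmac.2.1, fun h => hmac.2.2.2 h trivial⟩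

/-- After the tour, the settled robots on the boundary agree on a numbering of the boundary. -/
theorem tourPart_spec (hm : 0 < m) (hident : Function.Injective ident) (hc : Calm ident c)
    (hcorner : ∀ i, (c i).mem.core.Walks → nodeDegree (squareGrid (m + 1)) (c i).pos = 2)
    (hex : ∃ i, (c i).mem.core.Walks) :
    let c' := perform L (tourPart m) c
    (∀ i, (c' i).mem.core.mode = (c i).mem.core.mode ∧ (c' i).mem.core.id = (c i).mem.core.id ∧
      (c' i).mem.core.ht = 0) ∧
    (∀ i, (c i).mem.core.mode = .settled → (c' i).pos = (c i).pos) ∧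
    ∃ e : GridSymm m, ∀ i, (c i).mem.core.mode = .settled →
      (∀ n < 4 * m, (c i).pos = e (ring m n) → (c' i).mem.core.best ≠ 0 ∧
        (c' i).mem.core.idx = n) ∧
      (¬ OnBoundary (c i).pos → (c' i).mem.core.best = 0) := by
  set b : ℕ → Configuration (Fin (m + 1) × Fin (m + 1)) Mem k := fun n =>
    perform L ((List.range n).flatMap fun n => ringMacro (noteRule n) fun _ => True) c with hb
  have hsucc : ∀ n, b (n + 1) = perform L (ringMacro (noteRule n) fun _ => True) (b n) :=
    fun n => perform_flatMap_range_succ L _ n c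
  have hinv : ∀ n, (∀ i, (b n i).mem.core.mode = (c i).mem.core.mode ∧
      (b n i).mem.core.id = (c i).mem.core.id ∧ (b n i).mem.core.ht = 0) ∧
      (∀ i, (c i).mem.core.mode = .settled → (b n i).pos = (c i).pos) ∧
      (∀ i, (c i).mem.core.Walks → OnBoundary (b n i).pos) := by
    intro n
    induction n with
    | zero => exact ⟨fun i => ⟨rfl, rfl, hc.ht i⟩, fun _ _ => rfl, hc.boundary⟩
    | succ n ih =>
      obtain ⟨ih1, ih2, ih3⟩ := ih
      have hwalks : ∀ i, (b n i).mem.core.Walks ↔ (c i).mem.core.Walks := by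
        intro i; rw [Core.Walks, Core.Walks, (ih1 i).1]
      have hst := tour_step L hm n (c := b n) (fun i hi => ih3 i ((hwalks i).1 hi))
      simp only [← hsucc] at hst
      refine ⟨fun i => ?_, fun i hi => ?_, fun i hi => ?_⟩
      · rw [(hst i).1, applyRule_noteRule, ← (ih1 i).1, ← (ih1 i).2.1, ← (ih1 i).2.2]
        split_ifs <;> exact ⟨rfl, rfl, rfl⟩
      · rw [(hst i).2.1 (fun h => ((hwalks i).1 h).ne_settled hi), ih2 i hi]
      · exact ((hst i).2.2 ((hwalks i).2 hi)).2.1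
  have hwalks : ∀ n i, (b n i).mem.core.Walks ↔ (c i).mem.core.Walks := by
    intro n i; rw [Core.Walks, Core.Walks, ((hinv n).1 i).1]
  have hid : ∀ n i, (b n i).mem.core.id = ident i := fun n i => by
    rw [((hinv n).1 i).2.1, hc.id]
  have hst : ∀ n i, (b (n + 1) i).mem.core = (applyRule L (noteRule n) (b n) i).mem.core ∧
      ((b n i).mem.core.Walks → StepsOn L (b n) (b (n + 1)) i) := by
    intro n i
    have := tour_step L hm n (c := b n) (fun i hi => (hinv n).2.2 i ((hwalks n i).1 hi)) i
    simp only [← hsucc] at this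
    exact ⟨this.1, this.2.2⟩
  refine ⟨(hinv (4 * m)).1, (hinv (4 * m)).2.1, ?_⟩
  -- The leader `w` is the walker of least identifier. Its visits prevail, whatever directions the
  -- other walkers take.
  obtain ⟨w, hw, hmin⟩ := Finset.exists_min_image
    (Finset.univ.filter fun i => (c i).mem.core.Walks) ident
    (hex.imp fun i hi => by simpa using hi)
  simp only [Finset.mem_filter, Finset.mem_univ, true_and] at hw hmin
  obtain ⟨e, a, ha, hea⟩ := exists_symm_of_stepsOn L hm (N := 4 * m) (by omega) b (i := w)
    (hc.boundary w hw) (fun n _ => (hst n w).2 ((hwalks n w).2 hw))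
  obtain rfl : a = 0 := by
    apply ring_start_of_corner hm e ha
    have := hea 0 (by omega)
    rw [add_zero] at this
    rw [← this]
    exact hcorner w hw
  simp only [zero_add] at hea
  refine ⟨e, fun i hi => ?_⟩
  have hnw : ∀ n, ¬ (b n i).mem.core.Walks := fun n h => ((hwalks n i).1 h).ne_settled hi
  -- Before the leader's visit, `best` is empty or larger than the leader's value; from that visit
  -- on it is the leader's value; off the boundary it stays empty. Successors of identifiers are
  -- stored so that `0` can mean "empty".
  have key : ∀ n ≤ 4 * m,
      (∀ n' < n, (c i).pos = e (ring m n') →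
        (b n i).mem.core.best = ident w + 1 ∧ (b n i).mem.core.idx = n') ∧
      ((∀ n' < n, (c i).pos ≠ e (ring m n')) →
        (b n i).mem.core.best = 0 ∨ ident w + 1 < (b n i).mem.core.best) ∧
      (¬ OnBoundary (c i).pos → (b n i).mem.core.best = 0) := by
    intro n
    induction n with
    | zero =>
      intro _
      exact ⟨by simp, fun _ => .inl (hc.best i), fun _ => hc.best i⟩
    | succ n ih =>
      intro hn
      obtain ⟨ih1, ih2, ih3⟩ := ih (by omega)
      have hcore := (hst n i).1
      rw [applyRule_noteRule, if_neg (hnw n)] at hcore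
      have hposi := (hinv n).2.1 i hi
      have hmode : (b n i).mem.core.mode = .settled := by rw [((hinv n).1 i).1, hi]
      have hge : (visitorIds (b n) i).Nonempty → ident w ≤ sInf (visitorIds (b n) i) ∧
          (sInf (visitorIds (b n) i) = ident w → (c i).pos = e (ring m n)) ∧
          OnBoundary (c i).pos := by
        intro hne
        obtain ⟨j, hj1, hj2, hj3⟩ := Nat.sInf_mem hne
        rw [hid] at hj3
        rw [hposi] at hj1
        rw [hwalks] at hj2
        refine ⟨hj3 ▸ hmin j hj2, fun h => ?_, hj1 ▸ (hinv n).2.2 j hj2⟩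
        rw [← hj3] at h
        obtain rfl := hident h
        rw [← hj1, hea n (by omega)]
      by_cases hp : (c i).pos = e (ring m n)
      · have hmem : ident w ∈ visitorIds (b n) i :=
          ⟨w, by rw [hposi, hp, hea n (by omega)], (hwalks n w).2 hw, hid n w⟩
        have hinf : sInf (visitorIds (b n) i) = ident w :=
          le_antisymm (Nat.sInf_le hmem) (hge ⟨_, hmem⟩).1
        -- During one turn the leader visits each boundary node only once.
        have hnew : ∀ n' < n, (c i).pos ≠ e (ring m n') := by
          intro n' hn' h
          have := ring_injOn (by omega) (by omega) (e.injective (hp.symm.trans h))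
          omega
        rw [if_pos ⟨hmode, ⟨_, hmem⟩, by rw [hinf]; exact ih2 hnew⟩, hinf] at hcore
        rw [hcore]
        refine ⟨fun n' hn' h => ⟨rfl, ?_⟩, fun h => absurd hp (h n (by omega)), fun h => ?_⟩
        · exact ring_injOn (i := n) (by omega) (by omega) (e.injective (hp.symm.trans h))
        · exact absurd (hge ⟨_, hmem⟩).2.2 h
      · have hlt : ∀ n' < n + 1, (c i).pos = e (ring m n') → n' < n := by
          intro n' hn' h
          rcases (Nat.lt_succ_iff.1 hn').lt_or_eq with h1 | rfl
          · exact h1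
          · exact absurd h hp
        split_ifs at hcore with hif
        -- An update by another walker can happen only before the leader's visit.
        · have hgt : ident w < sInf (visitorIds (b n) i) :=
            lt_of_le_of_ne (hge hif.2.1).1 fun h => hp ((hge hif.2.1).2.1 h.symm)
          rw [hcore]
          refine ⟨fun n' hn' h => ?_, fun h => .inr (by simpa using hgt),
            fun h => absurd (hge hif.2.1).2.2 h⟩
          have := (ih1 n' (hlt n' hn' h) h).1
          rcases hif.2.2 with h0 | h0 <;> omega
        · rw [hcore]
          exact ⟨fun n' hn' h => ih1 n' (hlt n' hn' h) h,
            fun h => ih2 fun n' hn' => h n' (by omega), ih3⟩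
  obtain ⟨h1, -, h3⟩ := key (4 * m) le_rfl
  refine ⟨fun n hn h => ?_, h3⟩
  have := h1 n hn h
  exact ⟨fun h0 => absurd (this.1.symm.trans h0) (by omega), this.2⟩

end tour

/-! ### The sweep -/

section sweep

variable {m k : ℕ} (L : PortLabeling (squareGrid (m + 1)))

theorem symm_gridPoint_inj (e : GridSymm m) {a b a' b' : ℕ} (ha : a ≤ m) (hb : b ≤ m)
    (ha' : a' ≤ m) (hb' : b' ≤ m) (h : e (gridPoint m a b) = e (gridPoint m a' b')) :
    a = a' ∧ b = b' := by
  have := e.injective h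
  rw [grid_eq_iff] at this
  simp only [gridPoint_fst, gridPoint_snd] at this
  omega

theorem exists_symm_gridPoint (e : GridSymm m) (x : Fin (m + 1) × Fin (m + 1)) :
    ∃ a b, a ≤ m ∧ b ≤ m ∧ x = e (gridPoint m a b) := by
  refine ⟨(e.symm x).1, (e.symm x).2, by omega, by omega, ?_⟩
  rw [gridPoint_coe]
  simp

theorem symm_gridPoint_adj (e : GridSymm m) {a b a' b' : ℕ} (ha : a ≤ m) (hb : b ≤ m)
    (ha' : a' ≤ m) (hb' : b' ≤ m) :
    (squareGrid (m + 1)).Adj (e (gridPoint m a b)) (e (gridPoint m a' b')) ↔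
      ((a + 1 = a' ∨ a' + 1 = a) ∧ b = b') ∨ ((b + 1 = b' ∨ b' + 1 = b) ∧ a = a') := by
  rw [e.map_adj_iff, gridPoint_adj ha hb ha' hb']

/-- The sweepers occupy row `r`, with respect to the coordinates given by `e`, and all other robots
are on this row or above. -/
structure Front (ident : Fin k → ℕ) (e : GridSymm m) (r : ℕ)
    (c : Configuration (Fin (m + 1) × Fin (m + 1)) Mem k) : Prop where
  id : ∀ i, (c i).mem.core.id = ident i
  ht : ∀ i, (c i).mem.core.ht = 0
  le : ∀ i, (c i).mem.core.Sweeps → (c i).mem.core.idx ≤ m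
  place : ∀ i, (c i).mem.core.Sweeps → (c i).pos = e (gridPoint m r (c i).mem.core.idx)
  full : ∀ j ≤ m, ∃ i, (c i).mem.core.Sweeps ∧ (c i).mem.core.idx = j
  unique : ∀ i i', (c i).mem.core.Sweeps → (c i').mem.core.Sweeps →
    (c i).mem.core.idx = (c i').mem.core.idx → i = i'
  rows : ∀ i, ∃ a b, r ≤ a ∧ a ≤ m ∧ b ≤ m ∧ (c i).pos = e (gridPoint m a b)

/-- The sweepers know the way to the row they came from. -/
def FrontEntry (e : GridSymm m) (r : ℕ) (c : Configuration (Fin (m + 1) × Fin (m + 1)) Mem k) :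
    Prop :=
  ∀ i, (c i).mem.core.Sweeps → (c i).entry.getD 0 =
    if r = 0 then 0 else L.port (c i).pos (e (gridPoint m (r - 1) (c i).mem.core.idx))

variable {ident : Fin k → ℕ} {c : Configuration (Fin (m + 1) × Fin (m + 1)) Mem k}

/-- Positions up to `m` of the tour form one side. Settled robots in the interior have `best = 0`,
so their `idx` is disregarded. The round is spent without moving, which leaves no entry port, as
`FrontEntry` requires for row `0`. -/
theorem enlist_spec (hm : 0 < m)
    (hid : ∀ i, (c i).mem.core.id = ident i) (hht : ∀ i, (c i).mem.core.ht = 0)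
    (hmode : ∀ i, (c i).mem.core.mode = .settled ∨ (c i).mem.core.Walks)
    (hunique : ∀ i j, (c i).mem.core.mode = .settled → (c j).mem.core.mode = .settled →
      (c i).pos = (c j).pos → i = j)
    (hfull : ∀ x, OnBoundary x → ∃ j, (c j).mem.core.mode = .settled ∧ (c j).pos = x)
    (e : GridSymm m) (he : ∀ i, (c i).mem.core.mode = .settled →
      (∀ n < 4 * m, (c i).pos = e (ring m n) → (c i).mem.core.best ≠ 0 ∧
        (c i).mem.core.idx = n) ∧
      (¬ OnBoundary (c i).pos → (c i).mem.core.best = 0)) :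
    Front ident e 0 (applyRule L (enlistRule m) c) ∧
      FrontEntry L e 0 (applyRule L (enlistRule m) c) := by
  have hrule : ∀ i, applyRule L (enlistRule m) c i =
      ⟨(c i).pos, if (c i).mem.core.mode = .settled ∧ (c i).mem.core.best ≠ 0 ∧
        (c i).mem.core.idx ≤ m then
        { (c i).mem with core := { (c i).mem.core with mode := .sweeper } } else (c i).mem,
        none⟩ := fun i => rfl
  have hcore : ∀ i, (applyRule L (enlistRule m) c i).mem.core.id = (c i).mem.core.id ∧
      (applyRule L (enlistRule m) c i).mem.core.ht = (c i).mem.core.ht ∧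
      (applyRule L (enlistRule m) c i).mem.core.idx = (c i).mem.core.idx ∧
      ((applyRule L (enlistRule m) c i).mem.core.Sweeps ↔ (c i).mem.core.mode = .settled ∧
        (c i).mem.core.best ≠ 0 ∧ (c i).mem.core.idx ≤ m) ∧
      (applyRule L (enlistRule m) c i).pos = (c i).pos ∧
      (applyRule L (enlistRule m) c i).entry = none := by
    intro i
    rw [hrule]
    split_ifs with h
    · simp [Core.Sweeps, h]
    · refine ⟨rfl, rfl, rfl, ⟨fun h' => ?_, fun h' => absurd h' h⟩, rfl, rfl⟩
      rcases hmode i with h1 | h1 <;> simp [Core.Sweeps, Core.Walks] at h' h1 <;>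
        simp [h'] at h1
  generalize applyRule L (enlistRule m) c = b at *
  have hring : ∀ i, (b i).mem.core.Sweeps → (c i).pos = e (gridPoint m 0 (c i).mem.core.idx) := by
    intro i hi
    obtain ⟨h1, h2, h3⟩ := (hcore i).2.2.2.1.1 hi
    have hbd : OnBoundary (c i).pos := by
      by_contra h
      exact h2 ((he i h1).2 h)
    obtain ⟨n, hn, hx⟩ := exists_ring_eq hm e hm hbd
    rw [zero_add] at hx
    have := ((he i h1).1 n hn hx).2
    rw [this] at h3 ⊢
    rw [hx, ring_of_le h3]
  refine ⟨⟨?_, ?_, ?_, ?_, ?_, ?_, ?_⟩, ?_⟩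
  · intro i; rw [(hcore i).1, hid]
  · intro i; rw [(hcore i).2.1, hht]
  · intro i hi
    rw [(hcore i).2.2.1]
    exact ((hcore i).2.2.2.1.1 hi).2.2
  · intro i hi
    rw [(hcore i).2.2.2.2.1, hring i hi, (hcore i).2.2.1]
  · intro j hj
    obtain ⟨i, hi, hp⟩ := hfull (e (ring m j)) ((onBoundary_iso e).2 (ring_onBoundary hm j))
    obtain ⟨h1, h2⟩ := (he i hi).1 j (by omega) hp
    exact ⟨i, (hcore i).2.2.2.1.2 ⟨hi, h1, by omega⟩, by rw [(hcore i).2.2.1, h2]⟩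
  · intro i i' hi hi' h
    rw [(hcore i).2.2.1, (hcore i').2.2.1] at h
    refine hunique i i' ((hcore i).2.2.2.1.1 hi).1 ((hcore i').2.2.2.1.1 hi').1 ?_
    rw [hring i hi, hring i' hi', h]
  · intro i
    obtain ⟨a, b', ha, hb, h⟩ := exists_symm_gridPoint e (c i).pos
    exact ⟨a, b', by omega, ha, hb, by rw [(hcore i).2.2.2.2.1, h]⟩
  · intro i hi
    simp [(hcore i).2.2.2.2.2]

/-- While one half of the front stays, the sweepers of the other half find the node ahead. -/
theorem hit_sweepLook {e : GridSymm m} {r : ℕ} (hr : r < m) (hF : Front ident e r c)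
    (hback : ∀ i, (c i).mem.core.Sweeps → (c i).mem.core.back =
      if r = 0 then 0 else L.port (c i).pos (e (gridPoint m (r - 1) (c i).mem.core.idx)))
    {P : ℕ → Prop} (hP : ∀ a, P a → ¬ P (a + 1)) {i : Fin k} (hi : (c i).mem.core.Sweeps)
    (hPi : P (c i).mem.core.idx) {x : Fin (m + 1) × Fin (m + 1)}
    (hx : (squareGrid (m + 1)).Adj (c i).pos x) :
    Hit L (fun κ => κ.Sweeps ∧ P κ.idx) sweepLook c i (L.port (c i).pos x) ↔
      x = e (gridPoint m (r + 1) (c i).mem.core.idx) := by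
  have hle := hF.le i hi
  have hpos := hF.place i hi
  simp only [Hit, sweepLook, L.port_mem hx, L.follow_port hx, true_and, hback i hi]
  constructor
  · rintro ⟨h1, h2⟩
    obtain ⟨a, b, ha, hb, rfl⟩ := exists_symm_gridPoint e x
    have hadj := hx
    rw [hpos, symm_gridPoint_adj e (by omega) hle ha hb] at hadj
    -- A lateral neighbour carries the sweeper of an adjacent column, which stays at home during
    -- these probes; so the test fails there.
    have hside : b ≤ m → (P (c i).mem.core.idx → ¬ P b) → a = r → b ≠ (c i).mem.core.idx →
        False := by
      intro hb hPb hra hne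
      obtain ⟨j, hj, hjb⟩ := hF.full b hb
      refine h2 (c j).mem.core ⟨j, ?_, ?_, rfl⟩ hj
      · rintro rfl; exact hne hjb.symm
      · rw [visit, if_neg (fun h => hPb hPi (hjb ▸ h.2)), hF.place j hj, hjb, hra]
    rcases hadj with ⟨h | h, h'⟩ | ⟨h | h, h'⟩
    · rw [← h, h']
    -- The node behind exists only if `r ≠ 0`, and then `back` excludes it.
    · rw [if_neg (by omega)] at h1
      exact absurd (by rw [show r - 1 = a by omega, h']) h1
    · exact (hside hb (fun hp => h ▸ hP _ hp) h'.symm (by omega)).elim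
    · exact (hside hb (fun hp hp' => hP _ hp' (h ▸ hp)) h'.symm (by omega)).elim
  · rintro rfl
    constructor
    · split_ifs with h0
      · exact (Nat.pos_iff_ne_zero.1 (L.port_mem hx).1)
      · intro h
        have hadj : (squareGrid (m + 1)).Adj (c i).pos
            (e (gridPoint m (r - 1) (c i).mem.core.idx)) := by
          rw [hpos, symm_gridPoint_adj e (by omega) hle (by omega) hle]
          omega
        have := symm_gridPoint_inj e (by omega) hle (by omega) hle (L.port_inj hx hadj h)
        omega
    · rintro κ' ⟨j, hj, hv, rfl⟩ hs
      have hposj := hF.place j hs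
      have hlej := hF.le j hs
      rw [visit] at hv
      have hrow : (c j).pos ≠ e (gridPoint m (r + 1) (c i).mem.core.idx) := by
        rw [hposj]
        intro h
        have := symm_gridPoint_inj e (by omega) hlej (by omega) hle h
        omega
      split_ifs at hv with hA
      -- Any sweeper visiting the node ahead comes from row `r`, and that node has only one
      -- neighbour there.
      · have hadj : (squareGrid (m + 1)).Adj (c j).pos
            (e (gridPoint m (r + 1) (c i).mem.core.idx)) := by
          rw [← hv]
          exact L.adj_of_follow_ne (fun h => hrow (h.symm.trans hv))
        rw [hposj, symm_gridPoint_adj e (by omega) hlej (by omega) hle] at hadj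
        exact hj (hF.unique j i hs hi (by omega))
      · exact hrow hv

/-- Adjacent sweepers have indices of different parity. Probing in two waves, even and odd, keeps
the lateral neighbours of each probing sweeper occupied. Afterwards the other robots on the row copy
the selected port of the sweeper beside them. -/
theorem sweep_step {e : GridSymm m} {r : ℕ} (hr : r < m) (hF : Front ident e r c)
    (hE : FrontEntry L e r c) :
    Front ident e (r + 1) (perform L sweepMacro c) ∧
      FrontEntry L e (r + 1) (perform L sweepMacro c) := by
  rw [sweepMacro, perform_cons, perform_append, perform_append, perform_cons, perform_nil]
  have hb : ∀ i, (applyRule L (orientRule Core.Sweeps) c i).pos = (c i).pos ∧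
      (applyRule L (orientRule Core.Sweeps) c i).mem.core =
        if (c i).mem.core.Sweeps then { (c i).mem.core with back := (c i).entry.getD 0 }
        else (c i).mem.core := by
    intro i
    simp only [applyRule, orientRule]
    split_ifs <;> exact ⟨rfl, rfl⟩
  generalize applyRule L (orientRule Core.Sweeps) c = b at *
  have hbcore : ∀ i, (b i).mem.core.id = (c i).mem.core.id ∧
      (b i).mem.core.ht = (c i).mem.core.ht ∧ (b i).mem.core.idx = (c i).mem.core.idx ∧
      ((b i).mem.core.Sweeps ↔ (c i).mem.core.Sweeps) := by
    intro i
    rw [(hb i).2]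
    split_ifs <;> exact ⟨rfl, rfl, rfl, Iff.rfl⟩
  have hFb : Front ident e r b := by
    refine ⟨?_, ?_, ?_, ?_, ?_, ?_, ?_⟩
    · intro i; rw [(hbcore i).1, hF.id]
    · intro i; rw [(hbcore i).2.1, hF.ht]
    · intro i hi; rw [(hbcore i).2.2.1]; exact hF.le i ((hbcore i).2.2.2.1 hi)
    · intro i hi
      rw [(hbcore i).2.2.1, (hb i).1]
      exact hF.place i ((hbcore i).2.2.2.1 hi)
    · intro j hj
      obtain ⟨i, hi, h⟩ := hF.full j hj
      exact ⟨i, (hbcore i).2.2.2.2 hi, by rw [(hbcore i).2.2.1, h]⟩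
    · intro i i' hi hi' h
      rw [(hbcore i).2.2.1, (hbcore i').2.2.1] at h
      exact hF.unique i i' ((hbcore i).2.2.2.1 hi) ((hbcore i').2.2.2.1 hi') h
    · intro i; rw [(hb i).1]; exact hF.rows i
  have hback : ∀ i, (b i).mem.core.Sweeps → (b i).mem.core.back =
      if r = 0 then 0 else L.port (b i).pos (e (gridPoint m (r - 1) (b i).mem.core.idx)) := by
    intro i hi
    have hi' := (hbcore i).2.2.2.1 hi
    rw [(hb i).1, (hbcore i).2.2.1, (hb i).2, if_pos hi']
    exact hE i hi'
  clear hb hbcore hE hF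
  have hahead : ∀ i, (b i).mem.core.Sweeps → (squareGrid (m + 1)).Adj (b i).pos
      (e (gridPoint m (r + 1) (b i).mem.core.idx)) := by
    intro i hi
    have := hFb.le i hi
    rw [hFb.place i hi, symm_gridPoint_adj e (by omega) this (by omega) this]
    omega
  have hp1 := perform_probes L (A := fun κ => κ.Sweeps ∧ Even κ.idx) (Q := sweepLook) (c := b) 4
  have hc1 : ∀ i, (b i).mem.core.Sweeps → Even (b i).mem.core.idx →
      (perform L (probes (fun κ => κ.Sweeps ∧ Even κ.idx) sweepLook 4) b i).mem.cand =
        L.port (b i).pos (e (gridPoint m (r + 1) (b i).mem.core.idx)) := by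
    intro i hi hpar
    refine perform_probes_cand L ⟨hi, hpar⟩ (nodeDegree_le_four _) (hahead i hi) fun x hx => ?_
    exact hit_sweepLook L hr hFb hback (fun a h => by rw [Nat.even_add_one]; simpa using h)
      hi hpar hx
  generalize perform L (probes (fun κ => κ.Sweeps ∧ Even κ.idx) sweepLook 4) b = b1 at *
  have hFb1 : Front ident e r b1 := by
    refine ⟨?_, ?_, ?_, ?_, ?_, ?_, ?_⟩ <;> simp only [(hp1 _).1, (hp1 _).2.1]
    exacts [hFb.id, hFb.ht, hFb.le, hFb.place, hFb.full, hFb.unique, hFb.rows]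
  have hback1 : ∀ i, (b1 i).mem.core.Sweeps → (b1 i).mem.core.back =
      if r = 0 then 0 else L.port (b1 i).pos (e (gridPoint m (r - 1) (b1 i).mem.core.idx)) := by
    simpa only [(hp1 _).1, (hp1 _).2.1] using hback
  have hp2 := perform_probes L (A := fun κ => κ.Sweeps ∧ ¬ Even κ.idx) (Q := sweepLook)
    (c := b1) 4
  have hc2 : ∀ i, (b1 i).mem.core.Sweeps → ¬ Even (b1 i).mem.core.idx →
      (perform L (probes (fun κ => κ.Sweeps ∧ ¬ Even κ.idx) sweepLook 4) b1 i).mem.cand =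
        L.port (b1 i).pos (e (gridPoint m (r + 1) (b1 i).mem.core.idx)) := by
    intro i hi hpar
    refine perform_probes_cand L (A := fun κ => κ.Sweeps ∧ ¬ Even κ.idx) ⟨hi, hpar⟩
      (nodeDegree_le_four _) ?_ fun x hx => ?_
    · rw [(hp1 i).1, (hp1 i).2.1]
      rw [(hp1 i).2.1] at hi
      exact hahead i hi
    exact hit_sweepLook L hr hFb1 hback1 (P := fun a => ¬ Even a)
      (fun a h => by rw [Nat.even_add_one]; simpa using h) hi hpar hx
  generalize perform L (probes (fun κ => κ.Sweeps ∧ ¬ Even κ.idx) sweepLook 4) b1 = b2 at *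
  have hcore : ∀ i, (b2 i).mem.core = (b i).mem.core :=
    fun i => (hp2 i).2.1.trans (hp1 i).2.1
  have hpos : ∀ i, (b2 i).pos = (b i).pos := fun i => (hp2 i).1.trans (hp1 i).1
  have hcand : ∀ i, (b i).mem.core.Sweeps → (b2 i).mem.cand =
      L.port (b i).pos (e (gridPoint m (r + 1) (b i).mem.core.idx)) := by
    intro i hi
    by_cases hpar : Even (b i).mem.core.idx
    · rw [(hp2 i).2.2.1 (by rw [(hp1 i).2.1]; tauto)]
      exact hc1 i hi hpar
    · have := hc2 i (by rwa [(hp1 i).2.1]) (by rwa [(hp1 i).2.1])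
      rwa [(hp1 i).2.1, (hp1 i).1] at this
  clear hp1 hp2 hc1 hc2 hback1 hFb1
  have hsw : ∀ i, (b i).mem.core.Sweeps → applyRule L convoyRule b2 i =
      ⟨e (gridPoint m (r + 1) (b i).mem.core.idx), (b2 i).mem,
        some (L.port (e (gridPoint m (r + 1) (b i).mem.core.idx)) (b i).pos)⟩ := by
    intro i hi
    simp only [applyRule, convoyRule, hcore, hi, if_true, hcand i hi, hpos]
    exact L.relocate_port _ _ (hahead i hi)
  have hmem : ∀ i, (applyRule L convoyRule b2 i).mem = (b2 i).mem := fun i => by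
    rw [applyRule_mem]; rfl
  have hrows : ∀ i, ∃ a b', r + 1 ≤ a ∧ a ≤ m ∧ b' ≤ m ∧
      (applyRule L convoyRule b2 i).pos = e (gridPoint m a b') := by
    intro i
    by_cases hi : (b i).mem.core.Sweeps
    · exact ⟨r + 1, _, le_rfl, by omega, hFb.le i hi, by rw [hsw i hi]⟩
    · obtain ⟨a, b', h1, h2, h3, h4⟩ := hFb.rows i
      -- The front fills its row and nothing else, so company by a sweeper means being on row `r`.
      have hex : (∃ τ ∈ b2.others i, τ.core.Sweeps) ↔ a = r := by
        rw [Configuration.exists_mem_others]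
        simp only [hcore, hpos]
        constructor
        · rintro ⟨j, -, hp, hj⟩
          rw [hFb.place j hj, h4] at hp
          exact (symm_gridPoint_inj e (by omega) (hFb.le j hj) h2 h3 hp).1.symm
        · rintro rfl
          obtain ⟨j, hj, hjb⟩ := hFb.full b' h3
          exact ⟨j, by rintro rfl; exact hi hj, by rw [hFb.place j hj, hjb, h4], hj⟩
      by_cases har : a = r
      · subst har
        have h := hex.2 rfl
        obtain ⟨j, hji, hp, hj⟩ := Configuration.mem_others.1 h.choose_spec.1
        have hjs : (b j).mem.core.Sweeps := by
          rw [← hcore, hj]; exact h.choose_spec.2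
        rw [hpos, hpos] at hp
        have hidx : (b j).mem.core.idx = b' := by
          rw [hFb.place j hjs, h4] at hp
          exact (symm_gridPoint_inj e h2 (hFb.le j hjs) h2 h3 hp).2
        refine ⟨a + 1, b', le_rfl, by omega, h3, ?_⟩
        simp only [applyRule, convoyRule, hcore, hi, if_false, dif_pos h, ← hj, hcand j hjs,
          hpos, PortLabeling.relocate_some_pos]
        rw [← hp, L.follow_port (hahead j hjs), hidx]
      · refine ⟨a, b', by omega, h2, h3, ?_⟩
        have h := fun h => har (hex.1 h)
        simp only [applyRule, convoyRule, hcore, hi, if_false, dif_neg h, hpos,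
          PortLabeling.relocate_none, h4]
  generalize applyRule L convoyRule b2 = d at *
  refine ⟨⟨?_, ?_, ?_, ?_, ?_, ?_, hrows⟩, ?_⟩
  · intro i; rw [hmem, hcore]; exact hFb.id i
  · intro i; rw [hmem, hcore]; exact hFb.ht i
  · intro i; rw [hmem, hcore]; exact hFb.le i
  · intro i hi
    rw [hmem, hcore] at hi ⊢
    rw [hsw i hi]
  · simpa only [hmem, hcore] using hFb.full
  · simpa only [hmem, hcore] using hFb.unique
  · intro i hi
    rw [hmem, hcore] at hi ⊢
    rw [hsw i hi, if_neg (by omega), Nat.add_sub_cancel, hFb.place i hi]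
    rfl

/-- The sweep collects all robots on the last row. -/
theorem sweepPart_spec {e : GridSymm m} (hF : Front ident e 0 c) (hE : FrontEntry L e 0 c) :
    Front ident e m (perform L (sweepPart m) c) := by
  have key : ∀ n ≤ m, Front ident e n
      (perform L ((List.range n).flatMap fun _ => sweepMacro) c) ∧
      FrontEntry L e n (perform L ((List.range n).flatMap fun _ => sweepMacro) c) := by
    intro n
    induction n with
    | zero => exact fun _ => ⟨hF, hE⟩
    | succ n ih =>
      intro hn
      rw [perform_flatMap_range_succ]
      exact sweep_step L hn (ih (by omega)).1 (ih (by omega)).2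
  exact (key m le_rfl).1

end sweep

/-! ### The distribution of the robots -/

section distribution

variable {m k : ℕ} (L : PortLabeling (squareGrid (m + 1)))

/-- The sweepers occupy the last row, and every other robot is in the column `f i` of that row. -/
structure Lined (e : GridSymm m) (f : Fin k → ℕ)
    (c : Configuration (Fin (m + 1) × Fin (m + 1)) Mem k) : Prop where
  le : ∀ i, (c i).mem.core.Sweeps → (c i).mem.core.idx ≤ m
  place : ∀ i, (c i).mem.core.Sweeps → (c i).pos = e (gridPoint m m (c i).mem.core.idx)
  full : ∀ j ≤ m, ∃ i, (c i).mem.core.Sweeps ∧ (c i).mem.core.idx = j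
  unique : ∀ i i', (c i).mem.core.Sweeps → (c i').mem.core.Sweeps →
    (c i).mem.core.idx = (c i').mem.core.idx → i = i'
  col_le : ∀ i, ¬ (c i).mem.core.Sweeps → f i ≤ m
  col_place : ∀ i, ¬ (c i).mem.core.Sweeps → (c i).pos = e (gridPoint m m (f i))

variable {c : Configuration (Fin (m + 1) × Fin (m + 1)) Mem k} {e : GridSymm m} {f : Fin k → ℕ}

theorem Lined.of_core_eq {c' : Configuration (Fin (m + 1) × Fin (m + 1)) Mem k} {g : Fin k → ℕ}
    (hc : Lined e f c)
    (hcore : ∀ i, ((c' i).mem.core.Sweeps ↔ (c i).mem.core.Sweeps) ∧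
      (c' i).mem.core.idx = (c i).mem.core.idx)
    (hpos : ∀ i, (c i).mem.core.Sweeps → (c' i).pos = (c i).pos)
    (hg : ∀ i, ¬ (c i).mem.core.Sweeps → g i ≤ m ∧ (c' i).pos = e (gridPoint m m (g i))) :
    Lined e g c' := by
  refine ⟨?_, ?_, ?_, ?_, ?_, ?_⟩ <;> simp only [(hcore _).1, (hcore _).2]
  · exact hc.le
  · intro i hi; rw [hpos i hi, hc.place i hi]
  · exact hc.full
  · exact hc.unique
  · exact fun i hi => (hg i hi).1
  · exact fun i hi => (hg i hi).2

/-- Sweepers as signposts: the index of a sweeper met on a node is the column of that node. -/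
theorem Lined.exists_sweeper_iff (hc : Lined e f c) {i : Fin k} (hi : ¬ (c i).mem.core.Sweeps)
    {σ : Mem} : (σ ∈ c.others i ∧ σ.core.Sweeps) ↔
      ∃ j, (c j).mem.core.Sweeps ∧ (c j).mem.core.idx = f i ∧ (c j).mem = σ := by
  rw [Configuration.mem_others]
  constructor
  · rintro ⟨⟨j, -, hp, rfl⟩, hs⟩
    refine ⟨j, hs, ?_, rfl⟩
    rw [hc.place j hs, hc.col_place i hi] at hp
    exact (symm_gridPoint_inj e le_rfl (hc.le j hs) le_rfl (hc.col_le i hi) hp).2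
  · rintro ⟨j, hs, hj, rfl⟩
    exact ⟨⟨j, by rintro rfl; exact hi hs, by rw [hc.place j hs, hc.col_place i hi, hj], rfl⟩, hs⟩

theorem applyRule_locateRule (hc : Lined e f c) (i : Fin k) :
    (applyRule L locateRule c i).pos = (c i).pos ∧
    (applyRule L locateRule c i).mem = if (c i).mem.core.Sweeps then (c i).mem else
      { (c i).mem with core := { (c i).mem.core with col := f i + 1 }, cand := 0 } := by
  refine ⟨rfl, ?_⟩
  rw [applyRule_mem, locateRule]
  by_cases hi : (c i).mem.core.Sweeps
  · simp [hi]
  · have hex : ∃ τ ∈ c.others i, τ.core.Sweeps := by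
      obtain ⟨j, hj, hj'⟩ := hc.full (f i) (hc.col_le i hi)
      exact ⟨_, (hc.exists_sweeper_iff hi).2 ⟨j, hj, hj', rfl⟩⟩
    obtain ⟨j, hj, hj', hj''⟩ := (hc.exists_sweeper_iff hi).1 hex.choose_spec
    simp only [hi, if_false, dif_pos hex, ← hj'', hj']

/-- Common core of gathering and fanning out. Sweepers stay during the probes, so a neighbour passes
exactly if it is the node of a column `a` with `R`. By `hg` there is exactly one such column, and it
is adjacent, or there is none; in the latter case the robot stays because `locateRule` has reset
`cand`. -/
theorem shift_step {Q : ℕ → ℕ → Core → Set Core → Prop} {R : Core → ℕ → Prop}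
    (hQ : ∀ p d κ K, Q p d κ K ↔ ∃ κ' ∈ K, κ'.Sweeps ∧ R κ κ'.idx)
    (hc : Lined e f c) {g : Fin k → ℕ}
    (hg : ∀ i, ¬ (c i).mem.core.Sweeps →
      ((g i ≤ m ∧ (f i + 1 = g i ∨ g i + 1 = f i)) ∧
        ∀ a ≤ m, R { (c i).mem.core with col := f i + 1 } a ↔ a = g i) ∨
      (g i = f i ∧ ∀ a ≤ m, ¬ R { (c i).mem.core with col := f i + 1 } a)) :
    Lined e g (perform L (shiftMacro Q) c) ∧
    ∀ i, (perform L (shiftMacro Q) c i).mem.core = if (c i).mem.core.Sweeps then (c i).mem.core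
      else { (c i).mem.core with col := f i + 1 } := by
  rw [shiftMacro, perform_cons]
  have hb := applyRule_locateRule L hc
  generalize applyRule L locateRule c = b at *
  have hbcore : ∀ i, (b i).mem.core = if (c i).mem.core.Sweeps then (c i).mem.core
      else { (c i).mem.core with col := f i + 1 } := by
    intro i; rw [(hb i).2]; split_ifs <;> rfl
  have hsw : ∀ i, ((b i).mem.core.Sweeps ↔ (c i).mem.core.Sweeps) ∧
      (b i).mem.core.idx = (c i).mem.core.idx := by
    intro i; rw [hbcore]; split_ifs <;> exact ⟨Iff.rfl, rfl⟩
  have hLb : Lined e f b := hc.of_core_eq hsw (fun i _ => (hb i).1)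
    fun i hi => ⟨hc.col_le i hi, by rw [(hb i).1, hc.col_place i hi]⟩
  have hcore := fun i => perform_probes_advance_core L (A := Core.Joins) (Q := Q)
    (go := fun _ => True) (D := 4) (c := b) i
  refine ⟨hc.of_core_eq (fun i => by rw [hcore]; exact hsw i) (fun i hi => ?_) (fun i hi => ?_),
    fun i => by rw [hcore, hbcore]⟩
  · rw [perform_probes_advance_of_not L (by simp [Core.Joins, (hsw i).1, hi]), (hb i).1]
  · have hbi : (b i).mem.core = { (c i).mem.core with col := f i + 1 } := by
      rw [hbcore, if_neg hi]
    have hA : (b i).mem.core.Joins := by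
      refine ⟨by rwa [(hsw i).1], ?_⟩
      rw [hbi]; simp
    have hcand : (b i).mem.cand = 0 := by rw [(hb i).2, if_neg hi]
    have hposi : (b i).pos = e (gridPoint m m (f i)) := by rw [(hb i).1, hc.col_place i hi]
    have hfi := hc.col_le i hi
    have hhit : ∀ x, (squareGrid (m + 1)).Adj (b i).pos x →
        (Hit L Core.Joins Q b i (L.port (b i).pos x) ↔ ∃ a ≤ m, x = e (gridPoint m m a) ∧
          R { (c i).mem.core with col := f i + 1 } a) := by
      intro x hx
      simp only [Hit, hQ, L.port_mem hx, L.follow_port hx, true_and, hbi]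
      constructor
      · rintro ⟨κ', ⟨j, hj, hv, rfl⟩, hs, hR⟩
        refine ⟨(b j).mem.core.idx, hLb.le j hs, ?_, hR⟩
        rw [visit, if_neg (fun h => h.1 hs), hLb.place j hs] at hv
        exact hv.symm
      · rintro ⟨a, ha, rfl, hR⟩
        obtain ⟨j, hj, hja⟩ := hLb.full a ha
        refine ⟨_, ⟨j, by rintro rfl; exact hA.1 hj, ?_, rfl⟩, hj, by rwa [hja]⟩
        rw [visit, if_neg (fun h => h.1 hj), hLb.place j hj, hja]
    rcases hg i hi with ⟨⟨h1, h2⟩, h3⟩ | ⟨h1, h2⟩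
    · refine ⟨h1, (perform_probes_advance L (w := e (gridPoint m m (g i))) hA trivial
        (nodeDegree_le_four _) ?_ fun x hx => ?_).1⟩
      · rw [hposi, symm_gridPoint_adj e le_rfl hfi le_rfl h1]
        omega
      · rw [hhit x hx]
        constructor
        · rintro ⟨a, ha, rfl, hR⟩
          rw [(h3 a ha).1 hR]
        · rintro rfl
          exact ⟨g i, h1, rfl, (h3 _ h1).2 rfl⟩
    · refine ⟨by rw [h1]; exact hfi, ?_⟩
      rw [perform_probes_advance_none L hA hcand, hposi, h1]
      intro x hx
      rw [hhit x hx]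
      rintro ⟨a, ha, -, hR⟩
      exact h2 a ha hR

/-- Since `col` is one more than the current column, `idx + 2 = col` singles out the preceding
column. In column `0` nothing qualifies, in agreement with the truncated `f i - 1`. -/
theorem gather_step (hc : Lined e f c) :
    Lined e (fun i => f i - 1) (perform L (shiftMacro gatherLook) c) ∧
    ∀ i, (perform L (shiftMacro gatherLook) c i).mem.core =
      if (c i).mem.core.Sweeps then (c i).mem.core
      else { (c i).mem.core with col := f i + 1 } := by
  refine shift_step L (R := fun κ a => a + 2 = κ.col) (fun _ _ _ _ => Iff.rfl) hc fun i hi => ?_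
  have := hc.col_le i hi
  dsimp only
  rcases Nat.eq_zero_or_pos (f i) with h | h
  · right
    exact ⟨by omega, fun a _ => by omega⟩
  · left
    exact ⟨by omega, fun a _ => by omega⟩

/-- All robots but the sweepers gather in column `0`. -/
theorem gatherPart_spec (hc : Lined e f c) :
    Lined e (fun _ => 0) (perform L (gatherPart m) c) ∧
    ∀ i, ((perform L (gatherPart m) c i).mem.core.Sweeps ↔ (c i).mem.core.Sweeps) ∧
      (perform L (gatherPart m) c i).mem.core.id = (c i).mem.core.id ∧
      (perform L (gatherPart m) c i).mem.core.ht = (c i).mem.core.ht := by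
  have key : ∀ n, Lined e (fun i => f i - n)
      (perform L ((List.range n).flatMap fun _ => shiftMacro gatherLook) c) ∧
    ∀ i, ((perform L ((List.range n).flatMap fun _ => shiftMacro gatherLook) c i).mem.core.Sweeps ↔
      (c i).mem.core.Sweeps) ∧
      (perform L ((List.range n).flatMap fun _ => shiftMacro gatherLook) c i).mem.core.id =
        (c i).mem.core.id ∧
      (perform L ((List.range n).flatMap fun _ => shiftMacro gatherLook) c i).mem.core.ht =
        (c i).mem.core.ht := by
    intro n
    induction n with
    | zero => exact ⟨hc, fun i => ⟨Iff.rfl, rfl, rfl⟩⟩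
    | succ n ih =>
      rw [perform_flatMap_range_succ]
      obtain ⟨h1, h2⟩ := gather_step L ih.1
      refine ⟨h1, fun i => ?_⟩
      rw [h2, ← (ih.2 i).2.1, ← (ih.2 i).2.2, ← (ih.2 i).1]
      split_ifs <;> exact ⟨Iff.rfl, rfl, rfl⟩
  obtain ⟨h1, h2⟩ := key m
  refine ⟨h1.of_core_eq (fun _ => ⟨Iff.rfl, rfl⟩) (fun _ _ => rfl) fun i hi => ⟨by omega, ?_⟩, h2⟩
  have hle := hc.col_le i (fun h => hi ((h2 i).1.2 h))
  have := h1.col_place i hi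
  rwa [show f i - m = 0 by omega] at this

/-- The number of robots other than sweepers with smaller identifier. -/
noncomputable def rankOf (c : Configuration (Fin (m + 1) × Fin (m + 1)) Mem k) (i : Fin k) : ℕ :=
  (Finset.univ.filter fun j => ¬ (c j).mem.core.Sweeps ∧
    (c j).mem.core.id < (c i).mem.core.id).card

theorem applyRule_rankRule (hc : Lined e (fun _ => 0) c) (i : Fin k) :
    (applyRule L (rankRule (m + 1)) c i).pos = (c i).pos ∧
    (applyRule L (rankRule (m + 1)) c i).mem.core =
      if (c i).mem.core.Sweeps then (c i).mem.core else
        { (c i).mem.core with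
          tcol := rankOf c i % (m + 1), ht := rankOf c i / (m + 1) + 1 } := by
  refine ⟨rfl, ?_⟩
  rw [applyRule_mem, rankRule]
  by_cases hi : (c i).mem.core.Sweeps
  · simp [hi]
  · have hex : ∃ τ ∈ c.others i, τ.core.Sweeps := by
      obtain ⟨j, hj, hj'⟩ := hc.full 0 (by omega)
      exact ⟨_, (hc.exists_sweeper_iff hi).2 ⟨j, hj, hj', rfl⟩⟩
    -- All robots but the sweepers are on this node, so the local count is the global rank.
    have hcard : Multiset.card ((c.others i).filter fun τ => ¬ τ.core.Sweeps ∧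
        τ.core.id < (c i).mem.core.id) = rankOf c i := by
      simp only [Configuration.others, Multiset.filter_map, Multiset.card_map, rankOf,
        ← Finset.filter_val, Finset.card_val]
      refine congrArg Finset.card (Finset.ext fun j => ?_)
      simp only [Finset.mem_filter, Finset.mem_univ, true_and, Function.comp_apply]
      refine ⟨fun h => h.2, fun h => ⟨⟨?_, ?_⟩, h⟩⟩
      · rintro rfl; exact lt_irrefl _ h.2
      · rw [hc.col_place j h.1, hc.col_place i hi]
    simp only [hi, not_false_eq_true, true_and, hex, if_true, hcard, if_false]

/-- The minimum expresses that a robot advances one column per step until it arrives; there `col =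
tcol + 1`, and `fanLook` fails everywhere. -/
theorem fan_step {n : ℕ} (hc : Lined e (fun i => min n (c i).mem.core.tcol) c)
    (ht : ∀ i, ¬ (c i).mem.core.Sweeps → (c i).mem.core.tcol ≤ m) :
    Lined e (fun i => min (n + 1) (c i).mem.core.tcol) (perform L (shiftMacro fanLook) c) ∧
    ∀ i, (perform L (shiftMacro fanLook) c i).mem.core =
      if (c i).mem.core.Sweeps then (c i).mem.core
      else { (c i).mem.core with col := min n (c i).mem.core.tcol + 1 } := by
  refine shift_step L (R := fun κ a => κ.col ≠ κ.tcol + 1 ∧ a = κ.col) (fun _ _ κ K => ?_) hc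
    fun i hi => ?_
  · simp only [fanLook]
    constructor
    · rintro ⟨h, κ', h1, h2, h3⟩; exact ⟨κ', h1, h2, h, h3⟩
    · rintro ⟨κ', h1, h2, h, h3⟩; exact ⟨h, κ', h1, h2, h3⟩
  · have := ht i hi
    dsimp only
    rcases le_or_gt (c i).mem.core.tcol n with h | h
    · right
      exact ⟨by omega, fun a _ => by omega⟩
    · left
      exact ⟨by omega, fun a _ => by omega⟩

/-- All robots but the sweepers move to their final columns. -/
theorem fanPart_spec (hc : Lined e (fun _ => 0) c)
    (ht : ∀ i, ¬ (c i).mem.core.Sweeps → (c i).mem.core.tcol ≤ m) :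
    Lined e (fun i => (c i).mem.core.tcol) (perform L (fanPart m) c) ∧
    ∀ i, ((perform L (fanPart m) c i).mem.core.Sweeps ↔ (c i).mem.core.Sweeps) ∧
      (perform L (fanPart m) c i).mem.core.idx = (c i).mem.core.idx ∧
      (perform L (fanPart m) c i).mem.core.ht = (c i).mem.core.ht := by
  set b : ℕ → Configuration (Fin (m + 1) × Fin (m + 1)) Mem k := fun n =>
    perform L ((List.range n).flatMap fun _ => shiftMacro fanLook) c with hb
  have hsucc : ∀ n, b (n + 1) = perform L (shiftMacro fanLook) (b n) :=
    fun n => perform_flatMap_range_succ L _ n c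
  have key : ∀ n, Lined e (fun i => min n (c i).mem.core.tcol) (b n) ∧
      ∀ i, ((b n i).mem.core.Sweeps ↔ (c i).mem.core.Sweeps) ∧
        (b n i).mem.core.idx = (c i).mem.core.idx ∧
        (b n i).mem.core.ht = (c i).mem.core.ht ∧
        (b n i).mem.core.tcol = (c i).mem.core.tcol := by
    intro n
    induction n with
    | zero =>
      refine ⟨?_, fun i => ⟨Iff.rfl, rfl, rfl, rfl⟩⟩
      simp only [Nat.zero_min]
      exact hc
    | succ n ih =>
      obtain ⟨ih1, ih2⟩ := ih
      rw [hsucc]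
      obtain ⟨h1, h2⟩ := fan_step L (n := n) (c := b n) (e := e)
        (by simpa only [(ih2 _).2.2.2] using ih1)
        (by simpa only [(ih2 _).2.2.2, (ih2 _).1] using ht)
      simp only [(ih2 _).2.2.2] at h1
      refine ⟨h1, fun i => ?_⟩
      rw [h2, ← (ih2 i).2.1, ← (ih2 i).2.2.1, ← (ih2 i).2.2.2, ← (ih2 i).1]
      split_ifs <;> exact ⟨Iff.rfl, rfl, rfl, rfl⟩
  obtain ⟨h1, h2⟩ := key m
  refine ⟨h1.of_core_eq (fun _ => ⟨Iff.rfl, rfl⟩) (fun _ _ => rfl) fun i hi => ?_,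
    fun i => ⟨(h2 i).1, (h2 i).2.1, (h2 i).2.2.1⟩⟩
  have hi' : ¬ (c i).mem.core.Sweeps := fun h => hi ((h2 i).1.2 h)
  refine ⟨ht i hi', ?_⟩
  have := h1.col_place i hi
  rwa [min_eq_right (ht i hi')] at this

/-- The final places `(H i, C i)` form complete rows below any robot. -/
structure Stacked (m : ℕ) (H C : Fin k → ℕ) : Prop where
  ht_le : ∀ i, H i ≤ m
  col_le : ∀ i, C i ≤ m
  support : ∀ i, ∀ h < H i, ∀ b ≤ m, ∃ j, H j = h ∧ C j = b
  inj : ∀ i j, H i = H j → C i = C j → i = j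

/-- If `h < H i`, then `support` fills every place of height at most `h`, by robots that are
inactive now. They block the lateral neighbours and the one behind. Ahead there can only be visitors
of greater final height, which do not block. -/
theorem stack_step {H C : Fin k → ℕ} (hS : Stacked m H C) {h : ℕ}
    (hH : ∀ i, (c i).mem.core.ht = H i)
    (hpos : ∀ i, (c i).pos = e (gridPoint m (m - min h (H i)) (C i))) (i : Fin k) :
    (perform L (stackMacro h) c i).mem.core.ht = H i ∧
    (perform L (stackMacro h) c i).pos = e (gridPoint m (m - min (h + 1) (H i)) (C i)) := by
  rw [stackMacro, perform_cons]
  have hb : ∀ i, (applyRule L resetRule c i).pos = (c i).pos ∧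
    (applyRule L resetRule c i).mem.core = (c i).mem.core := fun i => ⟨rfl, rfl⟩
  generalize applyRule L resetRule c = b at *
  simp only [← (hb _).1] at hpos
  simp only [← (hb _).2] at hH
  clear hb
  refine ⟨by rw [perform_probes_advance_core]; exact hH i, ?_⟩
  have hCi := hS.col_le i
  have hHi := hS.ht_le i
  rcases le_or_gt (H i) h with hle | hlt
  · rw [perform_probes_advance_of_not L (by rw [hH]; omega), hpos,
      min_eq_right hle, min_eq_right (by omega)]
  · have hposi := hpos i
    rw [min_eq_left (by omega)] at hposi
    rw [min_eq_left (by omega)]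
    refine (perform_probes_advance L (w := e (gridPoint m (m - (h + 1)) (C i)))
      (by rw [hH]; exact hlt) trivial (nodeDegree_le_four _) ?_ fun x hx => ?_).1
    · rw [hposi, symm_gridPoint_adj e (by omega) hCi (by omega) hCi]
      omega
    · simp only [Hit, stackLook, L.port_mem hx, L.follow_port hx, true_and]
      constructor
      · intro hall
        obtain ⟨a, a', ha, ha', rfl⟩ := exists_symm_gridPoint e x
        rw [hposi, symm_gridPoint_adj e (by omega) hCi ha ha'] at hx
        -- Used with `h' = h - 1` for the row behind and with `h' = h` for the robot's own row.
        have hblock : ∀ h' ≤ h, a = m - h' → (a' ≠ C i ∨ h' ≠ H i) → False := by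
          intro h' hh' hah' hne
          obtain ⟨j, hj1, hj2⟩ := hS.support i h' (by omega) a' ha'
          have := hall (b j).mem.core ⟨j, by rintro rfl; omega, ?_, rfl⟩
          · rw [hH] at this; omega
          · rw [visit, if_neg (by rw [hH]; omega), hpos, hj1, hj2, min_eq_right hh', hah']
        rcases hx with ⟨h1 | h1, h2⟩ | ⟨h1, h2⟩
        · exact (hblock (h - 1) (by omega) (by omega) (by omega)).elim
        · rw [show m - (h + 1) = a by omega, h2]
        · exact (hblock h le_rfl (by omega) (by omega)).elim
      · rintro rfl κ' ⟨j, hj, hv, rfl⟩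
        rw [hH]
        by_contra hjh
        rw [visit, if_neg (by rw [hH]; exact hjh), hpos] at hv
        have := symm_gridPoint_inj e (by omega) (hS.col_le j) (by omega) hCi hv
        omega

/-- In the end all robots have reached their final places. -/
theorem stackPart_spec {H C : Fin k → ℕ} (hS : Stacked m H C)
    (hH : ∀ i, (c i).mem.core.ht = H i) (hpos : ∀ i, (c i).pos = e (gridPoint m m (C i)))
    (i j : Fin k) (hij : (perform L (stackPart m) c i).pos = (perform L (stackPart m) c j).pos) :
    i = j := by
  have key : ∀ n, ∀ i, (perform L ((List.range n).flatMap stackMacro) c i).mem.core.ht = H i ∧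
      (perform L ((List.range n).flatMap stackMacro) c i).pos =
        e (gridPoint m (m - min n (H i)) (C i)) := by
    intro n
    induction n with
    | zero => exact fun i => ⟨hH i, by simpa using hpos i⟩
    | succ n ih =>
      intro i
      rw [perform_flatMap_range_succ]
      exact stack_step L hS (fun i => (ih i).1) (fun i => (ih i).2) i
  rw [stackPart, (key m i).2, (key m j).2] at hij
  have h1 := hS.ht_le i
  have h2 := hS.ht_le j
  have := symm_gridPoint_inj e (by omega) (hS.col_le i) (by omega) (hS.col_le j) hij
  exact hS.inj i j (by omega) this.2

/-- The places derived from ranks. -/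
theorem stacked_of_rank {P : Fin k → Prop} {ident : Fin k → ℕ} (hident : Function.Injective ident)
    (hk : k ≤ (m + 1) ^ 2) {idx : Fin k → ℕ} (hle : ∀ i, P i → idx i ≤ m)
    (hfull : ∀ j ≤ m, ∃ i, P i ∧ idx i = j)
    (hunique : ∀ i i', P i → P i' → idx i = idx i' → i = i') {rk : Fin k → ℕ}
    (hrk : ∀ i, rk i = (Finset.univ.filter fun j => ¬ P j ∧ ident j < ident i).card)
    {H C : Fin k → ℕ} (hH : ∀ i, H i = if P i then 0 else rk i / (m + 1) + 1)
    (hC : ∀ i, C i = if P i then idx i else rk i % (m + 1)) : Stacked m H C := by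
  set N := (Finset.univ.filter fun j => ¬ P j).card with hN
  have hlt : ∀ i, ¬ P i → rk i < N := by
    intro i hi
    rw [hrk]
    refine Finset.card_lt_card ?_
    rw [Finset.ssubset_iff_of_subset (fun j hj => by simp at hj ⊢; exact hj.1)]
    exact ⟨i, by simpa using hi, by simp⟩
  have hinj : ∀ i j, ¬ P i → ¬ P j → rk i = rk j → i = j := by
    have aux : ∀ i j, ¬ P i → ident i < ident j → rk i < rk j := by
      intro i j hi hij
      rw [hrk, hrk]
      refine Finset.card_lt_card ?_
      rw [Finset.ssubset_iff_of_subset (fun l hl => by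
        simp only [Finset.mem_filter, Finset.mem_univ, true_and] at hl ⊢
        exact ⟨hl.1, hl.2.trans hij⟩)]
      exact ⟨i, by simpa using ⟨hi, hij⟩, by simp⟩
    intro i j hi hj h
    apply hident
    rcases lt_trichotomy (ident i) (ident j) with h' | h' | h'
    · have := aux i j hi h'; omega
    · exact h'
    · have := aux j i hj h'; omega
  -- `N` distinct ranks below `N` leave no gap. Hence the rows below any robot are complete.
  have hsurj : ∀ r < N, ∃ i, ¬ P i ∧ rk i = r := by
    have himg : (Finset.univ.filter fun j => ¬ P j).image rk = Finset.range N := by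
      refine Finset.eq_of_subset_of_card_le ?_ ?_
      · intro r hr
        obtain ⟨i, hi, rfl⟩ := Finset.mem_image.1 hr
        exact Finset.mem_range.2 (hlt i (by simpa using hi))
      · rw [Finset.card_range, Finset.card_image_of_injOn]
        intro i hi j hj h
        exact hinj i j (by simpa using hi) (by simpa using hj) h
    intro r hr
    obtain ⟨i, hi, h⟩ := Finset.mem_image.1 (himg ▸ Finset.mem_range.2 hr)
    exact ⟨i, by simpa using hi, h⟩
  -- The front takes `m + 1` of the at most `(m + 1) ^ 2` robots, so ranks divided by `m + 1` stay
  -- below `m`.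
  have hNle : N ≤ (m + 1) * m := by
    have h1 : m + 1 ≤ (Finset.univ.filter P).card := by
      choose g hg1 hg2 using fun j : Fin (m + 1) => hfull j (by omega)
      calc m + 1 = (Finset.univ : Finset (Fin (m + 1))).card := by simp
        _ ≤ _ := Finset.card_le_card_of_injOn g (fun j _ => by simpa using hg1 j) (by
          intro j _ j' _ h
          apply Fin.ext
          rw [← hg2 j, ← hg2 j', h])
    have h2 := Finset.card_filter_add_card_filter_not (s := (Finset.univ : Finset (Fin k))) P
    rw [Finset.card_univ, Fintype.card_fin] at h2
    have h3 : (m + 1) ^ 2 = (m + 1) * m + (m + 1) := by ring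
    omega
  have hhead : ∀ b ≤ m, ∃ j, H j = 0 ∧ C j = b := by
    intro b hb
    obtain ⟨j, hj, hjb⟩ := hfull b hb
    exact ⟨j, by rw [hH, if_pos hj], by rw [hC, if_pos hj, hjb]⟩
  refine ⟨fun i => ?_, fun i => ?_, fun i h hh b hb => ?_, fun i j h1 h2 => ?_⟩
  · rw [hH]
    split_ifs with hi
    · omega
    · have : rk i / (m + 1) < m :=
        Nat.div_lt_of_lt_mul ((hlt i hi).trans_le hNle)
      omega
  · rw [hC]
    split_ifs with hi
    · exact hle i hi
    · exact Nat.lt_succ_iff.1 (Nat.mod_lt _ (by omega))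
  · rcases h with _ | h
    · exact hhead b hb
    · rw [hH] at hh
      split_ifs at hh with hi
      · omega
      · have h1 : h < rk i / (m + 1) := by omega
        -- Height `h + 1` and column `b` belong to rank `b + (m + 1) * h`; being smaller than the
        -- rank of `i`, it is attained.
        have h2 : b + (m + 1) * h < rk i := by
          have h3 : (m + 1) * (h + 1) ≤ (m + 1) * (rk i / (m + 1)) := Nat.mul_le_mul_left _ h1
          have h4 := Nat.mul_div_le (rk i) (m + 1)
          rw [Nat.mul_add] at h3
          omega
        obtain ⟨j, hj, hjr⟩ := hsurj _ (h2.trans (hlt i hi))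
        refine ⟨j, ?_, ?_⟩
        · rw [hH, if_neg hj, hjr, Nat.add_mul_div_left _ _ (by omega),
            Nat.div_eq_of_lt (by omega), zero_add]
        · rw [hC, if_neg hj, hjr, Nat.add_mul_mod_self_left, Nat.mod_eq_of_lt (by omega)]
  · rw [hH, hH] at h1
    rw [hC, hC] at h2
    split_ifs at h1 h2 with hi hj hj
    · exact hunique i j hi hj h2
    · refine hinj i j hi hj ?_
      rw [← Nat.div_add_mod (rk i) (m + 1), ← Nat.div_add_mod (rk j) (m + 1), h2]
      congr 2
      omega

end distribution

/-! ### The final part of the algorithm -/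

section rules

/-- This and the following decompositions serve twice, with `P` being `RoundRule.Inert` and with `P`
being `RoundRule.Keeps`. -/
theorem forall_mem_probes {A : Core → Prop} {Q : ℕ → ℕ → Core → Set Core → Prop} {D : ℕ}
    {P : RoundRule Mem → Prop} (h1 : ∀ p, P (outRule A p))
    (h2 : ∀ p ≤ D, P (checkRule A Q p)) : ∀ f ∈ probes A Q D, P f := by
  intro f hf
  simp only [probes, List.mem_flatMap, List.mem_range, List.mem_cons, List.not_mem_nil,
    or_false] at hf
  obtain ⟨p, hp, rfl | rfl⟩ := hf
  · exact h1 _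
  · exact h2 _ hp

theorem forall_mem_ringMacro {f₀ : RoundRule Mem} {go : ℕ → Prop} {P : RoundRule Mem → Prop}
    (h0 : P f₀) (h1 : ∀ p, P (outRule Core.Walks p))
    (h2 : ∀ p ≤ 4, P (checkRule Core.Walks ringLook p)) (h3 : P (advanceRule Core.Walks go)) :
    ∀ f ∈ ringMacro f₀ go, P f := by
  simp only [ringMacro, List.forall_mem_cons, List.forall_mem_append, List.not_mem_nil,
    IsEmpty.forall_iff, implies_true, and_true]
  exact ⟨h0, forall_mem_probes h1 fun p hp => h2 p (by omega), h3⟩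

theorem forall_mem_sweepMacro {P : RoundRule Mem → Prop} (h0 : P (orientRule Core.Sweeps))
    (h1 : ∀ A : Core → Prop, (∀ κ, A κ → κ.Sweeps) → ∀ p, P (outRule A p))
    (h2 : ∀ A : Core → Prop, (∀ κ, A κ → κ.Sweeps) → ∀ p ≤ 4, P (checkRule A sweepLook p))
    (h3 : P convoyRule) : ∀ f ∈ sweepMacro, P f := by
  simp only [sweepMacro, List.forall_mem_cons, List.forall_mem_append, List.not_mem_nil,
    IsEmpty.forall_iff, implies_true, and_true]
  exact ⟨h0, forall_mem_probes (h1 _ fun _ h => h.1) (h2 _ fun _ h => h.1),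
    forall_mem_probes (h1 _ fun _ h => h.1) (h2 _ fun _ h => h.1), h3⟩

theorem forall_mem_shiftMacro {Q : ℕ → ℕ → Core → Set Core → Prop} {P : RoundRule Mem → Prop}
    (h0 : P locateRule) (h1 : ∀ p, P (outRule Core.Joins p))
    (h2 : ∀ p ≤ 4, P (checkRule Core.Joins Q p))
    (h3 : P (advanceRule Core.Joins fun _ => True)) : ∀ f ∈ shiftMacro Q, P f := by
  simp only [shiftMacro, List.forall_mem_cons, List.forall_mem_append, List.not_mem_nil,
    IsEmpty.forall_iff, implies_true, and_true]
  exact ⟨h0, forall_mem_probes h1 h2, h3⟩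

theorem forall_mem_stackMacro {h : ℕ} {P : RoundRule Mem → Prop}
    (h0 : P resetRule) (h1 : ∀ p, P (outRule (fun κ => h < κ.ht) p))
    (h2 : ∀ p ≤ 4, P (checkRule (fun κ => h < κ.ht) (stackLook h) p))
    (h3 : P (advanceRule (fun κ => h < κ.ht) fun _ => True)) : ∀ f ∈ stackMacro h, P f := by
  simp only [stackMacro, List.forall_mem_cons, List.forall_mem_append, List.not_mem_nil,
    IsEmpty.forall_iff, implies_true, and_true]
  exact ⟨h0, forall_mem_probes h1 h2, h3⟩

theorem forall_mem_flatMap_range {p : ℕ → List (RoundRule Mem)} {N : ℕ}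
    {P : RoundRule Mem → Prop} (h : ∀ n < N, ∀ f ∈ p n, P f) :
    ∀ f ∈ (List.range N).flatMap p, P f := by
  intro f hf
  obtain ⟨n, hn, hf⟩ := List.mem_flatMap.1 hf
  exact h n (List.mem_range.1 hn) f hf

/-- The cores on which a set of activities has no effect. -/
def Core.Idle (κ : Core) : Prop := κ.mode = .settled ∧ κ.best = 0 ∧ κ.ht = 0 ∧ κ.col = 0

/-- The rule neither moves robots nor changes their long-term memories, provided all robots are
idle. -/
def RoundRule.Inert (f : RoundRule Mem) : Prop :=
  ∀ d e σ o, σ.core.Idle → (∀ τ ∈ o, τ.core.Idle) → (f d e σ o).1.core = σ.core ∧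
    (f d e σ o).2 = none

theorem Core.Idle.not_walks {κ : Core} (h : κ.Idle) : ¬ κ.Walks := fun h' => h'.ne_settled h.1

theorem Core.Idle.not_sweeps {κ : Core} (h : κ.Idle) : ¬ κ.Sweeps := by
  intro h'
  rw [Core.Sweeps, h.1] at h'
  cases h'

theorem Core.Idle.not_joins {κ : Core} (h : κ.Idle) : ¬ κ.Joins := fun h' => h'.2 h.2.2.2

theorem inert_outRule {A : Core → Prop} (hA : ∀ κ, A κ → ¬ κ.Idle) (p : ℕ) :
    RoundRule.Inert (outRule A p) := by
  intro d e σ o hσ _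
  have h : ¬ A σ.core := fun h => hA _ h hσ
  simp [outRule, h]

theorem inert_checkRule {A : Core → Prop} {Q : ℕ → ℕ → Core → Set Core → Prop}
    (hA : ∀ κ, A κ → ¬ κ.Idle) (p : ℕ) : RoundRule.Inert (checkRule A Q p) := by
  intro d e σ o hσ _
  have h : ¬ A σ.core := fun h => hA _ h hσ
  simp [checkRule, h]

theorem inert_advanceRule {A : Core → Prop} {go : ℕ → Prop} (hA : ∀ κ, A κ → ¬ κ.Idle) :
    RoundRule.Inert (advanceRule A go) := by
  intro d e σ o hσ _
  have h : ¬ A σ.core := fun h => hA _ h hσ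
  simp [advanceRule, h]

theorem inert_orientRule {A : Core → Prop} (hA : ∀ κ, A κ → ¬ κ.Idle) :
    RoundRule.Inert (orientRule A) := by
  intro d e σ o hσ _
  have h : ¬ A σ.core := fun h => hA _ h hσ
  simp [orientRule, h]

/-- The robots cannot tell whether walkers remain, so the final part is executed also if the robots
are already dispersed. Without walkers no `best` is set, hence there are no sweepers, nobody learns
a column, and all heights stay `0`. -/
theorem finalPart_inert (m : ℕ) : ∀ f ∈ finalPart m, RoundRule.Inert f := by
  have hw : ∀ κ : Core, κ.Walks → ¬ κ.Idle := fun κ h h' => h'.not_walks h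
  have hs : ∀ κ : Core, κ.Sweeps → ¬ κ.Idle := fun κ h h' => h'.not_sweeps h
  have hj : ∀ κ : Core, κ.Joins → ¬ κ.Idle := fun κ h h' => h'.not_joins h
  have hh : ∀ h, ∀ κ : Core, h < κ.ht → ¬ κ.Idle := fun h κ h1 h' => by
    have := h'.2.2.1; omega
  have hloc : RoundRule.Inert locateRule := by
    intro d e σ o hσ ho
    have hno : ¬ ∃ τ ∈ o, τ.core.Sweeps := fun ⟨τ, h1, h2⟩ => (ho τ h1).not_sweeps h2
    simp only [locateRule, if_neg hσ.not_sweeps, dif_neg hno, and_true]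
    -- With no sweeper in sight `locateRule` writes `col := 0`, the value an idle robot already has.
    rw [← hσ.2.2.2]
  simp only [finalPart, List.forall_mem_cons, List.forall_mem_append]
  refine ⟨?_, ?_, ?_, ?_, ?_, ?_, ?_, ?_⟩
  · exact forall_mem_flatMap_range fun n _ => forall_mem_ringMacro (inert_orientRule hw)
      (inert_outRule hw) (fun p _ => inert_checkRule hw p) (inert_advanceRule hw)
  · refine forall_mem_flatMap_range fun n _ => forall_mem_ringMacro ?_
      (inert_outRule hw) (fun p _ => inert_checkRule hw p) (inert_advanceRule hw)
    intro d e σ o hσ ho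
    have hno : ¬ ∃ τ ∈ o, τ.core.Walks := fun ⟨τ, h1, h2⟩ => (ho τ h1).not_walks h2
    simp [noteRule, hσ.not_walks, hno]
  · intro d e σ o hσ _
    simp [enlistRule, hσ.2.1]
  · refine forall_mem_flatMap_range fun n _ => forall_mem_sweepMacro (inert_orientRule hs)
      (fun A hA p => inert_outRule (fun κ h => hs κ (hA κ h)) p)
      (fun A hA p _ => inert_checkRule (fun κ h => hs κ (hA κ h)) p) ?_
    intro d e σ o hσ ho
    have hno : ¬ ∃ τ ∈ o, τ.core.Sweeps := fun ⟨τ, h1, h2⟩ => (ho τ h1).not_sweeps h2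
    simp only [convoyRule, if_neg hσ.not_sweeps, dif_neg hno, and_self]
  · exact forall_mem_flatMap_range fun n _ => forall_mem_shiftMacro hloc
      (inert_outRule hj) (fun p _ => inert_checkRule hj p) (inert_advanceRule hj)
  · intro d e σ o hσ ho
    have hno : ¬ ∃ τ ∈ o, τ.core.Sweeps := fun ⟨τ, h1, h2⟩ => (ho τ h1).not_sweeps h2
    simp [rankRule, hno]
  · exact forall_mem_flatMap_range fun n _ => forall_mem_shiftMacro hloc
      (inert_outRule hj) (fun p _ => inert_checkRule hj p) (inert_advanceRule hj)
  · exact forall_mem_flatMap_range fun n _ => forall_mem_stackMacro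
      (fun d e σ o _ _ => ⟨rfl, rfl⟩)
      (inert_outRule (hh n)) (fun p _ => inert_checkRule (hh n) p) (inert_advanceRule (hh n))

/-- Idle robots keep their positions. -/
theorem perform_inert {V : Type} {G : SimpleGraph V} {k : ℕ} (L : PortLabeling G)
    {prog : List (RoundRule Mem)} (hprog : ∀ f ∈ prog, RoundRule.Inert f)
    {c : Configuration V Mem k} (hc : ∀ i, (c i).mem.core.Idle) (i : Fin k) :
    (perform L prog c i).pos = (c i).pos := by
  refine (perform_induction L (fun b => ∀ i, (b i).pos = (c i).pos ∧ (b i).mem.core.Idle)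
    (fun f hf b hb i => ?_) (fun i => ⟨rfl, hc i⟩) i).1
  have h := hprog f hf (nodeDegree G (b i).pos) (b i).entry (b i).mem (b.others i) (hb i).2
    (Configuration.forall_mem_others.2 fun j _ _ => (hb j).2)
  rw [applyRule_stay L h.2, h.1]
  exact hb i

end rules

/-! ### From the occupied boundary to dispersion. -/

section final

variable {m k : ℕ} (L : PortLabeling (squareGrid (m + 1)))
  {ident : Fin k → ℕ} {c : Configuration (Fin (m + 1) × Fin (m + 1)) Mem k}

theorem Front.lined {e : GridSymm m} (hF : Front ident e m c) : ∃ f, Lined e f c := by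
  choose a f h1 h2 h3 h4 using hF.rows
  refine ⟨f, hF.le, hF.place, hF.full, hF.unique, fun i _ => h3 i, fun i _ => ?_⟩
  rw [h4, le_antisymm (h2 i) (h1 i)]

/-- From the moment at which all robots are on the last row, the robots are dispersed. -/
theorem distribution_spec {e : GridSymm m} (hident : Function.Injective ident)
    (hk : k ≤ (m + 1) ^ 2) (hF : Front ident e m c) (i j : Fin k)
    (hij : (perform L (gatherPart m ++ (rankRule (m + 1) :: (fanPart m ++ stackPart m))) c i).pos =
      (perform L (gatherPart m ++ (rankRule (m + 1) :: (fanPart m ++ stackPart m))) c j).pos) :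
    i = j := by
  rw [perform_append, perform_cons, perform_append] at hij
  obtain ⟨f, hL⟩ := hF.lined
  obtain ⟨hG, hGc⟩ := gatherPart_spec L hL
  generalize perform L (gatherPart m) c = b at *
  have hR := applyRule_rankRule L hG
  generalize applyRule L (rankRule (m + 1)) b = r at *
  have hsw : ∀ i, ((r i).mem.core.Sweeps ↔ (b i).mem.core.Sweeps) ∧
      (r i).mem.core.idx = (b i).mem.core.idx := by
    intro i; rw [(hR i).2]; split_ifs <;> exact ⟨Iff.rfl, rfl⟩
  have hLr : Lined e (fun _ => 0) r := hG.of_core_eq hsw (fun i _ => (hR i).1)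
    fun i hi => ⟨Nat.zero_le _, by rw [(hR i).1, hG.col_place i hi]⟩
  obtain ⟨hFn, hFc⟩ := fanPart_spec L hLr (fun i hi => by
    rw [(hR i).2, if_neg (fun h => hi ((hsw i).1.2 h))]
    exact Nat.lt_succ_iff.1 (Nat.mod_lt _ (by omega)))
  generalize perform L (fanPart m) r = d at *
  have hS : Stacked m (fun i => (d i).mem.core.ht)
      (fun i => if (b i).mem.core.Sweeps then (b i).mem.core.idx else rankOf b i % (m + 1)) := by
    refine stacked_of_rank (P := fun i => (b i).mem.core.Sweeps) hident hk hG.le hG.full hG.unique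
      (rk := rankOf b) (fun i => ?_) (fun i => ?_) (fun i => rfl)
    · simp only [rankOf, (hGc _).2.1, hF.id]
    · rw [(hFc i).2.2, (hR i).2]
      split_ifs with h
      · rw [(hGc i).2.2, hF.ht]
      · rfl
  refine stackPart_spec L (e := e) hS (fun i => rfl) (fun i => ?_) i j hij
  have hdb : (d i).mem.core.Sweeps ↔ (b i).mem.core.Sweeps := (hFc i).1.trans (hsw i).1
  by_cases h : (b i).mem.core.Sweeps
  · rw [hFn.place i (hdb.2 h), (hFc i).2.1, (hsw i).2, if_pos h]
  · rw [hFn.col_place i (fun h' => h (hdb.1 h')), (hR i).2, if_neg h, if_neg h]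

/-- The final part of the algorithm disperses the robots. -/
theorem finalPart_spec (hm : 0 < m) (hident : Function.Injective ident) (hk : k ≤ (m + 1) ^ 2)
    (hc : Calm ident c)
    (hfull : (∃ i, (c i).mem.core.Walks) →
      ∀ x, OnBoundary x → ∃ j, (c j).mem.core.mode = .settled ∧ (c j).pos = x)
    (i j : Fin k)
    (hij : (perform L (finalPart m) c i).pos = (perform L (finalPart m) c j).pos) : i = j := by
  by_cases hex : ∃ i, (c i).mem.core.Walks
  · have hfull := hfull hex
    rw [finalPart, perform_append, perform_append, perform_cons, perform_append] at hij
    obtain ⟨h1, h2, h3, h4⟩ := cornerPart_spec L hm hc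
    generalize perform L (cornerPart m) c = c₁ at *
    have hex₁ : ∃ i, (c₁ i).mem.core.Walks := by
      obtain ⟨i, hi⟩ := hex
      exact ⟨i, by rw [Core.Walks, h2]; exact hi⟩
    obtain ⟨h5, h6, e, h7⟩ := tourPart_spec L hm hident h1 h4 hex₁
    generalize perform L (tourPart m) c₁ = c₂ at *
    have hset : ∀ i, (c₂ i).mem.core.mode = .settled → (c₁ i).mem.core.mode = .settled :=
      fun i hi => by rw [← (h5 i).1, hi]
    obtain ⟨h8, h9⟩ := enlist_spec L (ident := ident) (c := c₂) hm
      (fun i => by rw [(h5 i).2.1, h1.id])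
      (fun i => (h5 i).2.2)
      (fun i => by rw [Core.Walks, (h5 i).1]; exact h1.mode i)
      (fun i j hi hj hp => h1.unique i j (hset i hi) (hset j hj)
        (by rwa [h6 i (hset i hi), h6 j (hset j hj)] at hp))
      (fun x hx => by
        obtain ⟨j, hj, hjx⟩ := hfull x hx
        refine ⟨j, by rw [(h5 j).1, h2, hj], ?_⟩
        rw [h6 j (by rw [h2, hj]), h3 j hj, hjx])
      e (fun i hi => by
        rw [h6 i (hset i hi)]
        exact h7 i (hset i hi))
    exact distribution_spec L hident hk (sweepPart_spec L h8 h9) i j hij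
  -- If nobody walks, all robots are settled on distinct nodes, and the program only has to leave
  -- them alone.
  · have hset : ∀ i, (c i).mem.core.mode = .settled := fun i =>
      (hc.mode i).resolve_right fun h => hex ⟨i, h⟩
    have hidle : ∀ i, (c i).mem.core.Idle := fun i =>
      ⟨hset i, hc.best i, hc.ht i, hc.col i⟩
    rw [perform_inert L (finalPart_inert m) hidle, perform_inert L (finalPart_inert m) hidle] at hij
    exact hc.unique i j (hset i) (hset j) hij

end final

/-! ### Groups that move along straight lines -/

section turn

theorem turn_mem {d e i : ℕ} (hd : 0 < d) : turn d e i ∈ Set.Icc 1 d :=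
  ⟨by simp [turn], Nat.mod_lt _ hd⟩

theorem turn_ne {e i : ℕ} (he : e ∈ Set.Icc 1 4) (hi : i < 3) : turn 4 e i ≠ e := by
  obtain ⟨h1, h2⟩ := he
  unfold turn
  omega

theorem turn_inj {e i j : ℕ} (hi : i < 3) (hj : j < 3) (h : turn 4 e i = turn 4 e j) : i = j := by
  unfold turn at h
  omega

/-- Three turns cover all ports other than `e`, whatever the degree. If `d < 4`, some turn leads
back through `e` itself. -/
theorem exists_turn {d e p : ℕ} (hd : d ≤ 4) (he : e ∈ Set.Icc 1 d) (hp : p ∈ Set.Icc 1 d)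
    (hne : p ≠ e) : ∃ i < 3, turn d e i = p := by
  obtain ⟨h1, h2⟩ := he
  obtain ⟨h3, h4⟩ := hp
  unfold turn
  interval_cases d
  · omega
  · omega
  · rcases Nat.lt_or_ge e p with h | h
    · exact ⟨p - e - 1, by omega, by omega⟩
    · exact ⟨p + 2 - e - 1, by omega, by omega⟩
  · rcases Nat.lt_or_ge e p with h | h
    · exact ⟨p - e - 1, by omega, by omega⟩
    · exact ⟨p + 3 - e - 1, by omega, by omega⟩
  · rcases Nat.lt_or_ge e p with h | h
    · exact ⟨p - e - 1, by omega, by omega⟩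
    · exact ⟨p + 4 - e - 1, by omega, by omega⟩

variable {V : Type} {G : SimpleGraph V} (L : PortLabeling G)

/-- The excursion `(p, q)` leads scouts at `x` and the anchor at `a` to the same node. -/
def Meets (v a x : V) (pq : ℕ × ℕ) : Prop :=
  L.follow x (turn (nodeDegree G x) (L.port x v) pq.2) =
    L.follow a (turn (nodeDegree G a) (L.port a v) pq.1)

theorem nodeDegree_pos_of_adj (L : PortLabeling G) {u v : V} (h : G.Adj u v) : 0 < nodeDegree G u :=
  Nat.lt_of_lt_of_le Nat.zero_lt_one ((L.port_mem h).1.trans (L.port_mem h).2)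

/-- Nine excursions exhaust the pairs of onward ports. If `x` has degree less than 4, scouts may
return to `v`, but the turns at `a` avoid `v` because `a` has degree 4. So there is no spurious
meeting at `v`. -/
theorem exists_meets_iff {v a x : V} (hva : G.Adj v a) (hvx : G.Adj v x)
    (ha : nodeDegree G a = 4) (hx : nodeDegree G x ≤ 4) :
    (∃ pq ∈ List.range 3 ×ˢ List.range 3, Meets L v a x pq) ↔
      ∃ y, y ≠ v ∧ G.Adj a y ∧ G.Adj x y := by
  constructor
  · rintro ⟨⟨p, q⟩, hpq, h⟩
    have hpq' : p < 3 ∧ q < 3 := by simpa using List.mem_product.1 hpq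
    have h1 : turn (nodeDegree G a) (L.port a v) p ∈ Set.Icc 1 (nodeDegree G a) :=
      turn_mem (nodeDegree_pos_of_adj L hva.symm)
    have h2 : turn (nodeDegree G x) (L.port x v) q ∈ Set.Icc 1 (nodeDegree G x) :=
      turn_mem (nodeDegree_pos_of_adj L hvx.symm)
    refine ⟨_, fun he => ?_, L.adj_follow h1, h ▸ L.adj_follow h2⟩
    have h3 := L.port_follow h1
    rw [he, ha] at h3
    have h4 := L.port_mem hva.symm
    rw [ha] at h4
    exact turn_ne h4 hpq'.1 h3.symm
  · rintro ⟨y, hy, hay, hxy⟩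
    obtain ⟨p, hp, hp'⟩ := exists_turn ha.le (L.port_mem hva.symm) (L.port_mem hay)
      fun h => hy (L.port_inj hay hva.symm h)
    obtain ⟨q, hq, hq'⟩ := exists_turn hx (L.port_mem hvx.symm) (L.port_mem hxy)
      fun h => hy (L.port_inj hxy hvx.symm h)
    refine ⟨(p, q), List.mem_product.2 ⟨by simpa using hp, by simpa using hq⟩, ?_⟩
    rw [Meets, hp', hq', L.follow_port hay, L.follow_port hxy]

end turn

/-! ### Trials: how a group finds the straight continuation. -/

section groups

variable {V : Type} {G : SimpleGraph V} {k : ℕ} (L : PortLabeling G)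

/-- The group with a given tag. -/
def Core.InGroup (κ : Core) (g : ℕ) : Prop := κ.Grouped ∧ κ.tag = g

/-- The node examined by a robot while scouts are at `x` and the anchor is at `a`. -/
noncomputable def camp (κ : Core) (a x : V) : V := if κ.mode = .scout then x else a

/-- During a trial, the members of the group `g` are at their camps. -/
structure Camped (κ : Fin k → Core) (g : ℕ) (v a x : V) (γ : Fin k → ℕ) (μ : Bool)
    (b : Configuration V Mem k) : Prop where
  core : ∀ i, (b i).mem.core = κ i
  pos : ∀ i, (κ i).InGroup g → (b i).pos = camp (κ i) a x
  ret : ∀ i, (κ i).InGroup g → (b i).mem.ret = L.port (camp (κ i) a x) v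
  met : ∀ i, (κ i).InGroup g → (b i).mem.met = μ
  cand : ∀ i, (κ i).InGroup g → (b i).mem.cand = γ i

variable {κ : Fin k → Core} {g : ℕ} {v a x : V} {γ : Fin k → ℕ} {μ : Bool}
  {b : Configuration V Mem k}

theorem adj_camp (hva : G.Adj v a) (hvx : G.Adj v x) (κ : Core) : G.Adj (camp κ a x) v := by
  unfold camp
  split_ifs
  exacts [hvx.symm, hva.symm]

/-- Every member has a partner of the other kind, so all members record the same answer and the
group cannot split. Tags keep other groups on the same nodes from interfering. -/
theorem excursion_spec (hva : G.Adj v a) (hvx : G.Adj v x)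
    (hpartner : ∀ i, (κ i).InGroup g → ∃ j, (κ j).InGroup g ∧ (κ j).mode ≠ (κ i).mode)
    (pq : ℕ × ℕ) (hb : Camped L κ g v a x γ μ b) :
    Camped L κ g v a x γ (μ || decide (Meets L v a x pq))
      (perform L [spreadRule pq.1 pq.2, meetRule] b) := by
  simp only [perform_cons, perform_nil]
  set spot : Core → V := fun κ => L.follow (camp κ a x) (turn (nodeDegree G (camp κ a x))
    (L.port (camp κ a x) v) (if κ.mode = .scout then pq.2 else pq.1)) with hspot
  have hcore₁ : ∀ i, (applyRule L (spreadRule pq.1 pq.2) b i).mem.core = κ i := by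
    intro i; rw [applyRule_mem]; exact hb.core i
  have hport : ∀ i, turn (nodeDegree G (camp (κ i) a x)) (L.port (camp (κ i) a x) v)
      (if (κ i).mode = .scout then pq.2 else pq.1) ∈
        Set.Icc 1 (nodeDegree G (camp (κ i) a x)) :=
    fun i => turn_mem (nodeDegree_pos_of_adj L (adj_camp hva hvx _))
  have h₁ : ∀ i, (κ i).InGroup g → applyRule L (spreadRule pq.1 pq.2) b i =
      ⟨spot (κ i), (b i).mem, some (L.port (spot (κ i)) (camp (κ i) a x))⟩ := by
    intro i hi
    simp only [applyRule, spreadRule, hb.core, hi.1, if_true, hb.pos i hi, hb.ret i hi]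
    exact L.relocate_some _ _ (hport i)
  generalize applyRule L (spreadRule pq.1 pq.2) b = b₁ at *
  have hmeet : ∀ i, (κ i).InGroup g → ((∃ τ ∈ b₁.others i, τ.core.Grouped ∧
      τ.core.tag = (κ i).tag ∧ τ.core.mode ≠ (κ i).mode) ↔ Meets L v a x pq) := by
    intro i hi
    rw [Configuration.exists_mem_others]
    simp only [hcore₁]
    have hmode : ∀ j, (κ j).InGroup g → (κ j).mode ≠ (κ i).mode →
        (spot (κ j) = spot (κ i) ↔ Meets L v a x pq) := by
      intro j hj hne
      rcases hi.1 with h | h <;> rcases hj.1 with h' | h' <;>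
        simp only [hspot, camp, h, h', if_true, Meets, reduceCtorEq, if_false, ne_eq,
          not_true_eq_false] at hne ⊢
      exact eq_comm
    constructor
    · rintro ⟨j, -, hp, hj1, hj2, hj3⟩
      have hj : (κ j).InGroup g := ⟨hj1, hj2.trans hi.2⟩
      rw [h₁ i hi, h₁ j hj] at hp
      exact (hmode j hj hj3).1 hp
    · intro h
      obtain ⟨j, hj, hne⟩ := hpartner i hi
      refine ⟨j, by rintro rfl; exact hne rfl, ?_, hj.1, hj.2.trans hi.2.symm, hne⟩
      rw [h₁ i hi, h₁ j hj]
      exact (hmode j hj hne).2 h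
  have h₂ : ∀ i, (κ i).InGroup g → applyRule L meetRule b₁ i =
      ⟨camp (κ i) a x, { (b i).mem with met := μ || decide (Meets L v a x pq) },
        some (L.port (camp (κ i) a x) (spot (κ i)))⟩ := by
    intro i hi
    have hm := hmeet i hi
    rw [applyRule, meetRule]
    simp only [h₁ i hi, hb.core, hi.1, if_true, hm, hb.met i hi]
    exact L.relocate_port _ _ (L.adj_follow (hport i)).symm
  refine ⟨fun i => ?_, fun i hi => ?_, fun i hi => ?_, fun i hi => ?_, fun i hi => ?_⟩
  · rw [applyRule_mem, meetRule, ← hcore₁]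
    split_ifs <;> rfl
  · rw [h₂ i hi]
  · rw [h₂ i hi]; exact hb.ret i hi
  · rw [h₂ i hi]
  · rw [h₂ i hi]; exact hb.cand i hi

theorem excursions_spec (hva : G.Adj v a) (hvx : G.Adj v x)
    (hpartner : ∀ i, (κ i).InGroup g → ∃ j, (κ j).InGroup g ∧ (κ j).mode ≠ (κ i).mode)
    (l : List (ℕ × ℕ)) (hb : Camped L κ g v a x γ μ b) :
    Camped L κ g v a x γ (μ || decide (∃ pq ∈ l, Meets L v a x pq))
      (perform L (excursions l) b) := by
  induction l generalizing μ b with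
  | nil => simpa [excursions] using hb
  | cons pq l ih =>
    rw [excursions, List.flatMap_cons, perform_append, ← excursions]
    have := ih (excursion_spec L hva hvx hpartner pq hb)
    simpa only [List.mem_cons, exists_eq_or_imp, Bool.decide_or, Bool.or_assoc] using this

/-- The members of the group `g` are at the node `v`, having come from `a`. -/
structure Assembled (κ : Fin k → Core) (g : ℕ) (v : V) (γ : ℕ)
    (b : Configuration V Mem k) : Prop where
  core : ∀ i, (b i).mem.core = κ i
  pos : ∀ i, (κ i).InGroup g → (b i).pos = v
  cand : ∀ i, (κ i).InGroup g → (b i).mem.cand = γ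

/-- The absence of meetings is what selects a port, so the candidate `γ` from an earlier trial
survives every trial with a meeting. -/
theorem trial_spec {γ : ℕ} (hva : G.Adj v a) (hv : nodeDegree G v = 4)
    (hpartner : ∀ i, (κ i).InGroup g → ∃ j, (κ j).InGroup g ∧ (κ j).mode ≠ (κ i).mode)
    (hback : ∀ i, (κ i).InGroup g → (κ i).back = L.port v a)
    (hb : Assembled κ g v γ b) (q : ℕ) :
    Assembled κ g v (if ∃ pq ∈ List.range 3 ×ˢ List.range 3,
      Meets L v a (L.follow v (turn 4 (L.port v a) q)) pq then γ
      else turn 4 (L.port v a) q) (perform L (trial q) b) := by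
  set x := L.follow v (turn 4 (L.port v a) q) with hx
  have hq : turn 4 (L.port v a) q ∈ Set.Icc 1 (nodeDegree G v) := by
    rw [hv]; exact turn_mem (by omega)
  have hvx : G.Adj v x := L.adj_follow hq
  rw [trial, perform_cons, perform_cons, perform_append, perform_cons, perform_nil]
  have hcore₁ : ∀ i, (applyRule L (departRule q) b i).mem.core = κ i := by
    intro i; rw [applyRule_mem, ← hb.core, departRule]; split_ifs <;> rfl
  have h₁ : ∀ i, (κ i).InGroup g → applyRule L (departRule q) b i =
      ⟨camp (κ i) a x, { (b i).mem with met := false },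
        some (L.port (camp (κ i) a x) v)⟩ := by
    intro i hi
    simp only [applyRule, departRule, hb.core, hi.1, if_true, hb.pos i hi, hback i hi]
    by_cases h : (κ i).mode = .scout
    · simp only [h, if_true, camp]
      exact L.relocate_some _ _ hq
    · simp only [h, if_false, camp]
      exact L.relocate_port _ _ hva
  generalize applyRule L (departRule q) b = b₁ at *
  have hcamp : Camped L κ g v a x (fun _ => γ) false (applyRule L recordRule b₁) := by
    have h₂ : ∀ i, (κ i).InGroup g → applyRule L recordRule b₁ i =
        ⟨camp (κ i) a x, { (b i).mem with met := false, ret := L.port (camp (κ i) a x) v },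
          none⟩ := by
      intro i hi
      simp only [applyRule, recordRule, h₁ i hi, hb.core, hi.1, if_true, Option.getD_some]
      rfl
    refine ⟨fun i => ?_, fun i hi => ?_, fun i hi => ?_, fun i hi => ?_, fun i hi => ?_⟩
    · rw [applyRule_mem, recordRule, ← hcore₁]
      split_ifs <;> rfl
    · rw [h₂ i hi]
    · rw [h₂ i hi]
    · rw [h₂ i hi]
    · rw [h₂ i hi]; exact hb.cand i hi
  have hexc := excursions_spec L hva hvx hpartner (List.range 3 ×ˢ List.range 3) hcamp
  rw [Bool.false_or] at hexc
  generalize perform L (excursions (List.range 3 ×ˢ List.range 3))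
    (applyRule L recordRule b₁) = b₂ at *
  have h₃ : ∀ i, (κ i).InGroup g → (applyRule L (rejoinRule q) b₂ i).pos = v ∧
      (applyRule L (rejoinRule q) b₂ i).mem.cand = if ∃ pq ∈ List.range 3 ×ˢ List.range 3,
        Meets L v a x pq then γ else turn 4 (L.port v a) q := by
    intro i hi
    simp only [applyRule, rejoinRule, hexc.core, hi.1, if_true, hexc.pos i hi, hexc.ret i hi,
      hexc.met i hi, hexc.cand i hi, hback i hi, decide_eq_true_eq, PortLabeling.relocate_mem,
      and_true]
    rw [L.relocate_port _ _ (adj_camp hva hvx _)]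
  refine ⟨fun i => ?_, fun i hi => (h₃ i hi).1, fun i hi => (h₃ i hi).2⟩
  rw [applyRule_mem, rejoinRule, ← hexc.core]
  split_ifs <;> rfl

/-- The group proceeds to the only neighbour that has no further common neighbour with `a`. -/
theorem trials_spec (hdeg : ∀ u, nodeDegree G u ≤ 4) {w : V} (hva : G.Adj v a) (hvw : G.Adj v w)
    (hwa : w ≠ a) (hv : nodeDegree G v = 4) (ha : nodeDegree G a = 4)
    (hw : ∀ x, G.Adj v x → x ≠ a → ((∃ y, y ≠ v ∧ G.Adj a y ∧ G.Adj x y) ↔ x ≠ w))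
    (hpartner : ∀ i, (κ i).InGroup g → ∃ j, (κ j).InGroup g ∧ (κ j).mode ≠ (κ i).mode)
    (hback : ∀ i, (κ i).InGroup g → (κ i).back = L.port v a)
    (hb : Assembled κ g v 0 b) :
    Assembled κ g v (L.port v w) (perform L ((List.range 3).flatMap trial) b) := by
  have hp := L.port_mem hva
  rw [hv] at hp
  obtain ⟨q₀, hq₀, hq₀'⟩ := exists_turn le_rfl hp (by rw [← hv]; exact L.port_mem hvw)
    fun h => hwa (L.port_inj hvw hva h)
  -- Every trial leads to a meeting except `q₀`, whose turn points to `w`.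
  have hC : ∀ q < 3, (∃ pq ∈ List.range 3 ×ˢ List.range 3,
      Meets L v a (L.follow v (turn 4 (L.port v a) q)) pq) ↔ q ≠ q₀ := by
    intro q hq
    have hq' : turn 4 (L.port v a) q ∈ Set.Icc 1 (nodeDegree G v) := by
      rw [hv]; exact turn_mem (by omega)
    rw [exists_meets_iff L hva (L.adj_follow hq') ha (hdeg _), hw _ (L.adj_follow hq')]
    · rw [not_iff_not]
      constructor
      · intro h
        apply turn_inj hq hq₀ (e := L.port v a)
        rw [hq₀', ← h, L.port_follow hq']
      · rintro rfl
        rw [hq₀', L.follow_port hvw]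
    · intro h
      have h' := L.port_follow hq'
      rw [h] at h'
      exact turn_ne hp hq h'.symm
  have key : ∀ n ≤ 3, Assembled κ g v (if q₀ < n then L.port v w else 0)
      (perform L ((List.range n).flatMap trial) b) := by
    intro n
    induction n with
    | zero => intro _; simpa using hb
    | succ n ih =>
      intro hn
      rw [perform_flatMap_range_succ]
      have := trial_spec L hva hv hpartner hback (ih (by omega)) n
      simp only [hC n (by omega)] at this
      convert this using 1
      by_cases h : n = q₀
      · subst h
        simp [hq₀']
      · simp only [ne_eq, h, not_false_eq_true, if_true]
        congr 1
        apply propext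
        omega
  have := key 3 le_rfl
  rwa [if_pos hq₀] at this

theorem forall_mem_excursions {P : RoundRule Mem → Prop} (h1 : ∀ i j, P (spreadRule i j))
    (h2 : P meetRule) (l : List (ℕ × ℕ)) : ∀ f ∈ excursions l, P f := by
  intro f hf
  simp only [excursions, List.mem_flatMap, List.mem_cons, List.not_mem_nil, or_false] at hf
  obtain ⟨pq, -, rfl | rfl⟩ := hf
  exacts [h1 _ _, h2]

theorem forall_mem_trials {P : RoundRule Mem → Prop} (h1 : ∀ q, P (departRule q))
    (h2 : P recordRule) (h3 : ∀ i j, P (spreadRule i j)) (h4 : P meetRule)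
    (h5 : ∀ q, P (rejoinRule q)) : ∀ f ∈ (List.range 3).flatMap trial, P f := by
  refine forall_mem_flatMap_range fun q _ => ?_
  simp only [trial, List.forall_mem_cons, List.forall_mem_append, List.not_mem_nil,
    IsEmpty.forall_iff, implies_true, and_true]
  exact ⟨h1 q, h2, forall_mem_excursions h3 h4 _, h5 q⟩

/-- Robots outside of groups ignore the trials. -/
theorem perform_trials_of_not (b : Configuration V Mem k) (i : Fin k) :
    (perform L ((List.range 3).flatMap trial) b i).mem.core = (b i).mem.core ∧
    (¬ (b i).mem.core.Grouped →
      (perform L ((List.range 3).flatMap trial) b i).pos = (b i).pos) := by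
  have hall : ∀ f ∈ (List.range 3).flatMap trial, ∀ d e σ o, (f d e σ o).1.core = σ.core ∧
      (¬ σ.core.Grouped → (f d e σ o).2 = none) := by
    refine forall_mem_trials (fun q d e σ o => ?_) (fun d e σ o => ?_) (fun i j d e σ o => ?_)
      (fun d e σ o => ?_) (fun q d e σ o => ?_)
    · rw [departRule]; split_ifs with h <;> simp [h]
    · rw [recordRule]; split_ifs with h <;> simp
    · rw [spreadRule]; split_ifs with h <;> simp [h]
    · rw [meetRule]; split_ifs with h <;> simp [h]
    · rw [rejoinRule]; split_ifs with h <;> simp [h]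
  refine perform_induction L (fun b' => (b' i).mem.core = (b i).mem.core ∧
    (¬ (b i).mem.core.Grouped → (b' i).pos = (b i).pos)) (fun f hf b' hb' => ?_)
    ⟨rfl, fun _ => rfl⟩
  have h := hall f hf (nodeDegree G (b' i).pos) (b' i).entry (b' i).mem (b'.others i)
  refine ⟨by rw [applyRule_mem, h.1, hb'.1], fun hg => ?_⟩
  rw [applyRule_stay L (h.2 (by rwa [hb'.1]))]
  exact hb'.2 hg

end groups

/-! ### The way to the boundary -/

section outward

variable {m k : ℕ} (L : PortLabeling (squareGrid (m + 1)))

/-- A step from `a` to `v`, after `n` steps in the same direction from an inner node. -/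
def Heading (n : ℕ) (a v : Fin (m + 1) × Fin (m + 1)) : Prop :=
  ((a.1 : ℕ) + 1 = v.1 ∧ n + 1 ≤ (a.1 : ℕ) ∧ (a.2 : ℕ) = v.2) ∨
  ((v.1 : ℕ) + 1 = a.1 ∧ (a.1 : ℕ) + n + 1 ≤ m ∧ (a.2 : ℕ) = v.2) ∨
  ((a.2 : ℕ) + 1 = v.2 ∧ n + 1 ≤ (a.2 : ℕ) ∧ (a.1 : ℕ) = v.1) ∨
  ((v.2 : ℕ) + 1 = a.2 ∧ (a.2 : ℕ) + n + 1 ≤ m ∧ (a.1 : ℕ) = v.1)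

theorem Heading.adj {n : ℕ} {a v : Fin (m + 1) × Fin (m + 1)} (h : Heading n a v) :
    (squareGrid (m + 1)).Adj a v := by
  rw [squareGrid_adj]
  unfold Heading at h
  omega

theorem heading_zero {a v : Fin (m + 1) × Fin (m + 1)} (h : (squareGrid (m + 1)).Adj a v)
    (ha : ¬ OnBoundary a) : Heading 0 a v := by
  rw [squareGrid_adj] at h
  unfold OnBoundary at ha
  unfold Heading
  omega

/-- `Heading n` places `a` more than `n` rows or columns away from the side behind it. This bounds
the length of the march. -/
theorem not_heading {a v : Fin (m + 1) × Fin (m + 1)} : ¬ Heading (m + 1) a v := by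
  unfold Heading
  omega

/-- If `x ≠ a`, the witness is the fourth corner of the unit square on `a`, `v`, `x`. If `x = a`, it
is the node behind `a`, which exists by `Heading`. -/
theorem exists_common_neighbor {n : ℕ} {a v w x : Fin (m + 1) × Fin (m + 1)}
    (h : Heading n a v) (hx : (squareGrid (m + 1)).Adj v x)
    (hw1 : (w.1 : ℕ) = 2 * v.1 - a.1) (hw2 : (w.2 : ℕ) = 2 * v.2 - a.2) (hxw : x ≠ w) :
    ∃ y, y ≠ v ∧ (squareGrid (m + 1)).Adj a y ∧ (squareGrid (m + 1)).Adj x y := by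
  rw [squareGrid_adj] at hx
  rw [Ne, grid_eq_iff] at hxw
  unfold Heading at h
  have hy1 : ((gridPoint m (a.1 + x.1 - v.1) (a.2 + x.2 - v.2)).1 : ℕ) = a.1 + x.1 - v.1 := by
    simp only [gridPoint_fst]
    rcases h with h | h | h | h <;> rcases hx with ⟨hx | hx, hx'⟩ | ⟨hx | hx, hx'⟩ <;> omega
  have hy2 : ((gridPoint m (a.1 + x.1 - v.1) (a.2 + x.2 - v.2)).2 : ℕ) = a.2 + x.2 - v.2 := by
    simp only [gridPoint_snd]
    rcases h with h | h | h | h <;> rcases hx with ⟨hx | hx, hx'⟩ | ⟨hx | hx, hx'⟩ <;> omega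
  generalize gridPoint m (a.1 + x.1 - v.1) (a.2 + x.2 - v.2) = y at *
  refine ⟨y, ?_, ?_, ?_⟩
  · rw [Ne, grid_eq_iff]
    rcases h with h | h | h | h <;> rcases hx with ⟨hx | hx, hx'⟩ | ⟨hx | hx, hx'⟩ <;> omega
  · rw [squareGrid_adj]
    rcases h with h | h | h | h <;> rcases hx with ⟨hx | hx, hx'⟩ | ⟨hx | hx, hx'⟩ <;> omega
  · rw [squareGrid_adj]
    rcases h with h | h | h | h <;> rcases hx with ⟨hx | hx, hx'⟩ | ⟨hx | hx, hx'⟩ <;> omega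

/-- At an inner node, the straight continuation is characterized by common neighbours. -/
theorem Heading.exists_opposite {n : ℕ} {a v : Fin (m + 1) × Fin (m + 1)} (h : Heading n a v)
    (hv : ¬ OnBoundary v) : ∃ w, Heading (n + 1) v w ∧ w ≠ a ∧
      ∀ x, (squareGrid (m + 1)).Adj v x → x ≠ a →
        ((∃ y, y ≠ v ∧ (squareGrid (m + 1)).Adj a y ∧ (squareGrid (m + 1)).Adj x y) ↔
          x ≠ w) := by
  unfold OnBoundary at hv
  have hw1 : ((gridPoint m (2 * v.1 - a.1) (2 * v.2 - a.2)).1 : ℕ) = 2 * v.1 - a.1 := by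
    simp only [gridPoint_fst]; unfold Heading at h; omega
  have hw2 : ((gridPoint m (2 * v.1 - a.1) (2 * v.2 - a.2)).2 : ℕ) = 2 * v.2 - a.2 := by
    simp only [gridPoint_snd]; unfold Heading at h; omega
  generalize gridPoint m (2 * v.1 - a.1) (2 * v.2 - a.2) = w at *
  refine ⟨w, ?_, ?_, fun x hx _ => ⟨?_, fun hxw => ?_⟩⟩
  · unfold Heading at h ⊢
    omega
  · rintro rfl
    unfold Heading at h
    omega
  -- Two nodes at distance two on a line have only the midpoint `v` as common neighbour.
  · rintro ⟨y, hy, h1, h2⟩ rfl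
    rw [squareGrid_adj] at h1 h2
    unfold Heading at h
    apply hy
    rw [grid_eq_iff]
    rcases h with h | h | h | h <;> omega
  · exact exists_common_neighbor h hx hw1 hw2 hxw

/-- The situation after `n` steps of the groups. -/
structure Marching (ident : Fin k → ℕ) (n : ℕ)
    (c : Configuration (Fin (m + 1) × Fin (m + 1)) Mem k) : Prop where
  id : ∀ i, (c i).mem.core.id = ident i
  mode : ∀ i, (c i).mem.core.mode = .settled ∨ (c i).mem.core.Walks ∨ (c i).mem.core.Grouped
  best : ∀ i, (c i).mem.core.best = 0
  ht : ∀ i, (c i).mem.core.ht = 0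
  col : ∀ i, (c i).mem.core.col = 0
  unique : ∀ i j, (c i).mem.core.mode = .settled → (c j).mem.core.mode = .settled →
    (c i).pos = (c j).pos → i = j
  boundary : ∀ i, (c i).mem.core.Walks → OnBoundary (c i).pos
  together : ∀ i j, (c i).mem.core.Grouped → (c j).mem.core.Grouped →
    (c i).mem.core.tag = (c j).mem.core.tag →
    (c i).pos = (c j).pos ∧ (c i).entry = (c j).entry
  partner : ∀ i, (c i).mem.core.Grouped → ∃ j, (c j).mem.core.Grouped ∧
    (c j).mem.core.tag = (c i).mem.core.tag ∧ (c j).mem.core.mode ≠ (c i).mem.core.mode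
  heading : ∀ i, (c i).mem.core.Grouped → (n = 0 ∧ OnBoundary (c i).pos) ∨
    ∃ a, Heading n a (c i).pos ∧ ¬ OnBoundary a ∧ (c i).entry = some (L.port (c i).pos a)

variable {ident : Fin k → ℕ} {c : Configuration (Fin (m + 1) × Fin (m + 1)) Mem k}

theorem Core.Grouped.ne_settled {κ : Core} (h : κ.Grouped) : κ.mode ≠ .settled := by
  rcases h with h | h <;> simp [h]

theorem Core.Grouped.not_walks {κ : Core} (h : κ.Grouped) : ¬ κ.Walks := by
  rcases h with h | h <;> simp [Core.Walks, h]

theorem nodeDegree_eq_four {x : Fin (m + 1) × Fin (m + 1)} (h : ¬ OnBoundary x) :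
    nodeDegree (squareGrid (m + 1)) x = 4 := by
  rw [← nodeDegree_lt_four] at h
  have := nodeDegree_le_four x
  omega

/-- A group on the boundary dissolves as a whole. Any other group stands on an inner node with an
inner predecessor, where `trials_spec` applies; its members share position and entry port and
therefore decide alike. -/
theorem straight_step {n : ℕ} (hc : Marching L ident n c) :
    Marching L ident (n + 1) (perform L straightMacro c) := by
  rw [straightMacro, perform_cons, perform_append, perform_cons, perform_nil]
  have hb : ∀ i, (applyRule L alignRule c i).pos = (c i).pos ∧
      (applyRule L alignRule c i).mem =
        if (c i).mem.core.Grouped then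
          if OnBoundary (c i).pos then
            { (c i).mem with core := { (c i).mem.core with mode := .walker } }
          else { (c i).mem with
            core := { (c i).mem.core with back := (c i).entry.getD 0 }, cand := 0 }
        else (c i).mem := by
    intro i
    refine ⟨rfl, ?_⟩
    rw [applyRule_mem, alignRule]
    simp only [nodeDegree_lt_four]
  generalize applyRule L alignRule c = b at *
  have hcore : ∀ i, (b i).mem.core.id = (c i).mem.core.id ∧
      (b i).mem.core.best = (c i).mem.core.best ∧ (b i).mem.core.ht = (c i).mem.core.ht ∧
      (b i).mem.core.col = (c i).mem.core.col ∧ (b i).mem.core.tag = (c i).mem.core.tag := by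
    intro i
    rw [(hb i).2]
    split_ifs <;> exact ⟨rfl, rfl, rfl, rfl, rfl⟩
  have hgr : ∀ i, (b i).mem.core.Grouped → (c i).mem.core.Grouped ∧ ¬ OnBoundary (c i).pos ∧
      (b i).mem.core.mode = (c i).mem.core.mode ∧
      (b i).mem.core.back = (c i).entry.getD 0 ∧ (b i).mem.cand = 0 := by
    intro i hi
    rw [(hb i).2] at hi ⊢
    split_ifs at hi ⊢ with h1 h2
    · simp [Core.Grouped] at hi
    · exact ⟨h1, h2, rfl, rfl, rfl⟩
    · exact absurd hi h1
  have hgr' : ∀ i, (c i).mem.core.Grouped → ¬ OnBoundary (c i).pos → (b i).mem.core.Grouped := by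
    intro i hi hi'
    rw [(hb i).2, if_pos hi, if_neg hi']
    exact hi
  have hmode : ∀ i, ¬ (b i).mem.core.Grouped → (b i).mem.core.mode = .settled ∧
      (c i).mem.core.mode = .settled ∨ (b i).mem.core.Walks ∧ OnBoundary (c i).pos := by
    intro i hi
    rw [(hb i).2] at hi ⊢
    split_ifs at hi ⊢ with h1 h2
    · exact .inr ⟨rfl, h2⟩
    · exact absurd h1 hi
    · rcases hc.mode i with h | h | h
      · exact .inl ⟨h, h⟩
      · exact .inr ⟨h, hc.boundary i h⟩
      · exact absurd h h1
  have hnot := perform_trials_of_not L b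
  have hgroup : ∀ i, (b i).mem.core.Grouped → ∃ w, Heading (n + 1) (c i).pos w ∧
      ∀ j, (b j).mem.core.Grouped → (b j).mem.core.tag = (b i).mem.core.tag →
        applyRule L (advanceRule Core.Grouped fun _ => True)
          (perform L ((List.range 3).flatMap trial) b) j =
        ⟨w, (perform L ((List.range 3).flatMap trial) b j).mem,
          some (L.port w (c i).pos)⟩ := by
    intro i hi
    obtain ⟨hi1, hi2, -, -, -⟩ := hgr i hi
    obtain ⟨a, ha, ha', hent⟩ := (hc.heading i hi1).resolve_left fun h => hi2 h.2
    obtain ⟨w, hw1, hw2, hw3⟩ := ha.exists_opposite hi2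
    refine ⟨w, hw1, ?_⟩
    have hmem : ∀ j, (b j).mem.core.InGroup (b i).mem.core.tag →
        (c j).pos = (c i).pos ∧ (c j).entry = (c i).entry := by
      intro j hj
      refine hc.together j i (hgr j hj.1).1 hi1 ?_
      rw [← (hcore j).2.2.2.2, ← (hcore i).2.2.2.2]
      exact hj.2
    have hA := trials_spec L (κ := fun j => (b j).mem.core) (g := (b i).mem.core.tag)
      nodeDegree_le_four ha.adj.symm hw1.adj hw2 (nodeDegree_eq_four hi2)
      (nodeDegree_eq_four ha') hw3
      (fun j hj => by
        obtain ⟨l, hl1, hl2, hl3⟩ := hc.partner j (hgr j hj.1).1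
        have hlp := (hc.together l j hl1 (hgr j hj.1).1 hl2).1
        have hl := hgr' l hl1 (by rw [hlp]; exact (hgr j hj.1).2.1)
        refine ⟨l, ⟨hl, ?_⟩, ?_⟩
        · rw [(hcore l).2.2.2.2, hl2, ← (hcore j).2.2.2.2]; exact hj.2
        · rw [(hgr l hl).2.2.1, (hgr j hj.1).2.2.1]; exact hl3)
      (fun j hj => by
        rw [(hgr j hj.1).2.2.2.1, (hmem j hj).2, hent, Option.getD_some])
      (b := b) ⟨fun _ => rfl, fun j hj => by rw [(hb j).1, (hmem j hj).1],
        fun j hj => (hgr j hj.1).2.2.2.2⟩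
    intro j hj1 hj2
    have hj : (b j).mem.core.InGroup (b i).mem.core.tag := ⟨hj1, hj2⟩
    rw [applyRule_advanceRule L (w := w) (by rwa [hA.core]) trivial
      (by rw [hA.pos j hj]; exact hw1.adj) (by rw [hA.cand j hj, hA.pos j hj]), hA.pos j hj]
  have hstay : ∀ i, ¬ (b i).mem.core.Grouped →
      (applyRule L (advanceRule Core.Grouped fun _ => True)
          (perform L ((List.range 3).flatMap trial) b) i).pos = (c i).pos := by
    intro i hi
    rw [applyRule_advanceRule_of_not L (by rw [(hnot i).1]; tauto), (hnot i).2 hi, (hb i).1]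
  have hcore' : ∀ i, (applyRule L (advanceRule Core.Grouped fun _ => True)
      (perform L ((List.range 3).flatMap trial) b) i).mem.core = (b i).mem.core := by
    intro i
    rw [applyRule_mem]
    exact (hnot i).1
  generalize applyRule L (advanceRule Core.Grouped fun _ => True)
    (perform L ((List.range 3).flatMap trial) b) = d at *
  refine ⟨?_, ?_, ?_, ?_, ?_, ?_, ?_, ?_, ?_, ?_⟩ <;> simp only [hcore']
  · intro i; rw [(hcore i).1, hc.id]
  · intro i
    by_cases h : (b i).mem.core.Grouped
    · exact .inr (.inr h)
    · exact (hmode i h).imp (fun h => h.1) (fun h => .inl h.1)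
  · intro i; rw [(hcore i).2.1, hc.best]
  · intro i; rw [(hcore i).2.2.1, hc.ht]
  · intro i; rw [(hcore i).2.2.2.1, hc.col]
  · intro i j hi hj hij
    have hgi : ¬ (b i).mem.core.Grouped := fun h => h.ne_settled hi
    have hgj : ¬ (b j).mem.core.Grouped := fun h => h.ne_settled hj
    rw [hstay i hgi, hstay j hgj] at hij
    refine hc.unique i j ?_ ?_ hij
    · exact ((hmode i hgi).resolve_right fun h => h.1.ne_settled hi).2
    · exact ((hmode j hgj).resolve_right fun h => h.1.ne_settled hj).2
  · intro i hi
    have hgi : ¬ (b i).mem.core.Grouped := fun h => h.not_walks hi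
    rw [hstay i hgi]
    exact ((hmode i hgi).resolve_left fun h => hi.ne_settled h.1).2
  · intro i j hi hj hij
    obtain ⟨w, -, hw⟩ := hgroup i hi
    rw [hw i hi rfl, hw j hj hij.symm]
    exact ⟨rfl, rfl⟩
  · intro i hi
    obtain ⟨l, hl1, hl2, hl3⟩ := hc.partner i (hgr i hi).1
    have hlp := (hc.together l i hl1 (hgr i hi).1 hl2).1
    have hl := hgr' l hl1 (by rw [hlp]; exact (hgr i hi).2.1)
    refine ⟨l, hl, ?_, ?_⟩
    · rw [(hcore l).2.2.2.2, hl2, ← (hcore i).2.2.2.2]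
    · rw [(hgr l hl).2.2.1, (hgr i hi).2.2.1]; exact hl3
  · intro i hi
    obtain ⟨w, hw1, hw⟩ := hgroup i hi
    right
    refine ⟨(c i).pos, ?_, (hgr i hi).2.1, ?_⟩ <;> rw [hw i hi rfl]
    exact hw1

/-- The least identifier on a node. -/
noncomputable def leastId (ident : Fin k → ℕ) (start : Fin k → Fin (m + 1) × Fin (m + 1))
    (x : Fin (m + 1) × Fin (m + 1)) : ℕ :=
  sInf {a | ∃ j, start j = x ∧ ident j = a}

/-- Two or more robots on a node yield both an anchor, the one of least identifier, and a scout, so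
every member has a partner. From an inner node all leave through port `1`, which fixes an arbitrary
direction. -/
theorem form_spec (hident : Function.Injective ident)
    (start : Fin k → Fin (m + 1) × Fin (m + 1)) :
    Marching L ident 0 (applyRule L formRule fun i => ⟨start i, initialMem (ident i), none⟩) := by
  have hleast : ∀ i, ∃ j, start j = start i ∧ ident j = leastId ident start (start i) :=
    fun i => Nat.sInf_mem (s := {a | ∃ j, start j = start i ∧ ident j = a}) ⟨_, i, rfl, rfl⟩
  have hb : ∀ i, applyRule L formRule (fun i => ⟨start i, initialMem (ident i), none⟩) i =
      if ∀ j, start j = start i → j = i then ⟨start i, initialMem (ident i), none⟩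
      else L.relocate (start i) { initialMem (ident i) with
        core := { (initialMem (ident i)).core with
          tag := leastId ident start (start i)
          mode := if ident i = leastId ident start (start i) then .anchor else .scout } }
        (if OnBoundary (start i) then none else some 1) := by
    intro i
    have h0 : (Configuration.others (fun i => (⟨start i, initialMem (ident i), none⟩ :
        RobotStatus (Fin (m + 1) × Fin (m + 1)) Mem)) i = 0) ↔
        ∀ j, start j = start i → j = i := by
      rw [Multiset.eq_zero_iff_forall_notMem]
      constructor
      · intro h j hj
        by_contra hne
        exact h _ (Configuration.mem_others.2 ⟨j, hne, hj, rfl⟩)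
      · intro h σ hσ
        obtain ⟨j, hne, hj, -⟩ := Configuration.mem_others.1 hσ
        exact hne (h j hj)
    have hset : {a | a = (initialMem (ident i)).core.id ∨
        ∃ τ ∈ Configuration.others (fun i => (⟨start i, initialMem (ident i), none⟩ :
          RobotStatus (Fin (m + 1) × Fin (m + 1)) Mem)) i, τ.core.id = a} =
        {a | ∃ j, start j = start i ∧ ident j = a} := by
      ext a
      simp only [Set.mem_ofPred_eq, Configuration.exists_mem_others]
      constructor
      · rintro (rfl | ⟨j, -, hj, rfl⟩)
        · exact ⟨i, rfl, rfl⟩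
        · exact ⟨j, hj, rfl⟩
      · rintro ⟨j, hj, rfl⟩
        by_cases h : j = i
        · subst h; exact .inl rfl
        · exact .inr ⟨j, h, hj, rfl⟩
    rw [applyRule, formRule]
    simp only [h0, hset, nodeDegree_lt_four]
    by_cases h : ∀ j, start j = start i → j = i
    · rw [if_pos h, if_pos h]; rfl
    · rw [if_neg h, if_neg h]; rfl
  generalize applyRule L formRule (fun i => ⟨start i, initialMem (ident i), none⟩) = b at *
  have hgr : ∀ i, (b i).mem.core.Grouped → ¬ ∀ j, start j = start i → j = i := by
    intro i hi h
    rw [hb, if_pos h] at hi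
    simp [Core.Grouped, initialMem] at hi
  have hgr' : ∀ i, (¬ ∀ j, start j = start i → j = i) → (b i).mem.core.Grouped ∧
      (b i).mem.core.tag = leastId ident start (start i) ∧
      (b i).mem.core.mode =
        if ident i = leastId ident start (start i) then .anchor else .scout := by
    intro i h
    rw [hb, if_neg h]
    simp only [PortLabeling.relocate_mem, Core.Grouped, and_self, and_true]
    split_ifs <;> simp
  have hset : ∀ i, (b i).mem.core.mode = .settled →
      (∀ j, start j = start i → j = i) ∧ (b i).pos = start i := by
    intro i hi
    have h : ∀ j, start j = start i → j = i := by
      by_contra h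
      exact (hgr' i h).1.ne_settled hi
    exact ⟨h, by rw [hb, if_pos h]⟩
  have hmode : ∀ i, (b i).mem.core.mode = .settled ∨ (b i).mem.core.Grouped := by
    intro i
    by_cases h : ∀ j, start j = start i → j = i
    · left; rw [hb, if_pos h]; rfl
    · exact .inr (hgr' i h).1
  refine ⟨?_, ?_, ?_, ?_, ?_, ?_, ?_, ?_, ?_, ?_⟩
  · intro i; rw [hb]; split_ifs <;> simp [initialMem]
  · exact fun i => (hmode i).imp_right .inr
  · intro i; rw [hb]; split_ifs <;> simp [initialMem]
  · intro i; rw [hb]; split_ifs <;> simp [initialMem]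
  · intro i; rw [hb]; split_ifs <;> simp [initialMem]
  · intro i j hi hj hij
    rw [(hset i hi).2, (hset j hj).2] at hij
    exact (hset j hj).1 i hij
  · intro i hi
    rcases hmode i with h | h
    · exact absurd h hi.ne_settled
    · exact absurd hi h.not_walks
  · intro i j hi hj hij
    rw [(hgr' i (hgr i hi)).2.1, (hgr' j (hgr j hj)).2.1] at hij
    have hs : start i = start j := by
      obtain ⟨p, hp, hp'⟩ := hleast i
      obtain ⟨q, hq, hq'⟩ := hleast j
      rw [← hp', ← hq'] at hij
      rw [← hp, ← hq, hident hij]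
    rw [hb i, hb j, if_neg (hgr i hi), if_neg (hgr j hj), hs]
    by_cases h : OnBoundary (start j)
    · rw [if_pos h]; exact ⟨rfl, rfl⟩
    · rw [if_neg h]; exact ⟨rfl, rfl⟩
  · intro i hi
    have hi' := hgr i hi
    have hcompany : ∀ j, start j = start i → ¬ ∀ l, start l = start j → l = j := by
      intro j hj h
      apply hi'
      intro l hl
      rw [h l (hl.trans hj.symm), h i hj.symm]
    obtain ⟨-, htag, hmi⟩ := hgr' i hi'
    have hfinish : ∀ j, start j = start i →
        (ident j = leastId ident start (start i) ↔ ¬ ident i = leastId ident start (start i)) →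
        ∃ j, (b j).mem.core.Grouped ∧ (b j).mem.core.tag = (b i).mem.core.tag ∧
          (b j).mem.core.mode ≠ (b i).mem.core.mode := by
      intro j hj hiff
      obtain ⟨h1, h2, h3⟩ := hgr' j (hcompany j hj)
      refine ⟨j, h1, by rw [h2, htag, hj], ?_⟩
      rw [h3, hmi, hj]
      by_cases h : ident i = leastId ident start (start i) <;> simp [hiff, h]
    by_cases h : ident i = leastId ident start (start i)
    · push Not at hi'
      obtain ⟨j, hj, hne⟩ := hi'
      refine hfinish j hj ?_
      simp only [h, not_true_eq_false, iff_false]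
      intro h'
      exact hne (hident (h'.trans h.symm))
    · obtain ⟨j, hj, hj'⟩ := hleast i
      exact hfinish j hj (by simp [hj', h])
  · intro i hi
    rw [hb, if_neg (hgr i hi)]
    by_cases h : OnBoundary (start i)
    · rw [if_pos h]
      exact .inl ⟨rfl, h⟩
    · rw [if_neg h]
      right
      have h1 : 1 ∈ Set.Icc 1 (nodeDegree (squareGrid (m + 1)) (start i)) := by
        rw [nodeDegree_eq_four h]; simp
      rw [L.relocate_some _ _ h1]
      exact ⟨start i, heading_zero (L.adj_follow h1) h, h, rfl⟩

/-- After the first part of the algorithm, all robots are settled or on the boundary. -/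
theorem outwardPart_spec (hident : Function.Injective ident)
    (start : Fin k → Fin (m + 1) × Fin (m + 1)) :
    Calm ident (perform L (outwardPart m) fun i => ⟨start i, initialMem (ident i), none⟩) := by
  rw [outwardPart, perform_cons]
  have hM := form_spec L hident start
  generalize applyRule L formRule (fun i => ⟨start i, initialMem (ident i), none⟩) = b at *
  have key : ∀ n, Marching L ident n (perform L ((List.range n).flatMap fun _ => straightMacro) b) := by
    intro n
    induction n with
    | zero => exact hM
    | succ n ih => rw [perform_flatMap_range_succ]; exact straight_step L ih
  have h := key (m + 1)
  refine ⟨h.id, fun i => ?_, h.best, h.ht, h.col, h.unique, h.boundary⟩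
  refine (h.mode i).imp_right fun h' => h'.resolve_right fun hg => ?_
  obtain ⟨a, ha, -⟩ := (h.heading i hg).resolve_left fun h => by omega
  exact not_heading ha

end outward

/-! ### The size of the memory -/

section memory

/-- The memory contents with identifiers less than `B` and other numbers at most `D`. -/
def boundedMem (B D : ℕ) : Set Mem :=
  {σ | σ.core.id < B ∧ σ.core.tag < B ∧ σ.core.best ≤ B ∧ σ.core.idx ≤ D ∧ σ.core.back ≤ D ∧
    σ.core.col ≤ D + 1 ∧ σ.core.tcol ≤ D ∧ σ.core.ht ≤ D ∧ σ.cand ≤ D ∧ σ.ret ≤ D}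

theorem initialMem_mem {a B D : ℕ} (h : a < B) : initialMem a ∈ boundedMem B D := by
  simp [boundedMem, initialMem, h, Nat.zero_lt_of_lt h]

theorem turn_four_le (e i : ℕ) : turn 4 e i ≤ 4 := by
  unfold turn
  omega

variable {B D : ℕ} {A : Core → Prop}

theorem RoundRule.keeps_of_fst {f : RoundRule Mem} (h : ∀ d e σ o, (f d e σ o).1 = σ) :
    f.Keeps (boundedMem B D) D := by
  intro d e σ o _ hσ _ _
  rwa [h]

theorem keeps_outRule (p : ℕ) : (outRule A p).Keeps (boundedMem B D) D :=
  RoundRule.keeps_of_fst fun _ _ _ _ => rfl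

theorem keeps_advanceRule (go : ℕ → Prop) : (advanceRule A go).Keeps (boundedMem B D) D :=
  RoundRule.keeps_of_fst fun _ _ _ _ => rfl

theorem keeps_convoyRule : convoyRule.Keeps (boundedMem B D) D :=
  RoundRule.keeps_of_fst fun _ _ _ _ => rfl

theorem keeps_spreadRule (i j : ℕ) : (spreadRule i j).Keeps (boundedMem B D) D :=
  RoundRule.keeps_of_fst fun _ _ _ _ => rfl

theorem getD_le {e : Option ℕ} (he : ∀ p ∈ e, p ≤ D) : e.getD 0 ≤ D := by
  cases e with
  | none => exact Nat.zero_le _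
  | some p => exact he p rfl

theorem keeps_checkRule (Q : ℕ → ℕ → Core → Set Core → Prop) {p : ℕ} (hp : p ≤ D) :
    (checkRule A Q p).Keeps (boundedMem B D) D := by
  intro d e σ o _ hσ _ _
  unfold checkRule
  simp only [boundedMem, Set.mem_ofPred_eq] at hσ ⊢
  split_ifs <;> simp only [hσ, hp, and_self]

theorem keeps_orientRule : (orientRule A).Keeps (boundedMem B D) D := by
  intro d e σ o he hσ _ _
  unfold orientRule
  simp only [boundedMem, Set.mem_ofPred_eq] at hσ ⊢
  split_ifs <;> simp only [hσ, getD_le he, Nat.zero_le, and_self]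

theorem keeps_formRule : formRule.Keeps (boundedMem B D) D := by
  intro d e σ o _ hσ _ _
  unfold formRule
  have h : sInf {a | a = σ.core.id ∨ ∃ τ ∈ o, τ.core.id = a} < B :=
    (Nat.sInf_le (.inl rfl)).trans_lt hσ.1
  simp only [boundedMem, Set.mem_ofPred_eq] at hσ ⊢
  by_cases h0 : o = 0
  · simp only [h0, if_true, hσ, and_self]
  · simp only [h0, if_false, hσ, h, and_self]

theorem keeps_alignRule : alignRule.Keeps (boundedMem B D) D := by
  intro d e σ o he hσ _ _
  unfold alignRule
  simp only [boundedMem, Set.mem_ofPred_eq] at hσ ⊢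
  split_ifs <;> simp only [hσ, getD_le he, Nat.zero_le, and_self]

theorem keeps_departRule (q : ℕ) : (departRule q).Keeps (boundedMem B D) D := by
  intro d e σ o he hσ _ _
  unfold departRule
  simp only [boundedMem, Set.mem_ofPred_eq] at hσ ⊢
  by_cases h : σ.core.Grouped <;> simp only [h, if_true, if_false, hσ, and_self]

theorem keeps_recordRule : recordRule.Keeps (boundedMem B D) D := by
  intro d e σ o he hσ _ _
  unfold recordRule
  simp only [boundedMem, Set.mem_ofPred_eq] at hσ ⊢
  split_ifs <;> simp only [hσ, getD_le he, and_self]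

theorem keeps_meetRule : meetRule.Keeps (boundedMem B D) D := by
  intro d e σ o he hσ _ _
  unfold meetRule
  simp only [boundedMem, Set.mem_ofPred_eq] at hσ ⊢
  by_cases h : σ.core.Grouped <;> simp only [h, if_true, if_false, hσ, and_self]

theorem keeps_rejoinRule (hD : 4 ≤ D) (q : ℕ) : (rejoinRule q).Keeps (boundedMem B D) D := by
  intro d e σ o he hσ _ _
  unfold rejoinRule
  have := (turn_four_le σ.core.back q).trans hD
  simp only [boundedMem, Set.mem_ofPred_eq] at hσ ⊢
  split_ifs <;> simp only [hσ, this, and_self]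

theorem keeps_settleRule : settleRule.Keeps (boundedMem B D) D := by
  intro d e σ o he hσ _ _
  unfold settleRule
  simp only [boundedMem, Set.mem_ofPred_eq] at hσ ⊢
  split_ifs <;> simp only [hσ, getD_le he, Nat.zero_le, and_self]

theorem keeps_noteRule {n : ℕ} (hn : n ≤ D) : (noteRule n).Keeps (boundedMem B D) D := by
  intro d e σ o he hσ ho _
  unfold noteRule
  have h : (∃ τ ∈ o, τ.core.Walks) →
      sInf {a | ∃ τ ∈ o, τ.core.Walks ∧ τ.core.id = a} + 1 ≤ B := by
    rintro ⟨τ, hτ, hw⟩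
    have hle : sInf {a | ∃ τ ∈ o, τ.core.Walks ∧ τ.core.id = a} ≤ τ.core.id :=
      Nat.sInf_le ⟨τ, hτ, hw, rfl⟩
    exact Nat.succ_le_of_lt (hle.trans_lt (ho τ hτ).1)
  simp only [boundedMem, Set.mem_ofPred_eq] at hσ ⊢
  split_ifs with h1 h2
  · simp only [hσ, getD_le he, Nat.zero_le, and_self]
  · simp only [hσ, h h2.2.1, hn, and_self]
  · exact hσ

theorem keeps_enlistRule (m : ℕ) : (enlistRule m).Keeps (boundedMem B D) D := by
  intro d e σ o he hσ ho _
  unfold enlistRule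
  simp only [boundedMem, Set.mem_ofPred_eq] at hσ ⊢
  split_ifs <;> simp only [hσ, and_self]

theorem keeps_locateRule : locateRule.Keeps (boundedMem B D) D := by
  intro d e σ o he hσ ho _
  unfold locateRule
  simp only [boundedMem, Set.mem_ofPred_eq] at hσ ⊢
  split_ifs with h1 h2
  · exact hσ
  · have := (ho _ h2.choose_spec.1).2.2.2.1
    simp only [hσ, Nat.zero_le, add_le_add_iff_right, this, and_self]
  · simp only [hσ, Nat.zero_le, and_self]

theorem keeps_rankRule (s : ℕ) : (rankRule s).Keeps (boundedMem B D) D := by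
  intro d e σ o he hσ ho hcard
  unfold rankRule
  have h : Multiset.card (o.filter fun τ => ¬ τ.core.Sweeps ∧ τ.core.id < σ.core.id) < D :=
    (Multiset.card_le_card (Multiset.filter_le _ _)).trans_lt hcard
  generalize Multiset.card (o.filter fun τ => ¬ τ.core.Sweeps ∧ τ.core.id < σ.core.id) = r at *
  have h1 : r % s ≤ D := (Nat.mod_le _ _).trans h.le
  have h2 : r / s + 1 ≤ D := Nat.succ_le_of_lt ((Nat.div_le_self _ _).trans_lt h)
  simp only [boundedMem, Set.mem_ofPred_eq] at hσ ⊢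
  by_cases hr : ¬ σ.core.Sweeps ∧ ∃ τ ∈ o, τ.core.Sweeps
  · simp only [if_pos hr, hσ, h1, h2, and_self]
  · simp only [if_neg hr, hσ, and_self]

theorem keeps_resetRule : resetRule.Keeps (boundedMem B D) D := by
  intro d e σ o he hσ ho _
  unfold resetRule
  simp only [boundedMem, Set.mem_ofPred_eq] at hσ ⊢
  simp only [hσ, Nat.zero_le, and_self]

/-- `4 ≤ D` accommodates the ports and `4 * m ≤ D` the visiting times noted during the tour. -/
theorem keeps_dispersionProgram {m : ℕ} (hD : 4 ≤ D) (hmD : 4 * m ≤ D) :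
    ∀ f ∈ dispersionProgram m, f.Keeps (boundedMem B D) D := by
  have hcheck : ∀ (A : Core → Prop) Q, ∀ p ≤ 4, (checkRule A Q p).Keeps (boundedMem B D) D :=
    fun A Q p hp => keeps_checkRule Q (hp.trans hD)
  simp only [dispersionProgram, outwardPart, finalPart, List.forall_mem_cons,
    List.forall_mem_append]
  refine ⟨⟨keeps_formRule, forall_mem_flatMap_range fun _ _ => ?_⟩,
    forall_mem_flatMap_range fun _ _ =>
      forall_mem_ringMacro keeps_settleRule keeps_outRule (hcheck _ _) (keeps_advanceRule _),
    forall_mem_flatMap_range fun _ _ =>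
      forall_mem_ringMacro keeps_orientRule keeps_outRule (hcheck _ _) (keeps_advanceRule _),
    forall_mem_flatMap_range fun n hn =>
      forall_mem_ringMacro (keeps_noteRule (hn.le.trans hmD)) keeps_outRule (hcheck _ _)
        (keeps_advanceRule _),
    keeps_enlistRule m,
    forall_mem_flatMap_range fun _ _ => forall_mem_sweepMacro keeps_orientRule
      (fun _ _ => keeps_outRule) (fun _ _ => hcheck _ _) keeps_convoyRule,
    forall_mem_flatMap_range fun _ _ =>
      forall_mem_shiftMacro keeps_locateRule keeps_outRule (hcheck _ _) (keeps_advanceRule _),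
    keeps_rankRule _,
    forall_mem_flatMap_range fun _ _ =>
      forall_mem_shiftMacro keeps_locateRule keeps_outRule (hcheck _ _) (keeps_advanceRule _),
    forall_mem_flatMap_range fun _ _ =>
      forall_mem_stackMacro keeps_resetRule keeps_outRule (hcheck _ _) (keeps_advanceRule _)⟩
  simp only [straightMacro, List.forall_mem_cons, List.forall_mem_append, List.not_mem_nil,
    IsEmpty.forall_iff, implies_true, and_true]
  exact ⟨keeps_alignRule, forall_mem_trials keeps_departRule keeps_recordRule keeps_spreadRule
    keeps_meetRule (keeps_rejoinRule hD), keeps_advanceRule _⟩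

theorem finite_and_card_le_pow {X : Type} {n E : ℕ} (f : X → Fin n → ℕ)
    (hf : Function.Injective f) (hlt : ∀ x i, f x i < E) : Finite X ∧ Nat.card X ≤ E ^ n := by
  have hg : Function.Injective fun x i => (⟨f x i, hlt x i⟩ : Fin E) := fun x y h =>
    hf (funext fun i => congrArg Fin.val (congrFun h i))
  exact ⟨Finite.of_injective _ hg, by simpa using Nat.card_le_card_of_injective _ hg⟩

/-- A number that stands for a mode. -/
def Mode.code : Mode → ℕ
  | settled => 0
  | scout => 1
  | anchor => 2
  | walker => 3
  | sweeper => 4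

theorem Mode.code_injective : Function.Injective Mode.code := by
  intro a b h
  cases a <;> cases b <;> first | rfl | exact absurd h (by decide)

theorem Mode.code_lt (a : Mode) : a.code < 5 := by
  cases a <;> decide

/-- The entries of a memory content. -/
def Mem.entries (σ : Mem) : Fin 12 → ℕ :=
  ![σ.core.id, σ.core.mode.code, σ.core.tag, σ.core.best, σ.core.idx, σ.core.back, σ.core.col,
    σ.core.tcol, σ.core.ht, σ.cand, σ.ret, σ.met.toNat]

theorem Mem.entries_injective : Function.Injective Mem.entries := by
  rintro ⟨⟨a0, a1, a2, a3, a4, a5, a6, a7, a8⟩, a9, a10, a11⟩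
    ⟨⟨b0, b1, b2, b3, b4, b5, b6, b7, b8⟩, b9, b10, b11⟩ h
  have h := fun i => congrFun h i
  have h11 : a11.toNat = b11.toNat := h 11
  obtain rfl : a11 = b11 := by cases a11 <;> cases b11 <;> simp_all
  obtain rfl := Mode.code_injective (h 1)
  obtain rfl : a0 = b0 := h 0
  obtain rfl : a2 = b2 := h 2
  obtain rfl : a3 = b3 := h 3
  obtain rfl : a4 = b4 := h 4
  obtain rfl : a5 = b5 := h 5
  obtain rfl : a6 = b6 := h 6
  obtain rfl : a7 = b7 := h 7
  obtain rfl : a8 = b8 := h 8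
  obtain rfl : a9 = b9 := h 9
  obtain rfl : a10 = b10 := h 10
  rfl

theorem Mem.entries_lt {σ : Mem} {E : ℕ} (h : σ ∈ boundedMem B D) (hE : 5 ≤ E) (hB : B < E)
    (hD : D + 1 < E) (i : Fin 12) : σ.entries i < E := by
  obtain ⟨h0, h2, h3, h4, h5, h6, h7, h8, h9, h10⟩ := h
  have h1 := σ.core.mode.code_lt
  have h11 := Bool.toNat_lt σ.met
  fin_cases i <;> simp [Mem.entries] <;> omega

/-- Thirteen numbers below `2 ^ e`: the clock and the twelve entries of the memory. -/
theorem clockedProtocol_usesBits {prog : List (RoundRule Mem)} {start : ℕ → Mem}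
    (d : boundedMem B D) {e : ℕ} (hE : 5 ≤ 2 ^ e) (hB : B < 2 ^ e) (hD : D + 1 < 2 ^ e)
    (hprog : prog.length < 2 ^ e) :
    (clockedProtocol prog start (boundedMem B D) d).UsesBits (13 * e) := by
  rw [Protocol.UsesBits, mul_comm 13 e, pow_mul]
  refine finite_and_card_le_pow
    (fun x : Fin (prog.length + 1) × boundedMem B D => Fin.cons (x.1 : ℕ) (x.2 : Mem).entries)
    ?_ ?_
  · rintro ⟨t, σ⟩ ⟨t', σ'⟩ h
    have h := Fin.cons_inj.1 h
    exact Prod.ext (Fin.ext h.1) (Subtype.ext (Mem.entries_injective h.2))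
  · rintro ⟨t, σ⟩ i
    refine Fin.cases ?_ (fun i => ?_) i
    · exact (Nat.lt_succ_iff.1 t.2).trans_lt hprog
    · exact Mem.entries_lt σ.2 hE hB hD i

end memory

/-! ### The theorem -/

theorem perform_dispersionProgram {m k : ℕ} (L : PortLabeling (squareGrid (m + 1))) (hm : 0 < m)
    (hk : k ≤ (m + 1) ^ 2) {ident : Fin k → ℕ} (hident : Function.Injective ident)
    (start : Fin k → Fin (m + 1) × Fin (m + 1)) (i j : Fin k)
    (hij : (perform L (dispersionProgram m) (fun i => ⟨start i, initialMem (ident i), none⟩) i).pos =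
      (perform L (dispersionProgram m) (fun i => ⟨start i, initialMem (ident i), none⟩) j).pos) :
    i = j := by
  rw [dispersionProgram, perform_append, perform_append] at hij
  obtain ⟨hc, hfull⟩ := settlePart_spec L hm hident (outwardPart_spec L hident start)
  exact finalPart_spec L hm hident hk hc hfull i j hij

/-- The protocol that terminates immediately. -/
def idleProtocol : Protocol where
  State := Unit
  init _ := ()
  halted := Set.univ
  step _ _ _ _ := ((), none)

/-- The algorithm for grids with `n` nodes and identifiers of at most `c (log₂ n + 1)` bits. -/
noncomputable def dispersionProtocol (c n : ℕ) : Protocol :=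
  if n ≤ 1 then idleProtocol
  else clockedProtocol (dispersionProgram (Nat.sqrt n - 1)) initialMem
    (boundedMem (2 ^ (c * (Nat.log 2 n + 1))) (4 * n))
    ⟨initialMem 0, initialMem_mem (by positivity)⟩

theorem dispersionProtocol_usesBits (c s : ℕ) :
    (dispersionProtocol c (s ^ 2)).UsesBits (13 * (2 * c + 10) * Nat.log 2 (s ^ 2)) := by
  by_cases hs : s ^ 2 ≤ 1
  · rw [dispersionProtocol, if_pos hs]
    refine ⟨inferInstanceAs (Finite Unit), ?_⟩
    have h : Nat.card Unit ≤ 1 := by simp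
    exact h.trans Nat.one_le_two_pow
  · rw [dispersionProtocol, if_neg hs, mul_assoc]
    have hs2 : 2 ≤ s := by
      by_contra h
      interval_cases s <;> simp at hs
    have hl : 2 ≤ Nat.log 2 (s ^ 2) := by
      apply Nat.le_log_of_pow_le (by norm_num)
      gcongr
    have hlt : s ^ 2 < 2 ^ (Nat.log 2 (s ^ 2) + 1) := Nat.lt_pow_succ_log_self (by norm_num) _
    have hss : s ≤ s ^ 2 := Nat.le_self_pow (by norm_num) s
    -- `2 ^ (log₂ n + 9)` exceeds `256 n`, which dominates `4 n + 1` and the length of the program.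
    -- The summand `2 * c` pays for identifiers of `c (log₂ n + 1)` bits.
    have h1 : 2 ^ (Nat.log 2 (s ^ 2) + 9) ≤ 2 ^ ((2 * c + 10) * Nat.log 2 (s ^ 2)) :=
      Nat.pow_le_pow_right (by norm_num) (by nlinarith)
    have h2 : 2 ^ (Nat.log 2 (s ^ 2) + 9) = 256 * 2 ^ (Nat.log 2 (s ^ 2) + 1) := by ring
    apply clockedProtocol_usesBits
    · omega
    · exact Nat.pow_lt_pow_right (by norm_num) (by nlinarith)
    · omega
    · rw [dispersionProgram_length, Nat.sqrt_eq']
      omega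

theorem dispersionProtocol_dispersed {c s k : ℕ} (hs : 0 < s) (L : PortLabeling (squareGrid s))
    (hk : k ≤ s ^ 2) {ident : Fin k → ℕ} (hident : Function.Injective ident)
    (hsize : ∀ i, Nat.size (ident i) ≤ c * (Nat.log 2 k + 1))
    (start : Fin k → Fin s × Fin s) :
    ∃ T ≤ 195 * s, (dispersionProtocol c (s ^ 2)).Dispersed
      ((dispersionProtocol c (s ^ 2)).run L ident start T) := by
  obtain ⟨m, rfl⟩ : ∃ m, s = m + 1 := ⟨s - 1, by omega⟩
  rcases Nat.eq_zero_or_pos m with rfl | hm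
  -- On a single node the boundary cycle degenerates; there is at most one robot, and it halts at
  -- once.
  · rw [dispersionProtocol, if_pos (by simp)]
    refine ⟨0, Nat.zero_le _, fun i j _ => ?_, fun i => Set.mem_univ _⟩
    have : Subsingleton (Fin k) := Fin.subsingleton_iff_le_one.2 (by simpa using hk)
    exact Subsingleton.elim i j
  · have hn : ¬ (m + 1) ^ 2 ≤ 1 := by nlinarith
    have hsq : Nat.sqrt ((m + 1) ^ 2) - 1 = m := by rw [Nat.sqrt_eq']; rfl
    rw [dispersionProtocol, if_neg hn, hsq]
    refine ⟨(dispersionProgram m).length, by rw [dispersionProgram_length]; omega, ?_⟩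
    refine clockedProtocol_dispersed L (D := 4 * (m + 1) ^ 2)
      (fun v => (nodeDegree_le_four v).trans (by nlinarith)) (by omega)
      (keeps_dispersionProgram (by omega) (by nlinarith)) (fun i => initialMem_mem ?_) start
      (perform_dispersionProgram L hm hk hident start)
    -- Identifiers are bounded in terms of `k`, which the algorithm does not know; `k ≤ n` allows a
    -- bound in terms of `n`.
    refine (Nat.lt_size_self _).trans_le (Nat.pow_le_pow_right (by norm_num) ((hsize i).trans ?_))
    gcongr

/-- For every constant `c` in the `O(log k)` bound on the length of the identifiers there are a
constant `C` and a deterministic algorithm `A` (which knows the number `n = s ^ 2` of nodes, but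
neither the port labelling nor the number `k` of robots) that solves dispersion on every unoriented
`s × s` grid within `195 √n = 195 s` rounds, with at most `C log₂ n` bits of memory per robot. -/
theorem mainTheorem2 (c : ℕ) :
    ∃ (C : ℕ) (A : ℕ → Protocol), ∀ s : ℕ, 0 < s →
      (A (s ^ 2)).UsesBits (C * Nat.log 2 (s ^ 2)) ∧
      ∀ (L : PortLabeling (squareGrid s)) (k : ℕ), k ≤ s ^ 2 →
        ∀ ident : Fin k → ℕ, Function.Injective ident →
          (∀ i, Nat.size (ident i) ≤ c * (Nat.log 2 k + 1)) →
          ∀ start : Fin k → Fin s × Fin s,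
            ∃ T ≤ 195 * s, (A (s ^ 2)).Dispersed ((A (s ^ 2)).run L ident start T) :=
  ⟨13 * (2 * c + 10), dispersionProtocol c, fun s hs => ⟨dispersionProtocol_usesBits c s,
    fun L _ hk _ hident hsize start => dispersionProtocol_dispersed hs L hk hident hsize start⟩⟩
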